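/- Let $H$ be a real separable Hilbert space. On $S(H)=H\times H$ (with the product inner product) consider the symplectic form $\omega((u_1,v_1),(u_2,v_2))=\langle v_2,u_1\rangle-\langle v_1,u_2\rangle$; a subspace $L$ is Lagrangian if it equals its $\omega$-orthogonal. The set $\Lambda(H)$ of Lagrangian subspaces carries the gap metric $\|P_L-P_{L'}\|$, where $P_L$ is the orthogonal projector onto $L$. Let $\mathcal C_{\rm gap}(H)$ be the set of all (possibly unbounded) self-adjoint Fredholm operators on $H$, with the topology induced by $A\mapsto \mathrm{Gr}\,A\in\Lambda(H)$. For $a\le b$, an admissible path is a continuous map $\mathcal A\colon[a,b]\to\mathcal C_{\rm gap}(H)$ with $\mathrm{Ker}\,A_a=\mathrm{Ker}\,A_b=\{0\}$. Its spectral flow $\mathrm{sf}(\mathcal A,[a,b])\in\mathbb Z$ is defined as follows. Choose a closed subspace $I\subset H$ of finite codimension such that, for all $\lambda\in[a,b]$, $\mathrm{Gr}\,A_\lambda\cap(I\times\{0\})=\{0\}$ and $\mathrm{Gr}\,A_\lambda+(I\times\{0\})$ is closed. With $F=I^\perp$, let $l(\lambda)=\{(P_Fx,y): (x,y)\in \mathrm{Gr}\,A_\lambda,\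 y\in F\}\in\Lambda(F)$. Close up the path $l$ by a path from $l(b)$ to $l(a)$ consisting of Lagrangian subspaces of $F\times F$ transverse to $F\times\{0\}$. Then $\mathrm{sf}(\mathcal A,[a,b])$ is the winding number along the resulting loop of the map $\Lambda(F)\to S^1$, $L\mapsto(\det U)^2$, where $U$ is any unitary map of $F\times F\cong F\otimes\mathbb C$ (with $(x,y)\leftrightarrow x+iy$) sending $F\times\{0\}$ onto $L$. Then for every admissible path $\mathcal A\colon[a,b]\to\mathcal C_{\rm gap}(H)$ the integer $\mathrm{sf}(\mathcal A,[a,b])$ is well defined (such choices exist and the result does not depend on them), and it has the following properties. (i) Normalization. If $\mathrm{Ker}\,A_\lambda=\{0\}$ for all $\lambda\in[a,b]$, then $\mathrm{sf}(\mathcal A,[a,b])=0$. (ii) Homotopy invariance. If $\mathcal H\colon[0,1]\times[a,b]\to\mathcal C_{\rm gap}(H)$ is continuous and $\mathcal H(s,\cdot)$ is admissible for each $s\in[0,1]$, then $\mathrm{sf}(\mathcal H(0,\cdot),[a,b])=\mathrm{sf}(\mathcal H(1,\cdot),[a,b])$. (iii) Concatenation. If $a\le c\le b$ and $\mathcal A$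 is admissible on $[a,c]$ and on $[c,b]$, then $\mathrm{sf}(\mathcal A,[a,b])=\mathrm{sf}(\mathcal A,[a,c])+\mathrm{sf}(\mathcal A,[c,b])$. (iv) Compact perturbations. If $A_\lambda=A+K_\lambda$ for all $\lambda\in[a,b]$, with $A$ a fixed (unbounded) operator and $\lambda\mapsto K_\lambda$ a norm-continuous path of compact operators in $\mathcal L(H)$, then the two spaces below are finite-dimensional and $$\mathrm{sf}(\mathcal A,[a,b])=\dim\big(E_-(A_a)\cap E_+(A_b)\big)-\dim\big(E_-(A_b)\cap E_+(A_a)\big),$$ where $E_+(T)$ and $E_-(T)$ denote the positive and the negative spectral subspace of the self-adjoint operator $T$, i.e. the ranges of its spectral projections for $(0,\infty)$ and $(-\infty,0)$. -/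

import Mathlib

open Set Topology
open scoped InnerProductSpace

namespace SpecFlow

noncomputable section

/-! ### The canonical symplectic Hilbert space `S(H) = H × H` and its Lagrangian Grassmannian -/

section Symplectic

variable (H : Type*) [NormedAddCommGroup H] [InnerProductSpace ℝ H]

/-- The Hilbert space `S(H) = H × H` (with the Hilbert product norm). -/
abbrev SympSpace : Type _ := WithLp 2 (H × H)

variable {H}

/-- The canonical symplectic form `ω((u₁,v₁),(u₂,v₂)) = ⟪v₂,u₁⟫ - ⟪v₁,u₂⟫` on `S(H)`. -/
def omega (z w : SympSpace H) : ℝ := ⟪w.snd, z.fst⟫_ℝ - ⟪z.snd, w.fst⟫_ℝ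

/-- The symplectic orthogonal `W♯ = {v | ω(u,v) = 0 for all u ∈ W}`. -/
def sympOrth (W : Submodule ℝ (SympSpace H)) : Submodule ℝ (SympSpace H) where
  carrier := {v | ∀ u ∈ W, omega u v = 0}
  zero_mem' := by intro u _; simp [omega]
  add_mem' := by
    intro v w hv hw u hu
    have h1 := hv u hu
    have h2 := hw u hu
    simp only [omega, WithLp.add_fst, WithLp.add_snd, inner_add_left, inner_add_right] at *
    linarith
  smul_mem' := by
    intro c v hv u hu
    have h1 := hv u hu
    simp only [omega, WithLp.smul_fst, WithLp.smul_snd, inner_smul_left, inner_smul_right,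
      conj_trivial] at *
    rw [← mul_sub, h1, mul_zero]

/-- `L` is Lagrangian if `L = L♯`. -/
def IsLagrangian (L : Submodule ℝ (SympSpace H)) : Prop := sympOrth L = L

theorem isClosed_sympOrth (W : Submodule ℝ (SympSpace H)) :
    IsClosed (sympOrth W : Set (SympSpace H)) := by
  have h : (sympOrth W : Set (SympSpace H)) = ⋂ u ∈ W, {v | omega u v = 0} := by
    ext v; simp [sympOrth]
  rw [h]
  refine isClosed_biInter fun u _ => isClosed_eq ?_ continuous_const
  have h1 : Continuous fun v : SympSpace H => v.fst := (WithLp.fstL 2 ℝ H H).continuous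
  have h2 : Continuous fun v : SympSpace H => v.snd := (WithLp.sndL 2 ℝ H H).continuous
  unfold omega
  fun_prop

variable (H) in
/-- The Lagrangian Grassmannian `Λ(H)` of `S(H)`. -/
def LagGr : Type _ := {L : Submodule ℝ (SympSpace H) // IsLagrangian L}

theorem LagGr.isClosed (L : LagGr H) : IsClosed (L.1 : Set (SympSpace H)) := by
  have h : sympOrth L.1 = L.1 := L.2
  rw [← h]
  exact isClosed_sympOrth _

instance [CompleteSpace H] (L : LagGr H) : L.1.HasOrthogonalProjection :=
  haveI : CompleteSpace L.1 := L.isClosed.completeSpace_coe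
  inferInstance

/-- The gap topology on `Λ(H)`: the topology of the metric `‖P_V - P_W‖`, where `P_V` is the
orthogonal projector of `S(H)` onto `V`. -/
instance [CompleteSpace H] : TopologicalSpace (LagGr H) :=
  TopologicalSpace.induced
    (fun L : LagGr H => (L.1.starProjection : SympSpace H →L[ℝ] SympSpace H)) inferInstance

/-- The subspace `I × {0}` of `S(H)`. -/
def horizontal (I : Submodule ℝ H) : Submodule ℝ (SympSpace H) :=
  (I.prod ⊥).comap (WithLp.linearEquiv 2 ℝ (H × H)).toLinearMap

/-- Two closed subspaces have a clean intersection if they meet only in `0` and their sum is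
closed. -/
def CleanIntersection (V W : Submodule ℝ (SympSpace H)) : Prop :=
  V ⊓ W = ⊥ ∧ IsClosed ((V ⊔ W : Submodule ℝ (SympSpace H)) : Set (SympSpace H))

/-- Symplectic reduction modulo `I × {0}`, where `I = Fᗮ` and `S(H)` reduces to `S(F)`:
the image of `L ∩ (I × {0})♯ = L ∩ (H × F)` under the orthogonal projection onto `F × F`, that is
`{(P_F x, y) | (x, y) ∈ L, y ∈ F}`. -/
def sympReduction (F : Submodule ℝ H) [F.HasOrthogonalProjection]
    (L : Submodule ℝ (SympSpace H)) : Submodule ℝ (SympSpace F) where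
  carrier := {p | ∃ x : H, WithLp.toLp 2 (x, (p.snd : H)) ∈ L ∧
    p.fst = F.orthogonalProjectionOnto x}
  zero_mem' := ⟨0, L.zero_mem, by simp⟩
  add_mem' := by
    rintro p q ⟨x, hx, hp⟩ ⟨y, hy, hq⟩
    refine ⟨x + y, ?_, by simp only [WithLp.add_fst, map_add, hp, hq]⟩
    simpa [← WithLp.toLp_add] using L.add_mem hx hy
  smul_mem' := by
    rintro c p ⟨x, hx, hp⟩
    refine ⟨c • x, ?_, by simp only [WithLp.smul_fst, map_smul, hp]⟩
    simpa [← WithLp.toLp_smul] using L.smul_mem c hx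

end Symplectic

/-! ### The Maslov index in finite dimensions -/

section Maslov

variable {F : Type*} [NormedAddCommGroup F] [InnerProductSpace ℝ F]

/-- The complex matrix of the vectors `v j` of `S(F)`, with `S(F)` identified with the
complexification of `F` through `(x, y) ↦ x + i y` and coordinates taken in the basis `e`. If `v`
is an orthonormal basis of a Lagrangian `L`, this is the unitary matrix sending the standard frame
of `F × {0}` to the frame `v` of `L`. -/
def frameMatrix {n : ℕ} (e : OrthonormalBasis (Fin n) ℝ F) (v : Fin n → SympSpace F) :
    Matrix (Fin n) (Fin n) ℂ :=
  Matrix.of fun k j => ⟨⟪e k, (v j).fst⟫_ℝ, ⟪e k, (v j).snd⟫_ℝ⟩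

/-- `z` is the value at `L` of the map `det² : Λ(F) → S¹`, i.e. `z = (det U)²` where `U` is a
unitary map sending `F × {0}` onto `L`. -/
def IsDetSq (L : Submodule ℝ (SympSpace F)) (z : ℂ) : Prop :=
  ∃ (n : ℕ) (e : OrthonormalBasis (Fin n) ℝ F) (v : OrthonormalBasis (Fin n) ℝ L),
    z = (frameMatrix e (fun j => (v j : SympSpace F))).det ^ 2

/-- The closed path `z : [a, c] → S¹` has winding number `m`. -/
def HasWindingNumber (z : ℝ → ℂ) (a c : ℝ) (m : ℤ) : Prop :=
  ∃ θ : ℝ → ℝ, ContinuousOn θ (Icc a c) ∧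
    (∀ t ∈ Icc a c, z t = Complex.exp ((θ t : ℂ) * Complex.I)) ∧
    θ c - θ a = 2 * Real.pi * m

/-- The closed path `l : [a, c] → Λ(F)` has Maslov index `m`: this is the winding number of
`det² ∘ l`. -/
def HasMaslovIndex (l : ℝ → LagGr F) (a c : ℝ) (m : ℤ) : Prop :=
  ∃ z : ℝ → ℂ, (∀ t ∈ Icc a c, IsDetSq (l t).1 (z t)) ∧ HasWindingNumber z a c m

/-- The path `l : [a, b] → Λ(F)` has Maslov index `m` relative to the Lagrangian `R`: after
concatenation of `l` with a path (here parametrized by `[b, b + 1]`) joining `l b` to `l a` inside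
the set of Lagrangians transverse to `R`, the resulting closed path has Maslov index `m`. -/
def HasRelMaslovIndex [CompleteSpace F] (R : Submodule ℝ (SympSpace F)) (l : ℝ → LagGr F)
    (a b : ℝ) (m : ℤ) : Prop :=
  ∃ l' : ℝ → LagGr F, ContinuousOn l' (Icc a (b + 1)) ∧ (∀ t ∈ Icc a b, l' t = l t) ∧
    (∀ t ∈ Icc b (b + 1), (l' t).1 ⊓ R = ⊥) ∧ l' (b + 1) = l a ∧
    HasMaslovIndex l' a (b + 1) m

end Maslov

/-! ### The generalized Maslov index -/

section GeneralizedMaslov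

variable {H : Type*} [NormedAddCommGroup H] [InnerProductSpace ℝ H]

/-- `m` is the generalized Maslov index `m_{H₀}` of the path `L : [a, b] → Λ(H)`: for some closed
subspace `I = Fᗮ` of finite codimension such that every `L t` has a clean intersection with
`I × {0}`, the path `l` in `Λ(F)` obtained by symplectic reduction modulo `I × {0}` has Maslov index
`m` relative to `F × {0}`. -/
def HasGenMaslovIndex (L : ℝ → LagGr H) (a b : ℝ) (m : ℤ) : Prop :=
  ∃ (F : Submodule ℝ H) (_ : FiniteDimensional ℝ F),
    (∀ t ∈ Icc a b, CleanIntersection (L t).1 (horizontal Fᗮ)) ∧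
    ∃ l : ℝ → LagGr F, (∀ t ∈ Icc a b, (l t).1 = sympReduction F (L t).1) ∧
      HasRelMaslovIndex (horizontal (⊤ : Submodule ℝ F)) l a b m

open Classical in
/-- The generalized Maslov index of a path (`0` by convention if it does not exist). -/
def genMaslovIndex (L : ℝ → LagGr H) (a b : ℝ) : ℤ :=
  if h : ∃ m : ℤ, HasGenMaslovIndex L a b m then h.choose else 0

end GeneralizedMaslov

/-! ### Unbounded self-adjoint Fredholm operators and the spectral flow -/

section Operators

variable {H : Type*} [NormedAddCommGroup H] [InnerProductSpace ℝ H]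

/-- A (possibly unbounded) operator is Fredholm if its kernel is finite-dimensional and its range
is closed and of finite codimension. (Closedness of the operator is part of self-adjointness
wherever this is used.) -/
def IsFredholmOp (A : H →ₗ.[ℝ] H) : Prop :=
  FiniteDimensional ℝ (LinearMap.ker A.toFun) ∧
    IsClosed (LinearMap.range A.toFun : Set H) ∧
    FiniteDimensional ℝ (H ⧸ LinearMap.range A.toFun)

/-- The graph of an operator as a subspace of `S(H)`. -/
def graphS (A : H →ₗ.[ℝ] H) : Submodule ℝ (SympSpace H) :=
  A.graph.comap (WithLp.linearEquiv 2 ℝ (H × H)).toLinearMap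

variable [CompleteSpace H]

theorem isLagrangian_graphS {A : H →ₗ.[ℝ] H} (hA : IsSelfAdjoint A) :
    IsLagrangian (graphS A) := by
  have hg : A.graph = A.graph.adjoint := by
    conv_lhs => rw [← LinearPMap.isSelfAdjoint_def.1 hA]
    exact LinearPMap.adjoint_graph_eq_graph_adjoint hA.dense_domain
  have key : ∀ v : SympSpace H, v ∈ graphS A ↔
      ∀ p q : H, (p, q) ∈ A.graph → ⟪q, v.fst⟫_ℝ - ⟪p, v.snd⟫_ℝ = 0 := by
    intro v
    have h1 : v ∈ graphS A ↔ (v.fst, v.snd) ∈ A.graph := Iff.rfl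
    rw [h1, hg, Submodule.mem_adjoint_iff, ← hg]
  unfold IsLagrangian
  ext v
  rw [key]
  constructor
  · intro hv p q hpq
    have h := hv (WithLp.toLp 2 (p, q)) hpq
    simp only [omega, WithLp.toLp_fst, WithLp.toLp_snd] at h
    rw [real_inner_comm v.snd p]
    linarith
  · intro hv u hu
    have h := hv u.fst u.snd hu
    simp only [omega]
    rw [real_inner_comm u.fst v.snd]
    linarith

variable (H) in
/-- The set `C_gap(H)` of all (possibly unbounded, densely defined) self-adjoint Fredholm operators
on `H`. -/
structure CGap where
  /-- the operator -/
  op : H →ₗ.[ℝ] H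
  dense_domain : Dense (op.domain : Set H)
  selfAdjoint : IsSelfAdjoint op
  fredholm : IsFredholmOp op

/-- The graph map `A ↦ Gr A`, `C_gap(H) → Λ(H)`. -/
def CGap.graph (A : CGap H) : LagGr H := ⟨graphS A.op, isLagrangian_graphS A.selfAdjoint⟩

/-- The gap topology on `C_gap(H)`, induced by the graph map. -/
instance : TopologicalSpace (CGap H) := TopologicalSpace.induced CGap.graph inferInstance

/-- `Ker A = {0}`. -/
def CGap.Injective (A : CGap H) : Prop := LinearMap.ker A.op.toFun = ⊥

/-- `𝒜 : [a, b] → C_gap(H)` is an admissible path: it is continuous and its endpoints have trivial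
kernel. -/
def IsAdmissible (𝒜 : ℝ → CGap H) (a b : ℝ) : Prop :=
  ContinuousOn 𝒜 (Icc a b) ∧ (𝒜 a).Injective ∧ (𝒜 b).Injective

/-- The spectral flow `sf(𝒜, [a, b])`: the generalized Maslov index of the path of graphs. -/
def spectralFlow (𝒜 : ℝ → CGap H) (a b : ℝ) : ℤ :=
  genMaslovIndex (fun t => (𝒜 t).graph) a b

end Operators

/-! ### Positive and negative spectral subspaces -/

section Spectral

variable {H : Type*} [NormedAddCommGroup H] [InnerProductSpace ℝ H]

/-- The closed subspace `M` reduces the operator `A`: with `P` the orthogonal projector onto `M`,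
`P` preserves the domain of `A` and `A P x = P A x` for all `x` in it. -/
def Reduces (M : Submodule ℝ H) [M.HasOrthogonalProjection] (A : H →ₗ.[ℝ] H) : Prop :=
  ∀ x : A.domain, ∃ h : M.starProjection (x : H) ∈ A.domain,
    A ⟨M.starProjection (x : H), h⟩ = M.starProjection (A x)

/-- The positive spectral subspace `E₊(A)` of a self-adjoint operator `A`, i.e. the range of its
spectral projection for `(0, ∞)`, described as the largest closed subspace which reduces `A` and on
which `A` is positive. (The range `M₀` of the spectral projection belongs to the family below. If
`M` is any member, the projector onto `M` commutes with the spectral projections of `A`, and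
positivity of `A` on `M` makes the one for `(-∞, 0]` vanish on `M`; so `M ≤ M₀`.) -/
def posSpectralSubspace (A : H →ₗ.[ℝ] H) : Submodule ℝ H :=
  sSup {M | ∃ _ : M.HasOrthogonalProjection, Reduces M A ∧
    ∀ x : A.domain, (x : H) ∈ M → (x : H) ≠ 0 → 0 < ⟪A x, (x : H)⟫_ℝ}

/-- The negative spectral subspace `E₋(A) = E₊(-A)`. -/
def negSpectralSubspace (A : H →ₗ.[ℝ] H) : Submodule ℝ H := posSpectralSubspace (-A)

end Spectral

end

end SpecFlow

open SpecFlow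

/-!
The spectral flow of an admissible path is well defined because `det²` changes under symplectic
reduction only by a continuous phase, and its value on compact perturbations is found by deforming
the path to a segment between two symmetries.

*Reduction.* Let `F` be finite-dimensional. For `L` in the open set of Lagrangian subspaces which
have a clean intersection with `Fᗮ × {0}` the reduction to `S(F)` is Lagrangian and depends
continuously on `L` (`IsClean.isLagrangian_red`, `continuousOn_redLag`). If `A` is Fredholm, its
graph is clean for some `F` (`exists_isCleanFor`), and on compact sets of parameters one `F`
suffices, as cleanness is open and persists when `F` grows (`exists_uniform_isCleanFor`). If `F` is
contained in `G` with codimension one, spanned by the unit vector `e`, then `det²` of the reduction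
to `G` is `det²` of the reduction to `F` times the square of the phase of a complex number
`kappa e l` (`dsq_eq_of_finrank_succ`): the frame matrix of the small reduction is a corner of a unitary
matrix. Since `kappa e l` has positive imaginary part, its argument is continuous. By induction the
quotient of the two values of `det²` has a continuous logarithm (`exists_phase_of_isometry`). For
`F = 0` this shows that `det²` has a continuous logarithm `φ` on the Lagrangian subspaces transverse to
`G × {0}`. So the closing paths do not matter, and the index is, up to the factor `2 π`, the
increment of an angle of `det²` minus the increment of `φ` (`hasRelMaslovIndex_iff`); passing from
`F` to `G` changes both increments by the same amount (`hasRelMaslovIndex_redFor_iff_of_le`).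
Normalization, homotopy invariance and concatenation can be read off from this formula.

*Compact perturbations.* The graph of a self-adjoint operator `A` is the range of `v ↦ (G v, F v)`
with the bounded operators `F = A (1 + A ^ 2) ^ (-1 / 2)` and `G = (1 + A ^ 2) ^ (-1 / 2)`. They are
obtained without functional calculus for unbounded operators, as the entries of the sign of the
bounded operator `dres L`, the inverse of the block operator `T` with rows `(A, 1)` and `(1, -A)`.
If `A` is replaced by `A + K`, then `T` changes to `T' = T + B`, where `B` is diagonal with the
entries `K` and `-K`, and the difference `X` of the signs satisfies the Sylvester equation
`X |T|⁻¹ + |T'|⁻¹ X = |T'|⁻¹ (B - sgn T' B sgn T) |T|⁻¹`. It follows that `X` is bounded by the norm of `K`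
and is compact if `K` is (`norm_le_of_sylvester`, `isCompactOperator_of_sylvester`). So along the
path `A + K t` the operators `F t` and `G t` are norm continuous and `F t - F a` is compact. The
path of graphs is homotopic, first with `G t` moved to `1`, then with `F t` moved to the segment
from `J = sgn (F a)` to `J' = sgn (F b)`, to the path of graphs of this segment; the end points stay
invertible, and all operators stay Fredholm because they are compact perturbations of invertible
operators (`genMaslovIndex_eq_segment`). The segment is singular only at its midpoint, and the
kernel `N` of `J + J'` reduces it to the graphs of the multiples `c E`, `-1 ≤ c ≤ 1`, of the
symmetry `E` which is the restriction of `J'` to `N`. A rotation closes up this path, and its index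
is the trace of `E`, that is, `dim (ker (J + 1) ∩ ker (J' - 1)) - dim (ker (J' + 1) ∩ ker (J - 1))`
(`genMaslovIndex_segment`). Finally `ker (J - 1)` and `ker (J + 1)` are the positive and the
negative spectral subspaces (`posSpectralSubspace_eq_of_polar`, `negSpectralSubspace_eq_of_polar`).
-/

namespace SpecFlow

noncomputable section

/-! ### Orthogonal projections onto ranges -/

section Frames

variable {E V : Type*} [NormedAddCommGroup E] [InnerProductSpace ℝ E] [CompleteSpace E]
  [NormedAddCommGroup V] [InnerProductSpace ℝ V] [CompleteSpace V]

theorem isUnit_adjoint_comp_self {T : V →L[ℝ] E} {c : ℝ} (hc : 0 < c)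
    (h : ∀ v, c * ‖v‖ ≤ ‖T v‖) : IsUnit ((T.adjoint ∘L T : V →L[ℝ] V)) := by
  refine ContinuousLinearMap.isUnit_of_forall_le_norm_inner_map _ (c := ⟨c ^ 2, by positivity⟩)
    (by exact_mod_cast (by positivity : 0 < c ^ 2)) fun x => ?_
  rw [ContinuousLinearMap.comp_apply, ContinuousLinearMap.adjoint_inner_left,
    real_inner_self_eq_norm_sq, Real.norm_eq_abs, abs_of_nonneg (by positivity)]
  have := h x
  have h0 : 0 ≤ c * ‖x‖ := by positivity
  calc ‖x‖ ^ 2 * c ^ 2 = (c * ‖x‖) ^ 2 := by ring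
    _ ≤ ‖T x‖ ^ 2 := by gcongr

/-- The orthogonal projection onto the range of a map `T` that is bounded below is
`T (T* T)⁻¹ T*`. -/
theorem starProjection_eq_of_range {T : V →L[ℝ] E}
    (h : IsUnit ((T.adjoint ∘L T : V →L[ℝ] V))) (U : Submodule ℝ E)
    [U.HasOrthogonalProjection] (hU : U = T.range) :
    U.starProjection = T ∘L (Ring.inverse (T.adjoint ∘L T : V →L[ℝ] V)) ∘L T.adjoint := by
  ext y
  subst hU
  refine Submodule.eq_starProjection_of_mem_of_inner_eq_zero ⟨_, rfl⟩ ?_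
  rintro _ ⟨v, rfl⟩
  have h1 := congrArg (fun S : V →L[ℝ] V => S (T.adjoint y)) (Ring.mul_inverse_cancel _ h)
  simp only [mul_apply_eq_comp, ContinuousLinearMap.comp_apply,
    one_apply_eq_self] at h1
  change ⟪_, T v⟫_ℝ = 0
  rw [← ContinuousLinearMap.adjoint_inner_left, map_sub]
  simp only [ContinuousLinearMap.comp_apply]
  rw [h1, sub_self, inner_zero_left]

/-- Orthogonal projections onto subspaces depend continuously on a frame, i.e. on a map that is
bounded below and has the subspace as its range. -/
theorem continuousWithinAt_starProjection {X : Type*} [TopologicalSpace X] {s : Set X} {x₀ : X}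
    {T : X → V →L[ℝ] E} (hT : ContinuousWithinAt T s x₀) {c : ℝ} (hc : 0 < c)
    (hb : ∀ v, c * ‖v‖ ≤ ‖T x₀ v‖) {U : X → Submodule ℝ E}
    [∀ x, (U x).HasOrthogonalProjection] (hU : ∀ᶠ x in 𝓝[s] x₀, U x = (T x).range)
    (hU₀ : U x₀ = (T x₀).range) :
    ContinuousWithinAt (fun x => (U x).starProjection) s x₀ := by
  have h0 := isUnit_adjoint_comp_self hc hb
  have hA : ContinuousWithinAt (fun x => (T x).adjoint) s x₀ :=
    (ContinuousLinearMap.adjoint (𝕜 := ℝ) (E := V) (F := E)).continuous.continuousAt.comp_continuousWithinAt hT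
  have hN : ContinuousWithinAt (fun x => ((T x).adjoint ∘L T x : V →L[ℝ] V)) s x₀ :=
    hA.clm_comp hT
  have hI : ContinuousWithinAt (fun x => Ring.inverse ((T x).adjoint ∘L T x : V →L[ℝ] V)) s x₀ := by
    obtain ⟨u, hu⟩ := h0
    refine ContinuousAt.comp_continuousWithinAt (f := fun x => ((T x).adjoint ∘L T x : V →L[ℝ] V))
      (g := Ring.inverse) ?_ hN
    rw [← hu]
    exact NormedRing.inverse_continuousAt u
  have hP : ContinuousWithinAt
      (fun x => T x ∘L (Ring.inverse ((T x).adjoint ∘L T x : V →L[ℝ] V)) ∘L (T x).adjoint) s x₀ :=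
    hT.clm_comp (hI.clm_comp hA)
  refine hP.congr_of_eventuallyEq ?_ (starProjection_eq_of_range h0 _ hU₀)
  have hopen : ∀ᶠ x in 𝓝[s] x₀, IsUnit ((T x).adjoint ∘L T x : V →L[ℝ] V) :=
    hN.eventually (Units.isOpen.mem_nhds h0)
  filter_upwards [hU, hopen] with x h1 h2
  exact starProjection_eq_of_range h2 _ h1

/-- The continuity statement `continuousWithinAt_starProjection` for finite-dimensional frames,
where it suffices to know one inclusion and the dimensions. -/
theorem continuousWithinAt_starProjection_of_finrank {X : Type*} [TopologicalSpace X] {s : Set X}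
    {x₀ : X} [FiniteDimensional ℝ V]
    {T : X → V →L[ℝ] E} (hT : ContinuousWithinAt T s x₀)
    (hinj : Function.Injective (T x₀)) {U : X → Submodule ℝ E} (hx₀ : x₀ ∈ s)
    [∀ x, (U x).HasOrthogonalProjection] (hfd : ∀ x ∈ s, FiniteDimensional ℝ (U x))
    (hU : ∀ x ∈ s, (T x).range ≤ U x)
    (hd : ∀ x ∈ s, Module.finrank ℝ (U x) = Module.finrank ℝ V) :
    ContinuousWithinAt (fun x => (U x).starProjection) s x₀ := by
  obtain ⟨K, hK, hb⟩ := (T x₀).exists_antilipschitzWith (LinearMap.ker_eq_bot.2 hinj)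
  have hb' : ∀ v, (K : ℝ)⁻¹ * ‖v‖ ≤ ‖T x₀ v‖ := fun v => by
    rw [inv_mul_le_iff₀ (by exact_mod_cast hK)]
    exact ZeroHomClass.bound_of_antilipschitz _ hb v
  have hKp : (0 : ℝ) < (K : ℝ)⁻¹ := by positivity
  have hnear : ∀ᶠ x in 𝓝[s] x₀, ‖T x - T x₀‖ < (K : ℝ)⁻¹ := by
    have : ContinuousWithinAt (fun x => ‖T x - T x₀‖) s x₀ := (hT.sub continuousWithinAt_const).norm
    exact this.tendsto.eventually_lt_const (by rw [sub_self, norm_zero]; exact hKp)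
  have key : ∀ x ∈ s, ‖T x - T x₀‖ < (K : ℝ)⁻¹ → U x = (T x).range := by
    intro x hx hxn
    have := hfd x hx
    refine (Submodule.eq_of_le_of_finrank_eq (hU x hx) ?_).symm
    rw [hd x hx]
    refine LinearMap.finrank_range_of_inj ((injective_iff_map_eq_zero _).2 fun v hv => ?_)
    change T x v = 0 at hv
    by_contra hv0
    have h1 : ‖T x₀ v‖ ≤ ‖T x - T x₀‖ * ‖v‖ := by
      have := (T x - T x₀).le_opNorm v
      rwa [sub_apply, hv, zero_sub, norm_neg] at this
    have h2 : ‖T x - T x₀‖ * ‖v‖ < (K : ℝ)⁻¹ * ‖v‖ :=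
      mul_lt_mul_of_pos_right hxn (norm_pos_iff.2 hv0)
    linarith [hb' v]
  refine continuousWithinAt_starProjection hT hKp hb' ?_ (key x₀ hx₀ (by simpa using hKp))
  filter_upwards [hnear, self_mem_nhdsWithin] with x h1 h2 using key x h2 h1

end Frames

/-! ### Lagrangian subspaces -/

section Lagrangian

variable {H : Type*} [NormedAddCommGroup H] [InnerProductSpace ℝ H]

omit [NormedAddCommGroup H] [InnerProductSpace ℝ H] in
theorem SympSpace.ext {z w : SympSpace H} (h1 : z.fst = w.fst) (h2 : z.snd = w.snd) : z = w :=
  WithLp.ofLp_injective 2 (Prod.ext h1 h2)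

theorem inner_sympSpace (z w : SympSpace H) :
    ⟪z, w⟫_ℝ = ⟪z.fst, w.fst⟫_ℝ + ⟪z.snd, w.snd⟫_ℝ := WithLp.prod_inner_apply z w

variable (H) in
/-- The complex structure `J (x, y) = (-y, x)` of `S(H)`. -/
def complexJ : SympSpace H ≃ₗᵢ[ℝ] SympSpace H where
  toFun z := WithLp.toLp 2 (-z.snd, z.fst)
  invFun z := WithLp.toLp 2 (z.snd, -z.fst)
  left_inv z := SympSpace.ext (by simp) (by simp)
  right_inv z := SympSpace.ext (by simp) (by simp)
  map_add' z w := SympSpace.ext (by simp [add_comm]) (by simp)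
  map_smul' c z := SympSpace.ext (by simp) (by simp)
  norm_map' z := by
    have h : ‖(WithLp.toLp 2 (-z.snd, z.fst) : SympSpace H)‖ ^ 2 = ‖z‖ ^ 2 := by
      rw [WithLp.prod_norm_sq_eq_of_L2, WithLp.prod_norm_sq_eq_of_L2]
      simp [add_comm]
    exact (sq_eq_sq₀ (norm_nonneg _) (norm_nonneg _)).1 h

@[simp] theorem complexJ_fst (z : SympSpace H) : (complexJ H z).fst = -z.snd := rfl
@[simp] theorem complexJ_snd (z : SympSpace H) : (complexJ H z).snd = z.fst := rfl

theorem complexJ_complexJ (z : SympSpace H) : complexJ H (complexJ H z) = -z :=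
  SympSpace.ext (by simp) (by simp)

theorem inner_complexJ (z w : SympSpace H) : ⟪z, complexJ H w⟫_ℝ = -omega z w := by
  rw [inner_sympSpace, omega, complexJ_fst, complexJ_snd, inner_neg_right,
    real_inner_comm w.snd z.fst]
  ring

theorem mem_sympOrth_iff {W : Submodule ℝ (SympSpace H)} {v : SympSpace H} :
    v ∈ sympOrth W ↔ complexJ H v ∈ Wᗮ := by
  rw [Submodule.mem_orthogonal]
  simp only [inner_complexJ, neg_eq_zero]
  rfl

theorem IsLagrangian.mem_iff {L : Submodule ℝ (SympSpace H)} (hL : IsLagrangian L)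
    {v : SympSpace H} : v ∈ L ↔ complexJ H v ∈ Lᗮ := by
  conv_lhs => rw [← (show sympOrth L = L from hL)]
  exact mem_sympOrth_iff

theorem IsLagrangian.mem_orthogonal_iff {L : Submodule ℝ (SympSpace H)} (hL : IsLagrangian L)
    {v : SympSpace H} : v ∈ Lᗮ ↔ complexJ H v ∈ L := by
  rw [hL.mem_iff, complexJ_complexJ, neg_mem_iff]

theorem IsLagrangian.omega_eq_zero {L : Submodule ℝ (SympSpace H)} (hL : IsLagrangian L)
    {v w : SympSpace H} (hv : v ∈ L) (hw : w ∈ L) : omega v w = 0 := by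
  rw [← (show sympOrth L = L from hL)] at hw
  exact hw v hv

theorem IsLagrangian.inner_comm {L : Submodule ℝ (SympSpace H)} (hL : IsLagrangian L)
    {v w : SympSpace H} (hv : v ∈ L) (hw : w ∈ L) : ⟪w.snd, v.fst⟫_ℝ = ⟪v.snd, w.fst⟫_ℝ :=
  sub_eq_zero.1 (hL.omega_eq_zero hv hw)

theorem IsLagrangian.eq_of_le {L L' : Submodule ℝ (SympSpace H)} (hL : IsLagrangian L)
    (hL' : IsLagrangian L') (h : L ≤ L') : L = L' := by
  refine le_antisymm h fun v hv => ?_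
  rw [hL.mem_iff]
  exact Submodule.orthogonal_le h (hL'.mem_iff.1 hv)

theorem mem_horizontal {I : Submodule ℝ H} {z : SympSpace H} :
    z ∈ horizontal I ↔ z.fst ∈ I ∧ z.snd = 0 := Iff.rfl

theorem mem_horizontal_top {z : SympSpace H} :
    z ∈ horizontal (⊤ : Submodule ℝ H) ↔ z.snd = 0 := by
  simp [mem_horizontal]

variable (H) in
theorem isLagrangian_horizontal_top : IsLagrangian (horizontal (⊤ : Submodule ℝ H)) := by
  refine le_antisymm (fun v hv => ?_) fun v hv u hu => ?_
  · have h := hv (WithLp.toLp 2 (v.snd, 0)) (mem_horizontal_top.2 rfl)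
    simpa [omega, mem_horizontal_top] using h
  · rw [mem_horizontal_top] at hu hv
    simp [omega, hu, hv]

open Classical in
/-- A subspace of `S(H)` as an element of `Λ(H)`; the value is `H × {0}` if the subspace is not
Lagrangian. -/
def toLag (U : Submodule ℝ (SympSpace H)) : LagGr H :=
  if h : IsLagrangian U then ⟨U, h⟩ else ⟨_, isLagrangian_horizontal_top H⟩

theorem toLag_coe {U : Submodule ℝ (SympSpace H)} (h : IsLagrangian U) : (toLag U).1 = U := by
  simp only [toLag]
  exact congrArg Subtype.val (dif_pos h)

/-- `L` is transverse to `H × {0}`. -/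
def IsTransverse (L : LagGr H) : Prop := L.1 ⊓ horizontal ⊤ = ⊥

theorem isTransverse_iff {L : LagGr H} : IsTransverse L ↔ ∀ z ∈ L.1, z.snd = 0 → z.fst = 0 := by
  rw [IsTransverse, Submodule.eq_bot_iff]
  constructor
  · intro h z hz h2
    rw [h z ⟨hz, mem_horizontal_top.2 h2⟩]; rfl
  · intro h z hz
    have h2 := mem_horizontal_top.1 hz.2
    exact SympSpace.ext (h z hz.1 h2) h2

/-- The map `v ↦ (X v, Y v)`. -/
def pairMap (X Y : H →L[ℝ] H) : H →L[ℝ] SympSpace H :=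
  (WithLp.prodContinuousLinearEquiv 2 ℝ H H).symm.toContinuousLinearMap ∘L X.prod Y

@[simp] theorem pairMap_fst (X Y : H →L[ℝ] H) (v : H) : (pairMap X Y v).fst = X v := rfl
@[simp] theorem pairMap_snd (X Y : H →L[ℝ] H) (v : H) : (pairMap X Y v).snd = Y v := rfl

theorem norm_pairMap_sq (X Y : H →L[ℝ] H) (v : H) :
    ‖pairMap X Y v‖ ^ 2 = ‖X v‖ ^ 2 + ‖Y v‖ ^ 2 := WithLp.prod_norm_sq_eq_of_L2 _

section Complete

variable [CompleteSpace H]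

/-- The projector of `S(H)` onto a Lagrangian subspace. -/
abbrev LagGr.proj (L : LagGr H) : SympSpace H →L[ℝ] SympSpace H := L.1.starProjection

theorem continuousWithinAt_lagGr_iff {X : Type*} [TopologicalSpace X] {l : X → LagGr H} {s : Set X}
    {x : X} : ContinuousWithinAt l s x ↔ ContinuousWithinAt (fun t => (l t).proj) s x :=
  (Topology.IsInducing.mk rfl : Topology.IsInducing (LagGr.proj : LagGr H → _)).continuousWithinAt_iff

theorem continuousOn_lagGr_iff {X : Type*} [TopologicalSpace X] {l : X → LagGr H} {s : Set X} :
    ContinuousOn l s ↔ ContinuousOn (fun t => (l t).proj) s :=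
  forall₂_congr fun _ _ => continuousWithinAt_lagGr_iff

theorem continuous_lagGr_proj : Continuous (LagGr.proj : LagGr H → _) := continuous_induced_dom

/-- A commuting pair of self-adjoint operators which is jointly bounded below. -/
structure IsLagPair (X Y : H →L[ℝ] H) : Prop where
  selfAdjoint_fst : IsSelfAdjoint X
  selfAdjoint_snd : IsSelfAdjoint Y
  commute : Commute X Y
  bounded_below : ∃ c > 0, ∀ v, c * ‖v‖ ^ 2 ≤ ‖X v‖ ^ 2 + ‖Y v‖ ^ 2

/-- If `(u, w)` is symplectically orthogonal to all `(X v, Y v)` then `X w = Y u`, and then `(u, w)`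
is the image of `(X ^ 2 + Y ^ 2)⁻¹ (X u + Y w)`. -/
theorem IsLagPair.isLagrangian {X Y : H →L[ℝ] H} (h : IsLagPair X Y) :
    IsLagrangian (pairMap X Y).range := by
  obtain ⟨hX, hY, hc, c, hc0, hb⟩ := h
  have hX' : ∀ u v, ⟪X u, v⟫_ℝ = ⟪u, X v⟫_ℝ := fun u v => hX.isSymmetric u v
  have hY' : ∀ u v, ⟪Y u, v⟫_ℝ = ⟪u, Y v⟫_ℝ := fun u v => hY.isSymmetric u v
  have hc' : ∀ v, X (Y v) = Y (X v) := fun v => congrArg (fun S : H →L[ℝ] H => S v) hc.eq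
  refine le_antisymm (fun v hv => ?_) ?_
  · have h1 : X v.snd = Y v.fst := by
      refine ext_inner_right ℝ fun w => ?_
      have := hv _ ⟨w, rfl⟩
      simp only [omega, ContinuousLinearMap.coe_coe, pairMap_fst, pairMap_snd] at this
      rw [hX', sub_eq_zero.1 this, hY', real_inner_comm]
    have hN : IsUnit (X * X + Y * Y) := by
      refine ContinuousLinearMap.isUnit_of_forall_le_norm_inner_map _ (c := ⟨c, hc0.le⟩) hc0
        fun x => ?_
      have : ⟪(X * X + Y * Y) x, x⟫_ℝ = ‖X x‖ ^ 2 + ‖Y x‖ ^ 2 := by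
        simp [inner_add_left, hX', hY']
      rw [this, Real.norm_eq_abs, abs_of_nonneg (by positivity), mul_comm]
      exact hb x
    obtain ⟨w, hw⟩ := (ContinuousLinearMap.isUnit_iff_bijective.1 hN).2 (X v.fst + Y v.snd)
    have hinj := (ContinuousLinearMap.isUnit_iff_bijective.1 hN).1
    refine ⟨w, SympSpace.ext (hinj ?_) (hinj ?_)⟩
    · have := congrArg X hw
      simp only [add_apply, mul_apply_eq_comp, map_add,
        ContinuousLinearMap.coe_coe, pairMap_fst, hc'] at this ⊢
      rw [this, h1]
    · have := congrArg Y hw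
      simp only [add_apply, mul_apply_eq_comp, map_add,
        ContinuousLinearMap.coe_coe, pairMap_snd, hc'] at this ⊢
      rw [this, ← hc', h1.symm]
  · rintro _ ⟨w, rfl⟩ _ ⟨u, rfl⟩
    simp only [omega, ContinuousLinearMap.coe_coe, pairMap_fst, pairMap_snd]
    rw [sub_eq_zero, hY', ← hc', ← hX', real_inner_comm]

theorem IsLagPair.exists_bound {X Y : H →L[ℝ] H} (h : IsLagPair X Y) :
    ∃ c > 0, ∀ v, c * ‖v‖ ≤ ‖pairMap X Y v‖ := by
  obtain ⟨c, hc, hb⟩ := h.bounded_below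
  refine ⟨√c, by positivity, fun v => ?_⟩
  refine le_of_sq_le_sq ?_ (norm_nonneg _)
  rw [mul_pow, Real.sq_sqrt hc.le, norm_pairMap_sq]
  exact hb v

/-- The Lagrangian subspace `{(X v, Y v)}` of a pair. -/
def pairLag (X Y : H →L[ℝ] H) : LagGr H := toLag (pairMap X Y).range

theorem IsLagPair.coe_pairLag {X Y : H →L[ℝ] H} (h : IsLagPair X Y) :
    (pairLag X Y).1 = (pairMap X Y).range := toLag_coe h.isLagrangian

theorem continuousOn_pairLag {α : Type*} [TopologicalSpace α] {s : Set α} {X Y : α → H →L[ℝ] H}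
    (hX : ContinuousOn X s) (hY : ContinuousOn Y s) (h : ∀ x ∈ s, IsLagPair (X x) (Y x)) :
    ContinuousOn (fun x => pairLag (X x) (Y x)) s := by
  rw [continuousOn_lagGr_iff]
  intro x hx
  obtain ⟨c, hc, hb⟩ := (h x hx).exists_bound
  have hT : ContinuousWithinAt (fun x => pairMap (X x) (Y x)) s x := by
    have h1 : (fun x => pairMap (X x) (Y x)) = fun x =>
        pairMap 1 0 ∘L X x + pairMap 0 1 ∘L Y x := by
      funext x; ext v
      · exact SympSpace.ext (by simp) (by simp)
    rw [h1]
    exact (continuousWithinAt_const.clm_comp (hX x hx)).add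
      (continuousWithinAt_const.clm_comp (hY x hx))
  exact continuousWithinAt_starProjection hT hc hb
    (Filter.eventually_of_mem self_mem_nhdsWithin fun y hy => (h y hy).coe_pairLag)
    (h x hx).coe_pairLag

theorem IsLagPair.isTransverse {X Y : H →L[ℝ] H} (h : IsLagPair X Y)
    (h0 : ∀ v, Y v = 0 → v = 0) : IsTransverse (pairLag X Y) := by
  rw [isTransverse_iff, h.coe_pairLag]
  rintro _ ⟨v, rfl⟩ hv
  simp [h0 v hv]

end Complete

/-- A Lagrangian subspace has half the dimension, as the complex structure maps it onto its
orthogonal complement. -/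
theorem IsLagrangian.finrank_eq [FiniteDimensional ℝ H] {L : Submodule ℝ (SympSpace H)}
    (hL : IsLagrangian L) : Module.finrank ℝ L = Module.finrank ℝ H := by
  have h1 : L.map (complexJ H).toLinearEquiv.toLinearMap = Lᗮ := by
    ext v
    constructor
    · rintro ⟨w, hw, rfl⟩
      exact hL.mem_iff.1 hw
    · intro hv
      refine ⟨-complexJ H v, neg_mem (hL.mem_orthogonal_iff.1 hv), ?_⟩
      change complexJ H (-complexJ H v) = v
      rw [map_neg, complexJ_complexJ, neg_neg]
  have h2 : Module.finrank ℝ Lᗮ = Module.finrank ℝ L := by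
    rw [← h1]; exact LinearEquiv.finrank_map_eq _ _
  have h3 := L.finrank_add_finrank_orthogonal
  have h4 : Module.finrank ℝ (SympSpace H) = Module.finrank ℝ H + Module.finrank ℝ H := by
    rw [(WithLp.linearEquiv 2 ℝ (H × H)).finrank_eq, Module.finrank_prod]
  omega

end Lagrangian

/-! ### Symplectic reduction -/

section Reduction

variable {H : Type*} [NormedAddCommGroup H] [InnerProductSpace ℝ H]
  {F : Type*} [NormedAddCommGroup F] [InnerProductSpace ℝ F]
  {G : Type*} [NormedAddCommGroup G] [InnerProductSpace ℝ G]

/-- Symplectic reduction along a linear isometry `ι : F → H`, i.e. modulo `I × {0}` with `I` the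
orthogonal complement of the range of `ι`. Allowing isometries instead of subspaces makes the
construction functorial. -/
def red (ι : F →ₗᵢ[ℝ] H) (L : Submodule ℝ (SympSpace H)) : Submodule ℝ (SympSpace F) where
  carrier := {p | ∃ x : H, WithLp.toLp 2 (x, ι p.snd) ∈ L ∧ ∀ f, ⟪ι f, x⟫_ℝ = ⟪f, p.fst⟫_ℝ}
  zero_mem' := ⟨0, by rw [WithLp.zero_snd, map_zero]; exact L.zero_mem, by simp⟩
  add_mem' := by
    rintro p q ⟨x, hx, hp⟩ ⟨y, hy, hq⟩
    refine ⟨x + y, ?_, by simp [inner_add_right, hp, hq]⟩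
    simpa [← WithLp.toLp_add] using L.add_mem hx hy
  smul_mem' := by
    rintro c p ⟨x, hx, hp⟩
    refine ⟨c • x, ?_, by simp [inner_smul_right, hp]⟩
    simpa [← WithLp.toLp_smul] using L.smul_mem c hx

theorem sympReduction_eq_red (F : Submodule ℝ H) [F.HasOrthogonalProjection]
    (L : Submodule ℝ (SympSpace H)) : sympReduction F L = red F.subtypeₗᵢ L := by
  ext p
  refine exists_congr fun x => and_congr_right fun _ => ?_
  constructor
  · intro h f
    rw [h, Submodule.inner_orthogonalProjectionOnto_eq_of_mem_left]
    rfl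
  · intro h
    refine ext_inner_left ℝ fun f => ?_
    rw [← h f, Submodule.inner_orthogonalProjectionOnto_eq_of_mem_left]
    rfl

theorem red_comp [CompleteSpace G] [CompleteSpace H] (ι : G →ₗᵢ[ℝ] H) (j : F →ₗᵢ[ℝ] G)
    (L : Submodule ℝ (SympSpace H)) : red (ι.comp j) L = red j (red ι L) := by
  ext p
  constructor
  · rintro ⟨x, hx, hp⟩
    refine ⟨ι.toContinuousLinearMap.adjoint x, ⟨x, hx, fun g => ?_⟩, fun f => ?_⟩
    · rw [WithLp.toLp_fst, ContinuousLinearMap.adjoint_inner_right]; rfl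
    · rw [ContinuousLinearMap.adjoint_inner_right]; exact hp f
  · rintro ⟨g, ⟨x, hx, hg⟩, hp⟩
    exact ⟨x, hx, fun f => (hg (j f)).trans (hp f)⟩

variable [CompleteSpace H] [FiniteDimensional ℝ F] [FiniteDimensional ℝ G]

/-- Quantitative form of the condition that `L` has a clean intersection with `I × {0}`, where `I`
is the orthogonal complement of the range of `ι`. -/
def IsClean (ι : F →ₗᵢ[ℝ] H) (L : LagGr H) : Prop :=
  ∃ c > 0, ∀ x : H, (∀ f, ⟪ι f, x⟫_ℝ = 0) →
    c * ‖x‖ ≤ ‖(WithLp.toLp 2 (x, 0) : SympSpace H) - L.proj (WithLp.toLp 2 (x, 0))‖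

omit [FiniteDimensional ℝ F] in
theorem IsClean.eq_zero {ι : F →ₗᵢ[ℝ] H} {L : LagGr H} (h : IsClean ι L) {x : H}
    (hx : ∀ f, ⟪ι f, x⟫_ℝ = 0) (hL : (WithLp.toLp 2 (x, 0) : SympSpace H) ∈ L.1) : x = 0 := by
  obtain ⟨c, hc, hb⟩ := h
  have := hb x hx
  rw [Submodule.starProjection_eq_self_iff.2 hL, sub_self, norm_zero] at this
  exact norm_le_zero_iff.1 (nonpos_of_mul_nonpos_right this hc)

omit [FiniteDimensional ℝ F] [FiniteDimensional ℝ G] in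
theorem IsClean.of_comp {ι : G →ₗᵢ[ℝ] H} {j : F →ₗᵢ[ℝ] G} {L : LagGr H}
    (h : IsClean (ι.comp j) L) : IsClean ι L := by
  obtain ⟨c, hc, hb⟩ := h
  exact ⟨c, hc, fun x hx => hb x fun f => hx (j f)⟩

/-- The map `x ↦ (1 - P_L) (x, 0)` on the orthogonal complement of the range of `ι`. -/
def cleanMap (ι : F →ₗᵢ[ℝ] H) (L : LagGr H) : ι.toLinearMap.rangeᗮ →L[ℝ] SympSpace H :=
  (1 - L.proj) ∘L pairMap 1 0 ∘L (ι.toLinearMap.rangeᗮ).subtypeL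

omit [FiniteDimensional ℝ F] in
theorem cleanMap_apply (ι : F →ₗᵢ[ℝ] H) (L : LagGr H) (x : ι.toLinearMap.rangeᗮ) :
    cleanMap ι L x =
      (WithLp.toLp 2 ((x : H), 0) : SympSpace H) - L.proj (WithLp.toLp 2 ((x : H), 0)) := rfl

omit [CompleteSpace H] [FiniteDimensional ℝ F] in
theorem mem_range_orthogonal {ι : F →ₗᵢ[ℝ] H} {x : H} :
    x ∈ ι.toLinearMap.rangeᗮ ↔ ∀ f, ⟪ι f, x⟫_ℝ = 0 := by
  rw [Submodule.mem_orthogonal]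
  exact ⟨fun h f => h _ ⟨f, rfl⟩, by rintro h _ ⟨f, rfl⟩; exact h f⟩

omit [FiniteDimensional ℝ F] in
theorem isClean_iff {ι : F →ₗᵢ[ℝ] H} {L : LagGr H} :
    IsClean ι L ↔ ∃ c > 0, ∀ x, c * ‖x‖ ≤ ‖cleanMap ι L x‖ := by
  simp only [IsClean, Subtype.forall, mem_range_orthogonal, cleanMap_apply]
  rfl

omit [FiniteDimensional ℝ F] in
theorem IsClean.isClosed_range {ι : F →ₗᵢ[ℝ] H} {L : LagGr H} (h : IsClean ι L) :
    IsClosed ((cleanMap ι L).range : Set (SympSpace H)) := by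
  obtain ⟨c, hc, hb⟩ := isClean_iff.1 h
  have : AntilipschitzWith c⁻¹.toNNReal (cleanMap ι L) :=
    (cleanMap ι L).antilipschitz_of_bound fun x => by
      rw [Real.coe_toNNReal _ (by positivity), inv_mul_eq_div, le_div_iff₀ hc, mul_comm]
      exact hb x
  rw [LinearMap.coe_range]
  exact this.isClosed_range (cleanMap ι L).uniformContinuous

omit [FiniteDimensional ℝ F] in
theorem isClean_of_isClosed_range {ι : F →ₗᵢ[ℝ] H} {L : LagGr H}
    (h0 : ∀ x : H, (∀ f, ⟪ι f, x⟫_ℝ = 0) → (WithLp.toLp 2 (x, 0) : SympSpace H) ∈ L.1 → x = 0)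
    (h : IsClosed ((cleanMap ι L).range : Set (SympSpace H))) : IsClean ι L := by
  have hinj : Function.Injective (cleanMap ι L) := by
    rw [injective_iff_map_eq_zero]
    intro x hx
    rw [cleanMap_apply, sub_eq_zero, eq_comm, Submodule.starProjection_eq_self_iff] at hx
    exact Subtype.ext (h0 x (mem_range_orthogonal.1 x.2) hx)
  obtain ⟨K, hK⟩ := (cleanMap ι L).antilipschitz_of_injective_of_isClosed_range hinj
    (by rwa [LinearMap.coe_range] at h)
  refine isClean_iff.2 ⟨(K + 1 : ℝ)⁻¹, by positivity, fun x => ?_⟩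
  rw [inv_mul_le_iff₀ (by positivity)]
  have h1 := ZeroHomClass.bound_of_antilipschitz _ hK x
  exact h1.trans (by gcongr; linarith)

omit [FiniteDimensional ℝ F] in
theorem isClean_of_finiteDimensional {j : F →ₗᵢ[ℝ] G} {L : LagGr G}
    (h0 : ∀ x : G, (∀ f, ⟪j f, x⟫_ℝ = 0) → (WithLp.toLp 2 (x, 0) : SympSpace G) ∈ L.1 → x = 0) :
    IsClean j L :=
  isClean_of_isClosed_range h0 (Submodule.closed_of_finiteDimensional _)

/-- The closed subspace `range (cleanMap ι L)`, written as a double orthogonal complement so that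
it has an orthogonal projection for every `L`. -/
def cleanRange (ι : F →ₗᵢ[ℝ] H) (L : LagGr H) : Submodule ℝ (SympSpace H) :=
  ((cleanMap ι L).range)ᗮᗮ

instance (ι : F →ₗᵢ[ℝ] H) (L : LagGr H) : (cleanRange ι L).HasOrthogonalProjection := by
  have : CompleteSpace (cleanRange ι L) :=
    IsClosed.completeSpace_coe (hs := Submodule.isClosed_orthogonal _)
  exact .ofCompleteSpace _

omit [FiniteDimensional ℝ F] in
theorem IsClean.cleanRange_eq {ι : F →ₗᵢ[ℝ] H} {L : LagGr H} (h : IsClean ι L) :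
    cleanRange ι L = (cleanMap ι L).range := by
  rw [cleanRange, Submodule.orthogonal_orthogonal_eq_closure]
  exact IsClosed.submodule_topologicalClosure_eq h.isClosed_range

omit [FiniteDimensional ℝ F] in
theorem continuousWithinAt_cleanRange (ι : F →ₗᵢ[ℝ] H) {L₀ : LagGr H} (h : IsClean ι L₀) :
    ContinuousWithinAt (fun L => (cleanRange ι L).starProjection) {L | IsClean ι L} L₀ := by
  obtain ⟨c, hc, hb⟩ := isClean_iff.1 h
  refine continuousWithinAt_starProjection (T := cleanMap ι) ?_ hc hb
    (Filter.eventually_of_mem self_mem_nhdsWithin fun L hL => IsClean.cleanRange_eq hL)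
    h.cleanRange_eq
  exact ((continuous_const.sub continuous_lagGr_proj).clm_comp
    continuous_const).continuousWithinAt

omit [CompleteSpace H] in
theorem toLp_mem_horizontal {I : Submodule ℝ H} {x : H} (hx : x ∈ I) :
    (WithLp.toLp 2 (x, 0) : SympSpace H) ∈ horizontal I := ⟨hx, rfl⟩

/-- The orthogonal projector onto the orthogonal complement of `L + I × {0}` (when `L` has a clean
intersection with `I × {0}`). -/
def sumComplProj (ι : F →ₗᵢ[ℝ] H) (L : LagGr H) : SympSpace H →L[ℝ] SympSpace H :=
  1 - L.proj - (cleanRange ι L).starProjection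

/-- The orthogonal complement of `L + I × {0}`. -/
def sumCompl (ι : F →ₗᵢ[ℝ] H) (L : LagGr H) : Submodule ℝ (SympSpace H) :=
  L.1ᗮ ⊓ (horizontal ι.toLinearMap.rangeᗮ)ᗮ

omit [CompleteSpace H] in
theorem mem_horizontal_orthogonal {ι : F →ₗᵢ[ℝ] H} {z : SympSpace H} :
    z ∈ (horizontal ι.toLinearMap.rangeᗮ)ᗮ ↔ ∃ f, z.fst = ι f := by
  have h1 : z ∈ (horizontal ι.toLinearMap.rangeᗮ)ᗮ ↔ z.fst ∈ ι.toLinearMap.rangeᗮᗮ := by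
    rw [Submodule.mem_orthogonal, Submodule.mem_orthogonal]
    constructor
    · intro h x hx
      simpa [inner_sympSpace] using h (WithLp.toLp 2 (x, 0)) ⟨hx, rfl⟩
    · intro h u hu
      rw [inner_sympSpace, h u.fst hu.1, (mem_horizontal.1 hu).2, inner_zero_left, add_zero]
  rw [h1, Submodule.orthogonal_orthogonal]
  exact ⟨fun ⟨f, hf⟩ => ⟨f, hf.symm⟩, fun ⟨f, hf⟩ => ⟨f, hf.symm⟩⟩

omit [FiniteDimensional ℝ F] in
theorem cleanRange_le (ι : F →ₗᵢ[ℝ] H) {L : LagGr H} (h : IsClean ι L) :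
    cleanRange ι L ≤ L.1ᗮ := by
  rw [h.cleanRange_eq]
  rintro _ ⟨x, rfl⟩
  exact Submodule.sub_starProjection_mem_orthogonal _

omit [FiniteDimensional ℝ F] in
/-- The operator `sumComplProj` annihilates `L + I × {0}`: this sum is the orthogonal sum of `L` and
of the image of `I × {0}` under the projector `1 - P_L`. -/
theorem sumComplProj_mem (ι : F →ₗᵢ[ℝ] H) {L : LagGr H} (h : IsClean ι L) (z : SympSpace H) :
    sumComplProj ι L z ∈ sumCompl ι L := by
  have h1 : sumComplProj ι L z ∈ L.1ᗮ :=
    sub_mem (Submodule.sub_starProjection_mem_orthogonal z)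
      (cleanRange_le ι h (Submodule.starProjection_apply_mem _ z))
  refine ⟨h1, ?_⟩
  change _ ∈ (horizontal ι.toLinearMap.rangeᗮ)ᗮ
  rw [Submodule.mem_orthogonal']
  intro w hw
  have hw' : w = WithLp.toLp 2 (w.fst, 0) := SympSpace.ext rfl (mem_horizontal.1 hw).2
  have h2 : w - L.proj w ∈ cleanRange ι L := by
    rw [h.cleanRange_eq]
    exact ⟨⟨w.fst, (mem_horizontal.1 hw).1⟩, (congrArg (fun u => u - L.proj u) hw').symm⟩
  have h3 : ⟪sumComplProj ι L z, L.proj w⟫_ℝ = 0 :=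
    Submodule.inner_left_of_mem_orthogonal (Submodule.starProjection_apply_mem _ w) h1
  have h4 : ⟪L.proj z, w - L.proj w⟫_ℝ = 0 :=
    Submodule.inner_right_of_mem_orthogonal (Submodule.starProjection_apply_mem _ z)
      (Submodule.sub_starProjection_mem_orthogonal w)
  have h5 : sumComplProj ι L z = (z - (cleanRange ι L).starProjection z) - L.proj z := by
    simp only [sumComplProj, sub_apply, one_apply_eq_self]; abel
  have h6 : ⟪sumComplProj ι L z, w - L.proj w⟫_ℝ = 0 := by
    rw [h5, inner_sub_left, Submodule.starProjection_inner_eq_zero _ _ h2, h4, sub_zero]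
  rwa [inner_sub_right, h3, sub_zero] at h6

omit [FiniteDimensional ℝ F] in
theorem sumComplProj_eq_self (ι : F →ₗᵢ[ℝ] H) {L : LagGr H} (h : IsClean ι L) {z : SympSpace H}
    (hz : z ∈ sumCompl ι L) : sumComplProj ι L z = z := by
  have h1 : L.proj z = 0 := by
    rw [LagGr.proj, Submodule.starProjection_apply_eq_zero_iff]; exact hz.1
  have h2 : (cleanRange ι L).starProjection z = 0 := by
    rw [Submodule.starProjection_apply_eq_zero_iff, h.cleanRange_eq, Submodule.mem_orthogonal']
    rintro _ ⟨x, rfl⟩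
    change ⟪z, cleanMap ι L x⟫_ℝ = 0
    rw [cleanMap_apply, inner_sub_right,
      Submodule.inner_left_of_mem_orthogonal (Submodule.starProjection_apply_mem _ _) hz.1,
      Submodule.inner_left_of_mem_orthogonal (toLp_mem_horizontal x.2) hz.2,
      sub_zero]
  simp [sumComplProj, h1, h2]

/-- The projection `S(H) → S(F)`, `(x, y) ↦ (ι* x, ι* y)`. -/
def adjPair (ι : F →ₗᵢ[ℝ] H) : SympSpace H →L[ℝ] SympSpace F :=
  have := FiniteDimensional.complete ℝ F
  (WithLp.prodContinuousLinearEquiv 2 ℝ F F).symm.toContinuousLinearMap ∘L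
    (ι.toContinuousLinearMap.adjoint ∘L WithLp.fstL 2 ℝ H H).prod
      (ι.toContinuousLinearMap.adjoint ∘L WithLp.sndL 2 ℝ H H)

theorem inner_adjPair_fst (ι : F →ₗᵢ[ℝ] H) (z : SympSpace H) (f : F) :
    ⟪f, (adjPair ι z).fst⟫_ℝ = ⟪ι f, z.fst⟫_ℝ :=
  have := FiniteDimensional.complete ℝ F
  ContinuousLinearMap.adjoint_inner_right ι.toContinuousLinearMap f z.fst

theorem inner_adjPair_snd (ι : F →ₗᵢ[ℝ] H) (z : SympSpace H) (f : F) :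
    ⟪f, (adjPair ι z).snd⟫_ℝ = ⟪ι f, z.snd⟫_ℝ :=
  have := FiniteDimensional.complete ℝ F
  ContinuousLinearMap.adjoint_inner_right ι.toContinuousLinearMap f z.snd

theorem adjPair_fst_eq (ι : F →ₗᵢ[ℝ] H) {z : SympSpace H} {f : F} (h : z.fst = ι f) :
    (adjPair ι z).fst = f := by
  refine ext_inner_left ℝ fun g => ?_
  rw [inner_adjPair_fst, h, ι.inner_map_map]

theorem complexJ_adjPair_mem_red (ι : F →ₗᵢ[ℝ] H) {L : LagGr H} {z : SympSpace H}
    (hz : z ∈ sumCompl ι L) : complexJ F (adjPair ι z) ∈ red ι L.1 := by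
  obtain ⟨f, hf⟩ := mem_horizontal_orthogonal.1 hz.2
  refine ⟨-z.snd, ?_, fun g => ?_⟩
  · rw [complexJ_snd, adjPair_fst_eq ι hf, ← hf]
    exact L.2.mem_orthogonal_iff.1 hz.1
  · rw [complexJ_fst, inner_neg_right, inner_neg_right, inner_adjPair_snd]

/-- A clean reduction is Lagrangian. The nontrivial inclusion rests on `L + I × {0}` being closed:
a vector orthogonal to the orthogonal complement of this sum belongs to it. -/
theorem IsClean.isLagrangian_red {ι : F →ₗᵢ[ℝ] H} {L : LagGr H} (h : IsClean ι L) :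
    IsLagrangian (red ι L.1) := by
  refine le_antisymm (fun v hv => ?_) ?_
  · set z : SympSpace H := WithLp.toLp 2 (ι v.fst, ι v.snd) with hz
    -- `z` is orthogonal to the complement of `L + I × {0}`, hence lies in this closed sum
    have h1 : ∀ m ∈ sumCompl ι L, ⟪m, z⟫_ℝ = 0 := by
      intro m hm
      have h2 := hv _ (complexJ_adjPair_mem_red ι hm)
      rw [← neg_eq_zero, ← inner_complexJ, LinearIsometryEquiv.inner_map_map, inner_sympSpace,
        real_inner_comm, inner_adjPair_fst, real_inner_comm v.snd, inner_adjPair_snd] at h2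
      rw [inner_sympSpace, real_inner_comm, real_inner_comm z.snd]
      exact h2
    have h3 : sumComplProj ι L z = 0 := by
      have h4 := h1 _ (sumComplProj_mem ι h z)
      have h5 : ⟪sumComplProj ι L z, L.proj z⟫_ℝ = 0 :=
        Submodule.inner_left_of_mem_orthogonal (Submodule.starProjection_apply_mem _ _)
          (sumComplProj_mem ι h z).1
      have h6 : ⟪sumComplProj ι L z, (cleanRange ι L).starProjection z⟫_ℝ = 0 := by
        have h7 : (cleanRange ι L).starProjection z ∈ (cleanMap ι L).range := by
          rw [← h.cleanRange_eq]; exact Submodule.starProjection_apply_mem _ _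
        obtain ⟨x, hx⟩ := h7
        rw [← hx]
        change ⟪_, cleanMap ι L x⟫_ℝ = 0
        rw [cleanMap_apply, inner_sub_right,
          Submodule.inner_left_of_mem_orthogonal (Submodule.starProjection_apply_mem _ _)
            (sumComplProj_mem ι h z).1,
          Submodule.inner_left_of_mem_orthogonal (toLp_mem_horizontal x.2)
            (sumComplProj_mem ι h z).2, sub_zero]
      have h8 : ⟪sumComplProj ι L z, sumComplProj ι L z⟫_ℝ = 0 := by
        conv_lhs => arg 3; simp only [sumComplProj, sub_apply, one_apply_eq_self]
        rw [inner_sub_right, inner_sub_right, h4, h5, h6]; simp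
      exact inner_self_eq_zero.1 h8
    have h7 : (cleanRange ι L).starProjection z ∈ (cleanMap ι L).range := by
      rw [← h.cleanRange_eq]; exact Submodule.starProjection_apply_mem _ _
    obtain ⟨x, hx⟩ := h7
    change cleanMap ι L x = _ at hx
    simp only [sumComplProj, sub_apply, one_apply_eq_self, ← hx, cleanMap_apply] at h3
    have h9 : z - WithLp.toLp 2 ((x : H), 0) ∈ L.1 := by
      have : z - WithLp.toLp 2 ((x : H), 0) =
          L.proj z - L.proj (WithLp.toLp 2 ((x : H), 0)) := by
        rw [← sub_eq_zero]
        rw [← h3]; abel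
      rw [this]
      exact sub_mem (Submodule.starProjection_apply_mem _ _)
        (Submodule.starProjection_apply_mem _ _)
    refine ⟨ι v.fst - x, ?_, fun f => ?_⟩
    · convert h9 using 1
      exact SympSpace.ext rfl (by simp [hz])
    · rw [inner_sub_right, ι.inner_map_map, mem_range_orthogonal.1 x.2 f, sub_zero]
  · rintro v ⟨x, hx, hv⟩ u ⟨y, hy, hu⟩
    have := L.2.inner_comm hy hx
    simp only [WithLp.toLp_fst, WithLp.toLp_snd] at this
    rw [omega, ← hv, ← hu, this, sub_self]

/-- Symplectic reduction as a map of Lagrangian Grassmannians. -/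
def redLag (ι : F →ₗᵢ[ℝ] H) (L : LagGr H) : LagGr F := toLag (red ι L.1)

theorem IsClean.redLag_coe {ι : F →ₗᵢ[ℝ] H} {L : LagGr H} (h : IsClean ι L) :
    (redLag ι L).1 = red ι L.1 := toLag_coe h.isLagrangian_red

omit [FiniteDimensional ℝ F] in
theorem IsClean.comp {ι : G →ₗᵢ[ℝ] H} {j : F →ₗᵢ[ℝ] G} {L : LagGr H}
    (h : IsClean (ι.comp j) L) : IsClean j (redLag ι L) := by
  refine isClean_of_finiteDimensional fun g hg hg' => ?_
  rw [h.of_comp.redLag_coe] at hg'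
  obtain ⟨x, hx, hxg⟩ := hg'
  simp only [WithLp.toLp_snd, WithLp.toLp_fst, map_zero] at hx hxg
  have : x = 0 := h.eq_zero (fun f => (hxg (j f)).trans (hg f)) hx
  refine ext_inner_left ℝ fun f => ?_
  rw [← hxg, this, inner_zero_right, inner_zero_right]

theorem redLag_comp {ι : G →ₗᵢ[ℝ] H} {j : F →ₗᵢ[ℝ] G} {L : LagGr H} (h : IsClean (ι.comp j) L) :
    redLag (ι.comp j) L = redLag j (redLag ι L) := by
  have := FiniteDimensional.complete ℝ G
  refine Subtype.ext ?_
  rw [h.redLag_coe, h.comp.redLag_coe, h.of_comp.redLag_coe, red_comp]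

theorem isTransverse_redLag {ι : F →ₗᵢ[ℝ] H} {L : LagGr H} (h : IsClean ι L)
    (hL : IsTransverse L) : IsTransverse (redLag ι L) := by
  rw [isTransverse_iff] at hL ⊢
  rw [h.redLag_coe]
  rintro p ⟨x, hx, hp⟩ h2
  have h3 : x = 0 := hL _ hx (by simp [h2])
  refine ext_inner_left ℝ fun f => ?_
  rw [← hp, h3, inner_zero_right, inner_zero_right]

theorem injOn_adjPair {ι : F →ₗᵢ[ℝ] H} {L : LagGr H} (h : IsClean ι L) {z : SympSpace H}
    (hz : z ∈ sumCompl ι L) (h0 : adjPair ι z = 0) : z = 0 := by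
  obtain ⟨f, hf⟩ := mem_horizontal_orthogonal.1 hz.2
  have h1 : z.fst = 0 := by
    have := adjPair_fst_eq ι hf
    rw [h0, WithLp.zero_fst] at this
    rw [hf, ← this, map_zero]
  have h2 : z.snd = 0 := by
    rw [← neg_eq_zero]
    refine h.eq_zero (fun f => ?_) ?_
    · rw [inner_neg_right, ← inner_adjPair_snd, h0]; simp
    · have := L.2.mem_orthogonal_iff.1 hz.1
      convert this using 1
      exact SympSpace.ext rfl h1.symm
  exact SympSpace.ext h1 h2

/-- Symplectic reduction is continuous on the clean Lagrangian subspaces. The orthogonal complement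
of the reduction of `L` is the image of the orthogonal complement of `L + I × {0}`; the projector
onto the latter is continuous in `L`, and the dimension of the former is constant. -/
theorem continuousOn_redLag (ι : F →ₗᵢ[ℝ] H) : ContinuousOn (redLag ι) {L | IsClean ι L} := by
  intro L₀ h₀
  change IsClean ι L₀ at h₀
  have := FiniteDimensional.complete ℝ F
  rw [continuousWithinAt_lagGr_iff]
  suffices hs : ContinuousWithinAt (fun L => ((redLag ι L).1ᗮ).starProjection)
      {L | IsClean ι L} L₀ by
    have : (fun L => (redLag ι L).proj) = fun L => 1 - ((redLag ι L).1ᗮ).starProjection := by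
      funext L
      rw [Submodule.starProjection_orthogonal', sub_sub_cancel]
    rw [this]
    exact continuousWithinAt_const.sub hs
  let V := sumCompl ι L₀
  have hV : ∀ v : V, adjPair ι v = 0 → v = 0 := fun v hv => Subtype.ext (injOn_adjPair h₀ v.2 hv)
  have : FiniteDimensional ℝ V :=
    FiniteDimensional.of_injective (adjPair ι ∘L V.subtypeL).toLinearMap
      ((injective_iff_map_eq_zero _).2 hV)
  have := FiniteDimensional.complete ℝ V
  let T : LagGr H → V →L[ℝ] SympSpace F := fun L => adjPair ι ∘L sumComplProj ι L ∘L V.subtypeL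
  have hT₀ : ∀ v : V, T L₀ v = adjPair ι v := fun v =>
    congrArg (adjPair ι) (sumComplProj_eq_self ι h₀ v.2)
  have hTc : ContinuousWithinAt T {L | IsClean ι L} L₀ :=
    continuousWithinAt_const.clm_comp
      (((continuousWithinAt_const.sub continuous_lagGr_proj.continuousWithinAt).sub
        (continuousWithinAt_cleanRange ι h₀)).clm_comp continuousWithinAt_const)
  have hle : ∀ L, IsClean ι L → (T L).range ≤ (redLag ι L).1ᗮ := by
    rintro L hL _ ⟨v, rfl⟩
    rw [(redLag ι L).2.mem_orthogonal_iff, hL.redLag_coe]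
    exact complexJ_adjPair_mem_red ι (sumComplProj_mem ι hL _)
  have hinj : Function.Injective (T L₀) :=
    (injective_iff_map_eq_zero _).2 fun v hv => hV v ((hT₀ v).symm.trans hv)
  have hsurj : (T L₀).range = (redLag ι L₀).1ᗮ := by
    refine le_antisymm (hle L₀ h₀) fun p hp => ?_
    rw [(redLag ι L₀).2.mem_orthogonal_iff, h₀.redLag_coe] at hp
    obtain ⟨x, hx, hpx⟩ := hp
    have hz : (WithLp.toLp 2 (ι p.fst, -x) : SympSpace H) ∈ sumCompl ι L₀ := by
      refine ⟨?_, mem_horizontal_orthogonal.2 ⟨p.fst, rfl⟩⟩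
      change _ ∈ L₀.1ᗮ
      rw [L₀.2.mem_orthogonal_iff]
      convert hx using 1
      exact SympSpace.ext (by simp) (by simp)
    refine ⟨⟨_, hz⟩, (hT₀ _).trans (SympSpace.ext (adjPair_fst_eq ι rfl) ?_)⟩
    refine ext_inner_left ℝ fun f => ?_
    rw [inner_adjPair_snd]
    have := hpx f
    rw [complexJ_fst, inner_neg_right] at this
    rw [WithLp.toLp_snd, inner_neg_right, this, neg_neg]
  have hd : ∀ L : LagGr H, Module.finrank ℝ ((redLag ι L).1ᗮ : Submodule ℝ _) =
      Module.finrank ℝ V := by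
    intro L
    have e2 := LinearMap.finrank_range_of_inj (f := (T L₀).toLinearMap) hinj
    have e7 : Module.finrank ℝ (T L₀).toLinearMap.range =
        Module.finrank ℝ ((redLag ι L₀).1ᗮ : Submodule ℝ _) := LinearEquiv.finrank_eq (LinearEquiv.ofEq _ _ hsurj)
    have e3 := (redLag ι L).1.finrank_add_finrank_orthogonal
    have e4 := (redLag ι L₀).1.finrank_add_finrank_orthogonal
    have e5 := (redLag ι L).2.finrank_eq
    have e6 := (redLag ι L₀).2.finrank_eq
    omega
  exact continuousWithinAt_starProjection_of_finrank hTc hinj h₀ (fun _ _ => inferInstance) hle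
    fun L _ => hd L

end Reduction

/-! ### Clean intersections -/

section Clean

theorem isOpen_setOf_bounded_below {E V : Type*} [NormedAddCommGroup E] [NormedSpace ℝ E]
    [NormedAddCommGroup V] [NormedSpace ℝ V] :
    IsOpen {T : V →L[ℝ] E | ∃ c > 0, ∀ v, c * ‖v‖ ≤ ‖T v‖} := by
  rw [Metric.isOpen_iff]
  rintro T ⟨c, hc, hb⟩
  refine ⟨c / 2, by positivity, fun S hS => ⟨c / 2, by positivity, fun v => ?_⟩⟩
  rw [mem_ball_iff_norm] at hS
  have h1 : ‖T v‖ - ‖S v‖ ≤ ‖S v - T v‖ := by rw [norm_sub_rev]; exact norm_sub_norm_le _ _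
  have h2 : ‖S v - T v‖ ≤ c / 2 * ‖v‖ := ((S - T).le_opNorm v).trans (by gcongr)
  linarith [hb v]

variable {H : Type*} [NormedAddCommGroup H] [InnerProductSpace ℝ H] [CompleteSpace H]
  {F : Type*} [NormedAddCommGroup F] [InnerProductSpace ℝ F]

theorem isOpen_setOf_isClean (ι : F →ₗᵢ[ℝ] H) : IsOpen {L | IsClean ι L} := by
  have hc : Continuous (cleanMap ι) :=
    (continuous_const.sub continuous_lagGr_proj).clm_comp continuous_const
  have : {L | IsClean ι L} = cleanMap ι ⁻¹' {T | ∃ c > 0, ∀ v, c * ‖v‖ ≤ ‖T v‖} := by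
    ext L; exact isClean_iff
  rw [this]
  exact isOpen_setOf_bounded_below.preimage hc

/-- Cleanness with respect to the orthogonal complement of a subspace. -/
abbrev IsCleanFor (F : Submodule ℝ H) (L : LagGr H) : Prop := IsClean F.subtypeₗᵢ L

omit [CompleteSpace H] in
theorem forall_inner_subtype_iff {F : Submodule ℝ H} {x : H} :
    (∀ f : F, ⟪F.subtypeₗᵢ f, x⟫_ℝ = 0) ↔ x ∈ Fᗮ := by
  rw [Submodule.mem_orthogonal]
  exact ⟨fun h u hu => h ⟨u, hu⟩, fun h f => h f f.2⟩

theorem IsCleanFor.mono {F G : Submodule ℝ H} (hFG : F ≤ G) {L : LagGr H} (h : IsCleanFor F L) :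
    IsCleanFor G L := by
  obtain ⟨c, hc, hb⟩ := h
  refine ⟨c, hc, fun x hx => hb x ?_⟩
  rw [forall_inner_subtype_iff] at hx ⊢
  exact Submodule.orthogonal_le hFG hx

theorem mem_range_cleanMap {F : Submodule ℝ H} {L : LagGr H} {z : SympSpace H} :
    z ∈ (cleanMap F.subtypeₗᵢ L).range ↔ ∃ w ∈ horizontal Fᗮ, w - L.proj w = z := by
  constructor
  · rintro ⟨x, rfl⟩
    exact ⟨_, toLp_mem_horizontal (forall_inner_subtype_iff.1 (mem_range_orthogonal.1 x.2)), rfl⟩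
  · rintro ⟨w, hw, rfl⟩
    have hw' : w = WithLp.toLp 2 (w.fst, 0) := SympSpace.ext rfl hw.2
    exact ⟨⟨w.fst, mem_range_orthogonal.2 (forall_inner_subtype_iff.2 hw.1)⟩,
      (congrArg (fun u => u - L.proj u) hw').symm⟩

/-- Cleanness is the same as a lower bound for the map `x ↦ (1 - P_L) (x, 0)` on `Fᗮ`: this map is
injective when `L` meets `Fᗮ × {0}` only in `0`, and its range is the intersection of the sum
`L + Fᗮ × {0}` with the orthogonal complement of `L`. -/
theorem cleanIntersection_iff {F : Submodule ℝ H} {L : LagGr H} :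
    CleanIntersection L.1 (horizontal Fᗮ) ↔ IsCleanFor F L := by
  constructor
  · rintro ⟨h1, h2⟩
    refine isClean_of_isClosed_range (fun x hx hL => ?_) ?_
    · have : (WithLp.toLp 2 (x, 0) : SympSpace H) ∈ L.1 ⊓ horizontal Fᗮ :=
        ⟨hL, toLp_mem_horizontal (forall_inner_subtype_iff.1 hx)⟩
      rw [h1, Submodule.mem_bot] at this
      exact congrArg WithLp.fst this
    · have : ((cleanMap F.subtypeₗᵢ L).range : Set (SympSpace H)) =
          ((L.1 ⊔ horizontal Fᗮ : Submodule ℝ (SympSpace H)) : Set (SympSpace H)) ∩ (L.1ᗮ : Set _) := by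
        ext z
        rw [SetLike.mem_coe, mem_range_cleanMap]
        constructor
        · rintro ⟨w, hw, rfl⟩
          refine ⟨?_, Submodule.sub_starProjection_mem_orthogonal w⟩
          exact sub_mem (Submodule.mem_sup_right hw)
            (Submodule.mem_sup_left (Submodule.starProjection_apply_mem _ _))
        · rintro ⟨h3, h4⟩
          obtain ⟨l, hl, w, hw, rfl⟩ := Submodule.mem_sup.1 h3
          refine ⟨w, hw, ?_⟩
          have h5 : L.proj (l + w) = 0 := (Submodule.starProjection_apply_eq_zero_iff _).2 h4
          rw [map_add, LagGr.proj, Submodule.starProjection_eq_self_iff.2 hl] at h5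
          rw [← sub_zero (l + w), ← h5]; abel
      rw [this]
      exact h2.inter (Submodule.isClosed_orthogonal _)
  · intro h
    constructor
    · rw [Submodule.eq_bot_iff]
      intro z hz
      have h2 := (mem_horizontal.1 hz.2)
      have hz' : z = WithLp.toLp 2 (z.fst, 0) := SympSpace.ext rfl h2.2
      have := h.eq_zero (forall_inner_subtype_iff.2 h2.1) (hz' ▸ hz.1)
      rw [hz', this]; rfl
    · have : ((L.1 ⊔ horizontal Fᗮ : Submodule ℝ (SympSpace H)) : Set (SympSpace H)) =
          (fun z => z - L.proj z) ⁻¹' ((cleanMap F.subtypeₗᵢ L).range : Set (SympSpace H)) := by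
        ext z
        rw [mem_preimage, SetLike.mem_coe, SetLike.mem_coe, mem_range_cleanMap]
        constructor
        · intro hz
          obtain ⟨l, hl, w, hw, rfl⟩ := Submodule.mem_sup.1 hz
          refine ⟨w, hw, ?_⟩
          rw [map_add, LagGr.proj, Submodule.starProjection_eq_self_iff.2 hl]; abel
        · rintro ⟨w, hw, h3⟩
          have : z = (L.proj z - L.proj w) + w := (eq_add_of_sub_eq h3.symm).trans
            (by rw [sub_add_eq_add_sub, sub_add_eq_add_sub, add_comm w])
          rw [this]
          exact Submodule.add_mem_sup (sub_mem (Submodule.starProjection_apply_mem _ _)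
            (Submodule.starProjection_apply_mem _ _)) hw
      rw [this]
      exact h.isClosed_range.preimage (continuous_id.sub L.proj.continuous)

/-- If `L ∩ (H × {0})` is contained in `F × {0}` and the second projection of `L` is closed, then
`L` has a clean intersection with `Fᗮ × {0}`: if `F` is the first projection of `L ∩ (H × {0})`, the
sum `L + Fᗮ × {0}` is the product of `H` with the second projection of `L`. -/
theorem isCleanFor_of_le {L : LagGr H} {F : Submodule ℝ H} [FiniteDimensional ℝ F]
    (h1 : ∀ z ∈ L.1, z.snd = 0 → z.fst ∈ F)
    (h2 : IsClosed (WithLp.snd '' (L.1 : Set (SympSpace H)))) : IsCleanFor F L := by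
  set F' : Submodule ℝ H := (L.1 ⊓ horizontal ⊤).map (WithLp.fstL 2 ℝ H H).toLinearMap with hF'
  have hle : F' ≤ F := by
    rintro _ ⟨z, hz, rfl⟩
    exact h1 z hz.1 (mem_horizontal_top.1 hz.2)
  have : FiniteDimensional ℝ F' := Submodule.finiteDimensional_of_le hle
  refine IsCleanFor.mono hle (cleanIntersection_iff.1 ⟨?_, ?_⟩)
  · rw [Submodule.eq_bot_iff]
    rintro z ⟨hz1, hz2⟩
    have h3 : z.fst = 0 := by
      have h4 := (mem_horizontal.1 hz2).1 z.fst
        ⟨z, ⟨hz1, mem_horizontal_top.2 (mem_horizontal.1 hz2).2⟩, rfl⟩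
      exact inner_self_eq_zero.1 h4
    exact SympSpace.ext h3 (mem_horizontal.1 hz2).2
  · have : ((L.1 ⊔ horizontal F'ᗮ : Submodule ℝ (SympSpace H)) : Set (SympSpace H)) =
        WithLp.snd ⁻¹' (WithLp.snd '' (L.1 : Set (SympSpace H))) := by
      ext z
      constructor
      · intro hz
        obtain ⟨l, hl, w, hw, rfl⟩ := Submodule.mem_sup.1 hz
        exact ⟨l, hl, by simp [(mem_horizontal.1 hw).2]⟩
      · rintro ⟨l, hl, hlz⟩
        obtain ⟨u, hu, v, hv, huv⟩ := F'.exists_add_mem_mem_orthogonal (z.fst - l.fst)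
        obtain ⟨k, hk, hku⟩ := hu
        have hk2 := mem_horizontal_top.1 hk.2
        change k.fst = u at hku
        have : z = (l + k) + WithLp.toLp 2 (v, 0) := by
          refine SympSpace.ext ?_ ?_
          · simp only [WithLp.add_fst, WithLp.toLp_fst, hku, add_assoc, ← huv]; abel
          · simp [hk2, hlz]
        rw [this]
        exact Submodule.add_mem_sup (add_mem hl hk.1) (toLp_mem_horizontal hv)
    rw [this]
    exact h2.preimage (WithLp.sndL 2 ℝ H H).continuous

theorem exists_isCleanFor {L : LagGr H}
    (h1 : FiniteDimensional ℝ (L.1 ⊓ horizontal ⊤ : Submodule ℝ (SympSpace H)))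
    (h2 : IsClosed (WithLp.snd '' (L.1 : Set (SympSpace H)))) :
    ∃ (F : Submodule ℝ H) (_ : FiniteDimensional ℝ F), IsCleanFor F L :=
  ⟨(L.1 ⊓ horizontal ⊤).map (WithLp.fstL 2 ℝ H H).toLinearMap, inferInstance,
    isCleanFor_of_le (fun z hz h => ⟨z, ⟨hz, mem_horizontal_top.2 h⟩, rfl⟩) h2⟩

/-- On a compact set, a single finite-dimensional subspace works. -/
theorem exists_uniform_isCleanFor {X : Type*} [TopologicalSpace X] {K : Set X} (hK : IsCompact K)
    {l : X → LagGr H} (hl : ContinuousOn l K)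
    (h : ∀ x ∈ K, ∃ (F : Submodule ℝ H) (_ : FiniteDimensional ℝ F), IsCleanFor F (l x)) :
    ∃ (F : Submodule ℝ H) (_ : FiniteDimensional ℝ F), ∀ x ∈ K, IsCleanFor F (l x) := by
  refine hK.induction_on
    (p := fun s => ∃ (F : Submodule ℝ H) (_ : FiniteDimensional ℝ F), ∀ x ∈ s, IsCleanFor F (l x))
    ⟨⊥, inferInstance, by simp⟩ ?_ ?_ ?_
  · rintro s t hst ⟨F, hF, h⟩
    exact ⟨F, hF, fun x hx => h x (hst hx)⟩
  · rintro s t ⟨F, hF, h⟩ ⟨G, hG, h'⟩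
    refine ⟨F ⊔ G, inferInstance, ?_⟩
    rintro x (hx | hx)
    · exact (h x hx).mono le_sup_left
    · exact (h' x hx).mono le_sup_right
  · intro x hx
    obtain ⟨F, hF, h⟩ := h x hx
    exact ⟨_, (hl x hx).preimage_mem_nhdsWithin ((isOpen_setOf_isClean _).mem_nhds h), F, hF,
      fun y hy => hy⟩

end Clean

/-! ### The map `det²` on the Lagrangian Grassmannian -/

section DetSq

open Matrix

variable {F : Type*} [NormedAddCommGroup F] [InnerProductSpace ℝ F]

/-- The frame matrix of an isotropic orthonormal family is unitary: the Hermitian inner products on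
`F ⊗ ℂ` have the inner product of `S(F)` as real part and, up to sign, the symplectic form as
imaginary part. -/
theorem frameMatrix_unitary {n : ℕ} (e : OrthonormalBasis (Fin n) ℝ F) {v : Fin n → SympSpace F}
    (hv : Orthonormal ℝ v) (h : ∀ i j, omega (v i) (v j) = 0) :
    (frameMatrix e v)ᴴ * frameMatrix e v = 1 := by
  ext i j
  rw [Matrix.mul_apply]
  have h1 : ∑ k, (⟪e k, (v i).fst⟫_ℝ * ⟪e k, (v j).fst⟫_ℝ +
      ⟪e k, (v i).snd⟫_ℝ * ⟪e k, (v j).snd⟫_ℝ) = if i = j then 1 else 0 := by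
    rw [← orthonormal_iff_ite.1 hv i j, inner_sympSpace, Finset.sum_add_distrib,
      ← e.sum_inner_mul_inner, ← e.sum_inner_mul_inner (v i).snd]
    simp only [real_inner_comm]
  have h2 : ∑ k, (⟪e k, (v i).fst⟫_ℝ * ⟪e k, (v j).snd⟫_ℝ -
      ⟪e k, (v i).snd⟫_ℝ * ⟪e k, (v j).fst⟫_ℝ) = 0 := by
    rw [← h i j, omega, Finset.sum_sub_distrib, real_inner_comm (v i).fst (v j).snd,
      ← e.sum_inner_mul_inner (v i).fst, ← e.sum_inner_mul_inner (v i).snd]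
    simp only [real_inner_comm]
  apply Complex.ext
  · rw [Complex.re_sum]
    simp only [conjTranspose_apply, frameMatrix, of_apply, Complex.mul_re, Complex.star_def,
      Complex.conj_re, Complex.conj_im, Matrix.one_apply]
    rw [apply_ite Complex.re, Complex.one_re, Complex.zero_re, ← h1]
    exact Finset.sum_congr rfl fun k _ => by ring
  · rw [Complex.im_sum]
    simp only [conjTranspose_apply, frameMatrix, of_apply, Complex.mul_im, Complex.star_def,
      Complex.conj_re, Complex.conj_im, Matrix.one_apply]
    rw [apply_ite Complex.im, Complex.one_im, Complex.zero_im, ite_self, ← h2]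
    exact Finset.sum_congr rfl fun k _ => by ring

theorem norm_det_frameMatrix {n : ℕ} (e : OrthonormalBasis (Fin n) ℝ F) {v : Fin n → SympSpace F}
    (hv : Orthonormal ℝ v) (h : ∀ i j, omega (v i) (v j) = 0) :
    ‖(frameMatrix e v).det‖ = 1 := by
  have h1 := congrArg Matrix.det (frameMatrix_unitary e hv h)
  rw [det_mul, det_conjTranspose, det_one] at h1
  have h2 := congrArg norm h1
  rw [norm_mul, norm_star, norm_one] at h2
  nlinarith [norm_nonneg (frameMatrix e v).det]

/-- Change of frame: determinants of frames of vectors of `L` differ by real factors. -/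
theorem det_frameMatrix_eq {L : Submodule ℝ (SympSpace F)} {n n' : ℕ}
    (e : OrthonormalBasis (Fin n) ℝ F) (e' : OrthonormalBasis (Fin n') ℝ F)
    (v : OrthonormalBasis (Fin n') ℝ L) {w : Fin n → SympSpace F} (hw : ∀ j, w j ∈ L) :
    ∃ r : ℝ, (frameMatrix e w).det = r * (frameMatrix e' fun j => (v j : SympSpace F)).det := by
  have hn : n = n' := by
    have h1 := Module.finrank_eq_card_basis e.toBasis
    have h2 := Module.finrank_eq_card_basis e'.toBasis
    simp only [Fintype.card_fin] at h1 h2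
    omega
  subst hn
  let Q : Matrix (Fin n) (Fin n) ℝ := of fun k k' => ⟪e k, e' k'⟫_ℝ
  let B : Matrix (Fin n) (Fin n) ℝ := of fun j' j => ⟪v j', (⟨w j, hw j⟩ : L)⟫_ℝ
  have hexp : ∀ j, w j = ∑ i, B i j • (v i : SympSpace F) := by
    intro j
    have := congrArg (Subtype.val) (v.sum_repr' (⟨w j, hw j⟩ : L))
    rw [AddSubmonoidClass.coe_finsetSum] at this
    exact this.symm
  have key : frameMatrix e w = Complex.ofRealHom.mapMatrix Q *
      frameMatrix e' (fun j => (v j : SympSpace F)) * Complex.ofRealHom.mapMatrix B := by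
    ext k j
    have hf : ⟪e k, (w j).fst⟫_ℝ =
        ∑ i, (∑ k', Q k k' * ⟪e' k', (v i : SympSpace F).fst⟫_ℝ) * B i j := by
      have : (w j).fst = ∑ i, B i j • (v i : SympSpace F).fst := by
        conv_lhs => rw [hexp j]
        change WithLp.fstₗ 2 ℝ F F _ = _
        rw [map_sum]; rfl
      rw [this, inner_sum]
      refine Finset.sum_congr rfl fun i _ => ?_
      rw [inner_smul_right, mul_comm]
      exact congrArg (· * _) (e'.sum_inner_mul_inner _ _).symm
    have hs : ⟪e k, (w j).snd⟫_ℝ =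
        ∑ i, (∑ k', Q k k' * ⟪e' k', (v i : SympSpace F).snd⟫_ℝ) * B i j := by
      have : (w j).snd = ∑ i, B i j • (v i : SympSpace F).snd := by
        conv_lhs => rw [hexp j]
        change WithLp.sndₗ 2 ℝ F F _ = _
        rw [map_sum]; rfl
      rw [this, inner_sum]
      refine Finset.sum_congr rfl fun i _ => ?_
      rw [inner_smul_right, mul_comm]
      exact congrArg (· * _) (e'.sum_inner_mul_inner _ _).symm
    rw [Matrix.mul_apply]
    simp only [Matrix.mul_apply]
    apply Complex.ext
    · rw [Complex.re_sum]
      simp only [frameMatrix, of_apply, hf, RingHom.mapMatrix_apply, map_apply,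
        Complex.ofRealHom_eq_coe, Complex.re_mul_ofReal, Complex.re_sum, Complex.re_ofReal_mul]
    · rw [Complex.im_sum]
      simp only [frameMatrix, of_apply, hs, RingHom.mapMatrix_apply, map_apply,
        Complex.ofRealHom_eq_coe, Complex.im_mul_ofReal, Complex.im_sum, Complex.im_ofReal_mul]
  refine ⟨Q.det * B.det, ?_⟩
  rw [key, det_mul, det_mul, ← RingHom.map_det, ← RingHom.map_det]
  simp only [Complex.ofRealHom_eq_coe, Complex.ofReal_mul]
  ring

theorem orthonormal_coe_basis {L : Submodule ℝ (SympSpace F)} {n : ℕ}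
    (v : OrthonormalBasis (Fin n) ℝ L) : Orthonormal ℝ fun j => (v j : SympSpace F) :=
  v.orthonormal.comp_linearIsometry L.subtypeₗᵢ

theorem IsDetSq.norm_eq_one {L : Submodule ℝ (SympSpace F)} (hL : IsLagrangian L) {z : ℂ}
    (h : IsDetSq L z) : ‖z‖ = 1 := by
  obtain ⟨n, e, v, rfl⟩ := h
  rw [norm_pow, norm_det_frameMatrix e (orthonormal_coe_basis v)
    fun i j => hL.omega_eq_zero (v i).2 (v j).2, one_pow]

theorem IsDetSq.det_sq_eq {L : Submodule ℝ (SympSpace F)} {z : ℂ}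
    (h : IsDetSq L z) {n : ℕ} (e : OrthonormalBasis (Fin n) ℝ F) {w : Fin n → SympSpace F}
    (hw : ∀ j, w j ∈ L) : ∃ r : ℝ, 0 ≤ r ∧ (frameMatrix e w).det ^ 2 = r * z := by
  obtain ⟨n', e', v, rfl⟩ := h
  obtain ⟨r, hr⟩ := det_frameMatrix_eq e e' v hw
  exact ⟨r ^ 2, by positivity, by rw [hr]; push_cast; ring⟩

theorem eq_of_real_mul {z z' : ℂ} {r : ℝ} (hr : 0 ≤ r) (hz : ‖z‖ = 1) (hz' : ‖z'‖ = 1)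
    (h : z' = r * z) : z' = z := by
  have := congrArg norm h
  rw [norm_mul, hz, hz', mul_one, Complex.norm_real, Real.norm_of_nonneg hr] at this
  rw [h, ← this, Complex.ofReal_one, one_mul]

theorem IsDetSq.unique {L : Submodule ℝ (SympSpace F)} (hL : IsLagrangian L) {z z' : ℂ}
    (h : IsDetSq L z) (h' : IsDetSq L z') : z' = z := by
  have hn := h.norm_eq_one hL
  have hn' := h'.norm_eq_one hL
  obtain ⟨n', e', v, rfl⟩ := h'
  obtain ⟨r, hr, hz⟩ := h.det_sq_eq e' (w := fun j => (v j : SympSpace F)) fun j => (v j).2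
  exact eq_of_real_mul hr hn hn' hz

variable [FiniteDimensional ℝ F]

theorem exists_isDetSq (L : LagGr F) : ∃ z, IsDetSq L.1 z :=
  ⟨_, _, stdOrthonormalBasis ℝ F,
    (stdOrthonormalBasis ℝ L.1).reindex (finCongr L.2.finrank_eq), rfl⟩

/-- The map `det² : Λ(F) → S¹`. -/
def dsq (L : LagGr F) : ℂ := (exists_isDetSq L).choose

theorem isDetSq_dsq (L : LagGr F) : IsDetSq L.1 (dsq L) := (exists_isDetSq L).choose_spec

theorem isDetSq_iff {L : LagGr F} {z : ℂ} : IsDetSq L.1 z ↔ z = dsq L :=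
  ⟨fun h => (isDetSq_dsq L).unique L.2 h, fun h => h ▸ isDetSq_dsq L⟩

theorem norm_dsq (L : LagGr F) : ‖dsq L‖ = 1 := (isDetSq_dsq L).norm_eq_one L.2

theorem dsq_ne_zero (L : LagGr F) : dsq L ≠ 0 := by
  rw [← norm_ne_zero_iff, norm_dsq]; exact one_ne_zero

/-- `det²` can be computed from any basis of `L`. -/
theorem dsq_eq_of_frame {L : LagGr F} {n : ℕ} (e : OrthonormalBasis (Fin n) ℝ F)
    {w : Fin n → SympSpace F} (hw : ∀ j, w j ∈ L.1) (h0 : (frameMatrix e w).det ≠ 0) :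
    dsq L = (frameMatrix e w).det ^ 2 / ((‖(frameMatrix e w).det‖ ^ 2 : ℝ) : ℂ) := by
  obtain ⟨r, hr, hz⟩ := (isDetSq_dsq L).det_sq_eq e hw
  have h1 : ‖(frameMatrix e w).det‖ ^ 2 = r := by
    rw [← norm_pow, hz, norm_mul, norm_dsq, mul_one, Complex.norm_real, Real.norm_of_nonneg hr]
  have h2 : (r : ℂ) ≠ 0 := by
    rw [← h1]; exact_mod_cast pow_ne_zero 2 (norm_ne_zero_iff.2 h0)
  rw [h1, hz, mul_div_cancel_left₀ _ h2]

/-- Continuity of `det²`: near `L₀` the projections of an orthonormal basis of `L₀` form a basis of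
`L`, which depends continuously on `L`. -/
theorem continuous_dsq : Continuous (dsq : LagGr F → ℂ) := by
  rw [continuous_iff_continuousAt]
  intro L₀
  obtain ⟨n, e, v, h⟩ := isDetSq_dsq L₀
  let w : LagGr F → Fin n → SympSpace F := fun L j => L.proj (v j)
  have hw : ∀ L j, w L j ∈ L.1 := fun L j => Submodule.starProjection_apply_mem _ _
  have hw₀ : w L₀ = fun j => (v j : SympSpace F) := by
    funext j; exact Submodule.starProjection_eq_self_iff.2 (v j).2
  have hc : Continuous fun L => (frameMatrix e (w L)).det := by
    refine Continuous.matrix_det (continuous_matrix fun k j => ?_)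
    have h1 : Continuous fun L : LagGr F => L.proj (v j : SympSpace F) :=
      continuous_lagGr_proj.clm_apply continuous_const
    have h2 := (WithLp.fstL 2 ℝ F F).continuous.comp h1
    have h3 := (WithLp.sndL 2 ℝ F F).continuous.comp h1
    have h4 : ∀ L : LagGr F, frameMatrix e (w L) k j =
        (⟪e k, (L.proj (v j : SympSpace F)).fst⟫_ℝ : ℂ) +
          (⟪e k, (L.proj (v j : SympSpace F)).snd⟫_ℝ : ℂ) * Complex.I := fun L =>
      Complex.mk_eq_add_mul_I _ _
    simp only [h4]
    exact (Complex.continuous_ofReal.comp (continuous_const.inner h2)).add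
      ((Complex.continuous_ofReal.comp (continuous_const.inner h3)).mul continuous_const)
  have h0 : (frameMatrix e (w L₀)).det ≠ 0 := by
    rw [hw₀]
    intro h0
    rw [h0] at h
    exact dsq_ne_zero L₀ (by rw [h]; simp)
  have hev : ∀ᶠ L in 𝓝 L₀, (frameMatrix e (w L)).det ≠ 0 := hc.continuousAt.eventually_ne h0
  have hcont : ContinuousAt (fun L => (frameMatrix e (w L)).det ^ 2 /
      ((‖(frameMatrix e (w L)).det‖ ^ 2 : ℝ) : ℂ)) L₀ := by
    refine ContinuousAt.div (hc.pow 2).continuousAt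
      (Complex.continuous_ofReal.comp (hc.norm.pow 2)).continuousAt ?_
    exact_mod_cast pow_ne_zero 2 (norm_ne_zero_iff.2 h0)
  refine hcont.congr ?_
  filter_upwards [hev] with L hL
  exact (dsq_eq_of_frame e (hw L) hL).symm

end DetSq

/-! ### Comparison of `det²` with its value on a reduction -/

section Phase

open Matrix

variable {F : Type*} [NormedAddCommGroup F] [InnerProductSpace ℝ F] [FiniteDimensional ℝ F]
  {G : Type*} [NormedAddCommGroup G] [InnerProductSpace ℝ G] [FiniteDimensional ℝ G]

/-- The complex coordinate along `e` of the projection of `(0, e)` onto `l`. -/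
def kappa (e : G) (l : LagGr G) : ℂ :=
  ⟨⟪e, (l.proj (WithLp.toLp 2 (0, e))).fst⟫_ℝ, ⟪e, (l.proj (WithLp.toLp 2 (0, e))).snd⟫_ℝ⟩

theorem kappa_im (e : G) (l : LagGr G) :
    (kappa e l).im = ‖l.proj (WithLp.toLp 2 (0, e))‖ ^ 2 := by
  have h1 : ⟪e, (l.proj (WithLp.toLp 2 (0, e))).snd⟫_ℝ =
      ⟪(WithLp.toLp 2 (0, e) : SympSpace G), l.proj (WithLp.toLp 2 (0, e))⟫_ℝ := by
    simp
  have h2 : ⟪(WithLp.toLp 2 (0, e) : SympSpace G) - l.proj (WithLp.toLp 2 (0, e)),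
      l.proj (WithLp.toLp 2 (0, e))⟫_ℝ = 0 :=
    Submodule.starProjection_inner_eq_zero _ _ (Submodule.starProjection_apply_mem _ _)
  rw [inner_sub_left, sub_eq_zero] at h2
  change ⟪e, (l.proj (WithLp.toLp 2 (0, e))).snd⟫_ℝ = _
  rw [h1, h2, real_inner_self_eq_norm_sq]

omit [FiniteDimensional ℝ F] in
theorem kappa_im_pos {j : F →ₗᵢ[ℝ] G} {e : G} (he : e ≠ 0) (hje : ∀ f, ⟪j f, e⟫_ℝ = 0)
    {l : LagGr G} (h : IsClean j l) : 0 < (kappa e l).im := by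
  rw [kappa_im]
  refine pow_pos (norm_pos_iff.2 fun h0 => he ?_) 2
  have h1 : (WithLp.toLp 2 (0, e) : SympSpace G) ∈ l.1ᗮ :=
    (Submodule.starProjection_apply_eq_zero_iff _).1 h0
  rw [l.2.mem_orthogonal_iff] at h1
  rw [← neg_eq_zero]
  exact h.eq_zero (fun f => by rw [inner_neg_right, hje, neg_zero]) h1

theorem continuous_kappa (e : G) : Continuous (kappa e) := by
  have h1 : Continuous fun L : LagGr G => L.proj (WithLp.toLp 2 (0, e)) :=
    continuous_lagGr_proj.clm_apply continuous_const
  have h2 := (WithLp.fstL 2 ℝ G G).continuous.comp h1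
  have h3 := (WithLp.sndL 2 ℝ G G).continuous.comp h1
  have h4 : kappa e = fun L : LagGr G =>
      (⟪e, (L.proj (WithLp.toLp 2 (0, e))).fst⟫_ℝ : ℂ) +
        (⟪e, (L.proj (WithLp.toLp 2 (0, e))).snd⟫_ℝ : ℂ) * Complex.I :=
    funext fun L => Complex.mk_eq_add_mul_I _ _
  rw [h4]
  exact (Complex.continuous_ofReal.comp (continuous_const.inner h2)).add
    ((Complex.continuous_ofReal.comp (continuous_const.inner h3)).mul continuous_const)

/-- A corner minor of a unitary matrix is the determinant times the conjugate of the opposite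
corner entry. -/
theorem det_submatrix_castSucc {n : ℕ} {U : Matrix (Fin (n + 1)) (Fin (n + 1)) ℂ}
    (hU : Uᴴ * U = 1) :
    (U.submatrix Fin.castSucc Fin.castSucc).det =
      U.det * star (U (Fin.last n) (Fin.last n)) := by
  have h1 : U.adjugate = U.det • Uᴴ := by
    have h2 : U * Uᴴ = 1 := mul_eq_one_comm.1 hU
    calc U.adjugate = U.adjugate * (U * Uᴴ) := by rw [h2, mul_one]
      _ = U.det • Uᴴ := by rw [← mul_assoc, adjugate_mul, smul_mul_assoc, one_mul]
  have h3 := adjugate_fin_succ_eq_det_submatrix U (Fin.last n) (Fin.last n)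
  rw [h1, ← two_mul, pow_mul, neg_one_sq, one_pow, one_mul, Fin.succAbove_last] at h3
  exact h3.symm

/-- An orthonormal family of the right size as an orthonormal basis. -/
theorem exists_orthonormalBasis {n : ℕ} {v : Fin n → G} (hv : Orthonormal ℝ v)
    (hn : Module.finrank ℝ G = n) : ∃ e : OrthonormalBasis (Fin n) ℝ G, ∀ i, e i = v i := by
  rcases Nat.eq_zero_or_pos n with rfl | h0
  · exact ⟨(stdOrthonormalBasis ℝ G).reindex (finCongr hn), fun i => i.elim0⟩
  · have : Nonempty (Fin n) := ⟨⟨0, h0⟩⟩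
    let b := basisOfOrthonormalOfCardEqFinrank hv (by rw [Fintype.card_fin, hn])
    have hb : ⇑b = v := coe_basisOfOrthonormalOfCardEqFinrank hv _
    refine ⟨b.toOrthonormalBasis (by rwa [hb]), fun i => ?_⟩
    rw [Module.Basis.coe_toOrthonormalBasis, hb]

theorem orthonormal_snoc {E : Type*} [NormedAddCommGroup E] [InnerProductSpace ℝ E] {n : ℕ}
    {v : Fin n → E} (hv : Orthonormal ℝ v) {e : E} (he : ‖e‖ = 1) (h : ∀ i, ⟪v i, e⟫_ℝ = 0) :
    Orthonormal ℝ (Fin.snoc v e : Fin (n + 1) → E) := by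
  rw [orthonormal_iff_ite] at hv ⊢
  intro a b
  induction a using Fin.lastCases with
  | last =>
    induction b using Fin.lastCases with
    | last => simp [he]
    | cast b => simpa [(Fin.castSucc_lt_last b).ne'] using (real_inner_comm _ _).trans (h b)
  | cast a =>
    induction b using Fin.lastCases with
    | last => simp [h, (Fin.castSucc_lt_last a).ne]
    | cast b => simp [hv]

/-- Passing from `F` to a space `G` of one dimension more multiplies `det²` by the square of the
phase of `kappa`. Indeed in an orthonormal frame of `l` adapted to the reduction the frame matrix of
the reduction is a corner of a unitary matrix. -/
theorem dsq_eq_of_finrank_succ {j : F →ₗᵢ[ℝ] G}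
    (hn : Module.finrank ℝ G = Module.finrank ℝ F + 1) {e : G} (he : ‖e‖ = 1)
    (hje : ∀ f, ⟪j f, e⟫_ℝ = 0) {l : LagGr G} (h : IsClean j l) :
    dsq l = dsq (redLag j l) * Complex.exp (((2 * (kappa e l).arg : ℝ) : ℂ) * Complex.I) := by
  have he0 : e ≠ 0 := by rintro rfl; simp at he
  have hκ := kappa_im_pos he0 hje h
  set w := l.proj (WithLp.toLp 2 (0, e)) with hw
  have hwl : w ∈ l.1 := Submodule.starProjection_apply_mem _ _
  have hw0 : 0 < ‖w‖ := by
    rw [kappa_im] at hκ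
    exact (sq_pos_iff.1 hκ).lt_of_le' (norm_nonneg _)
  let n := Module.finrank ℝ F
  -- an orthonormal frame of `l`, the first `n` vectors of which have no `e`-component in `snd`
  let φ : l.1 →ₗ[ℝ] ℝ := (innerₛₗ ℝ e) ∘ₗ (WithLp.sndL 2 ℝ G G).toLinearMap ∘ₗ l.1.subtype
  have hφ : ∀ z : l.1, φ z = ⟪e, (z : SympSpace G).snd⟫_ℝ := fun z => rfl
  have hφw : ∀ z : l.1, φ z = ⟪(z : SympSpace G), w⟫_ℝ := by
    intro z
    have h1 : ⟪(WithLp.toLp 2 (0, e) : SympSpace G) - w, (z : SympSpace G)⟫_ℝ = 0 :=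
      Submodule.starProjection_inner_eq_zero _ _ z.2
    rw [inner_sub_left, sub_eq_zero] at h1
    rw [real_inner_comm, ← h1, hφ]
    simp
  have hφ1 : LinearMap.range φ = ⊤ := by
    refine LinearMap.range_eq_top.2 (LinearMap.surjective fun h0 => ?_)
    have h1 := hφw ⟨w, hwl⟩
    rw [h0, LinearMap.zero_apply, real_inner_self_eq_norm_sq] at h1
    exact absurd h1.symm (pow_pos hw0 2).ne'
  have hK : Module.finrank ℝ (LinearMap.ker φ) = n := by
    have h1 := φ.finrank_range_add_finrank_ker
    rw [hφ1, finrank_top, Module.finrank_self, l.2.finrank_eq, hn] at h1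
    omega
  let b : OrthonormalBasis (Fin n) ℝ (LinearMap.ker φ) :=
    (stdOrthonormalBasis ℝ _).reindex (finCongr hK)
  have hbo : Orthonormal ℝ fun k => ((b k : l.1) : SympSpace G) :=
    b.orthonormal.comp_linearIsometry (l.1.subtypeₗᵢ.comp (LinearMap.ker φ).subtypeₗᵢ)
  have hbφ : ∀ k, φ (b k) = 0 := fun k => (b k).2
  let v : Fin (n + 1) → SympSpace G :=
    Fin.snoc (fun k => ((b k : l.1) : SympSpace G)) (‖w‖⁻¹ • w)
  have hvl : ∀ k, v k ∈ l.1 := by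
    intro k
    induction k using Fin.lastCases with
    | last => simpa [v] using Submodule.smul_mem _ _ hwl
    | cast k => simp [v]
  have hvo : Orthonormal ℝ v := by
    refine orthonormal_snoc hbo ?_ fun k => ?_
    · rw [norm_smul, norm_inv, norm_norm, inv_mul_cancel₀ hw0.ne']
    · rw [inner_smul_right, ← hφw, hbφ, mul_zero]
  -- an adapted orthonormal basis of `G`
  let eF : OrthonormalBasis (Fin n) ℝ F := stdOrthonormalBasis ℝ F
  obtain ⟨eG, heG⟩ := exists_orthonormalBasis
    (orthonormal_snoc (eF.orthonormal.comp_linearIsometry j) he fun k => hje _) hn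
  have heG1 : ∀ k : Fin n, eG k.castSucc = j (eF k) := fun k => by rw [heG]; simp
  have heG2 : eG (Fin.last n) = e := by rw [heG]; simp
  set U := frameMatrix eG v with hUdef
  have hom : ∀ i k, omega (v i) (v k) = 0 := fun i k => l.2.omega_eq_zero (hvl i) (hvl k)
  have hU : Uᴴ * U = 1 := frameMatrix_unitary eG hvo hom
  have hUn : ‖U.det‖ = 1 := norm_det_frameMatrix eG hvo hom
  have hU0 : U.det ≠ 0 := by rw [← norm_ne_zero_iff, hUn]; exact one_ne_zero
  -- the frame of the reduction
  let w' : Fin n → SympSpace F := fun k => adjPair j ((b k : l.1) : SympSpace G)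
  have hw' : ∀ k, w' k ∈ (redLag j l).1 := by
    intro k
    rw [h.redLag_coe]
    have h1 : j (w' k).snd = ((b k : l.1) : SympSpace G).snd := by
      refine eG.repr.injective (PiLp.ext fun i => ?_)
      rw [eG.repr_apply_apply, eG.repr_apply_apply]
      induction i using Fin.lastCases with
      | last =>
        rw [heG2, real_inner_comm, hje, ← hφ, hbφ]
      | cast i => rw [heG1, j.inner_map_map, inner_adjPair_snd]
    refine ⟨((b k : l.1) : SympSpace G).fst, ?_, fun f => (inner_adjPair_fst j _ f).symm⟩
    rw [h1]
    exact (b k : l.1).2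
  have hsub : U.submatrix Fin.castSucc Fin.castSucc = frameMatrix eF w' := by
    ext i k
    simp only [hUdef, submatrix_apply, frameMatrix, of_apply, heG1, v, Fin.snoc_castSucc, w',
      inner_adjPair_fst, inner_adjPair_snd]
  have hcorner : U (Fin.last n) (Fin.last n) = ((‖w‖⁻¹ : ℝ) : ℂ) * kappa e l := by
    have hu : U (Fin.last n) (Fin.last n) =
        ⟨⟪e, (‖w‖⁻¹ • w).fst⟫_ℝ, ⟪e, (‖w‖⁻¹ • w).snd⟫_ℝ⟩ := by
      simp only [hUdef, frameMatrix, of_apply, heG2, v, Fin.snoc_last]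
    rw [hu]
    apply Complex.ext
    · rw [Complex.re_ofReal_mul, WithLp.smul_fst, inner_smul_right]; rfl
    · rw [Complex.im_ofReal_mul, WithLp.smul_snd, inner_smul_right]; rfl
  have hdet := det_submatrix_castSucc hU
  rw [hsub, hcorner] at hdet
  have hκ0 : kappa e l ≠ 0 := by intro h0; rw [h0] at hκ; simp at hκ
  have hwc : ((‖w‖⁻¹ : ℝ) : ℂ) ≠ 0 := by exact_mod_cast inv_ne_zero hw0.ne'
  have hd0 : (frameMatrix eF w').det ≠ 0 := by
    rw [hdet]; exact mul_ne_zero hU0 (star_ne_zero.2 (mul_ne_zero hwc hκ0))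
  have e1 := dsq_eq_of_frame eG hvl hU0
  have e2 := dsq_eq_of_frame eF hw' hd0
  rw [← hUdef, hUn, one_pow, Complex.ofReal_one, div_one] at e1
  rw [hdet, norm_mul, hUn, one_mul, norm_star] at e2
  set a := ((‖w‖⁻¹ : ℝ) : ℂ) with ha
  have hanorm : ‖a * kappa e l‖ ^ 2 = ‖w‖⁻¹ ^ 2 * ‖kappa e l‖ ^ 2 := by
    rw [norm_mul, ha, Complex.norm_real, norm_inv, norm_norm, mul_pow]
  have hstar : star (a * kappa e l) = a * star (kappa e l) := by
    rw [star_mul', ha]; simp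
  have hexp : Complex.exp (((2 * (kappa e l).arg : ℝ) : ℂ) * Complex.I) =
      (kappa e l) ^ 2 / ((‖kappa e l‖ ^ 2 : ℝ) : ℂ) := by
    have h1 := Complex.norm_mul_exp_arg_mul_I (kappa e l)
    have h2 : ((‖kappa e l‖ : ℝ) : ℂ) ≠ 0 := by exact_mod_cast norm_ne_zero_iff.2 hκ0
    conv_rhs => rw [← h1]
    rw [norm_mul, Complex.norm_real, norm_norm, Complex.norm_exp_ofReal_mul_I, mul_one]
    rw [eq_div_iff (by exact_mod_cast pow_ne_zero 2 (norm_ne_zero_iff.2 hκ0)), mul_pow,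
      ← Complex.exp_nat_mul]
    push_cast
    rw [mul_comm]
    congr 2
    ring
  have hnn : star (kappa e l) * kappa e l = ((‖kappa e l‖ ^ 2 : ℝ) : ℂ) := by
    rw [mul_comm, Complex.star_def, Complex.mul_conj, Complex.normSq_eq_norm_sq]
  have hκn : ((‖kappa e l‖ ^ 2 : ℝ) : ℂ) ≠ 0 := by
    exact_mod_cast pow_ne_zero 2 (norm_ne_zero_iff.2 hκ0)
  have hw2 : (((‖w‖⁻¹ ^ 2 : ℝ)) : ℂ) = a ^ 2 := by rw [ha]; push_cast; ring
  rw [e1, e2, hexp, hanorm, hstar, Complex.ofReal_mul, hw2]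
  field_simp
  rw [← hnn]
  ring

/-- An isometry between spaces of the same dimension does not change `det²`. -/
theorem dsq_redLag_of_finrank_eq {j : F →ₗᵢ[ℝ] G}
    (hn : Module.finrank ℝ G = Module.finrank ℝ F) {l : LagGr G} (h : IsClean j l) :
    dsq l = dsq (redLag j l) := by
  obtain ⟨n, e, v, hz⟩ := isDetSq_dsq (redLag j l)
  have hn' : Module.finrank ℝ G = n := by
    rw [hn, Module.finrank_eq_card_basis e.toBasis, Fintype.card_fin]
  obtain ⟨eG, heG⟩ := exists_orthonormalBasis (e.orthonormal.comp_linearIsometry j) hn'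
  let w : Fin n → SympSpace G := fun k =>
    WithLp.toLp 2 (j (v k : SympSpace F).fst, j (v k : SympSpace F).snd)
  have hw : ∀ k, w k ∈ l.1 := by
    intro k
    have h1 := (v k).2
    have h2 : ((v k : SympSpace F)) ∈ red j l.1 := h.redLag_coe ▸ h1
    obtain ⟨x, hx, hxf⟩ := h2
    have h3 : x = j (v k : SympSpace F).fst := by
      refine eG.repr.injective (PiLp.ext fun i => ?_)
      rw [eG.repr_apply_apply, eG.repr_apply_apply, heG]
      exact (hxf _).trans (j.inner_map_map _ _).symm
    rw [h3] at hx
    exact hx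
  have hM : frameMatrix eG w = frameMatrix e fun k => (v k : SympSpace F) := by
    ext i k
    simp only [frameMatrix, of_apply, heG, w, WithLp.toLp_fst, WithLp.toLp_snd,
      Function.comp_apply, j.inner_map_map]
  have hd : (frameMatrix eG w).det ≠ 0 := by
    intro h0
    rw [← hM, h0] at hz
    exact dsq_ne_zero _ (by rw [hz]; simp)
  have hnorm := norm_dsq (redLag j l)
  have h2 := dsq_eq_of_frame eG hw hd
  rw [hM, ← norm_pow, ← hz, hnorm, Complex.ofReal_one, div_one] at h2
  exact h2

/-- On the Lagrangian subspaces which are clean with respect to `j : F → G`, the quotient of `det²`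
by `det²` of the reduction has a continuous logarithm. -/
theorem exists_phase_of_isometry.{u} {F : Type*} [NormedAddCommGroup F] [InnerProductSpace ℝ F]
    [FiniteDimensional ℝ F] (n : ℕ) {G : Type u} [NormedAddCommGroup G] [InnerProductSpace ℝ G]
    [FiniteDimensional ℝ G] (j : F →ₗᵢ[ℝ] G)
    (hn : Module.finrank ℝ G = Module.finrank ℝ F + n) :
    ∃ ψ : LagGr G → ℝ, ContinuousOn ψ {l | IsClean j l} ∧
      ∀ l, IsClean j l → dsq l = dsq (redLag j l) * Complex.exp ((ψ l : ℂ) * Complex.I) := by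
  induction n generalizing G with
  | zero =>
    exact ⟨fun _ => 0, continuousOn_const, fun l hl => by
      rw [dsq_redLag_of_finrank_eq hn hl]; simp⟩
  | succ n ih =>
    have hlt : j.toLinearMap.range ≠ ⊤ := by
      intro h
      have h1 := LinearMap.finrank_range_of_inj (f := j.toLinearMap) j.injective
      rw [h, finrank_top] at h1
      omega
    obtain ⟨u, hu, hu0⟩ := Submodule.exists_mem_ne_zero_of_ne_bot
      (mt Submodule.orthogonal_eq_bot_iff.1 hlt)
    set e : G := ‖u‖⁻¹ • u with he
    have he1 : ‖e‖ = 1 := by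
      rw [he, norm_smul, norm_inv, norm_norm, inv_mul_cancel₀ (norm_ne_zero_iff.2 hu0)]
    have he0 : e ≠ 0 := by intro h; rw [h, norm_zero] at he1; exact zero_ne_one he1
    have hje : ∀ f, ⟪j f, e⟫_ℝ = 0 := fun f => by
      rw [he, inner_smul_right, mem_range_orthogonal.1 hu f, mul_zero]
    let G' : Submodule ℝ G := (ℝ ∙ e)ᗮ
    have hG' : Module.finrank ℝ G' + 1 = Module.finrank ℝ G := by
      have h1 := (ℝ ∙ e).finrank_add_finrank_orthogonal
      rw [finrank_span_singleton he0] at h1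
      rw [← h1, add_comm]
    let j' : F →ₗᵢ[ℝ] G' :=
      { toLinearMap := j.toLinearMap.codRestrict G' fun f =>
          Submodule.mem_orthogonal_singleton_iff_inner_left.2 (hje f)
        norm_map' := fun f => j.norm_map f }
    have hjj' : G'.subtypeₗᵢ.comp j' = j := by ext f; rfl
    obtain ⟨ψ, hψ, hψ'⟩ := ih j' (by omega)
    have hG'e : ∀ g : G', ⟪G'.subtypeₗᵢ g, e⟫_ℝ = 0 := fun g =>
      Submodule.mem_orthogonal_singleton_iff_inner_left.1 g.2
    have hc : ∀ l, IsClean j l → IsClean (G'.subtypeₗᵢ.comp j') l := fun l hl => hjj'.symm ▸ hl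
    refine ⟨fun l => ψ (redLag G'.subtypeₗᵢ l) + 2 * (kappa e l).arg, ?_, fun l hl => ?_⟩
    · refine ContinuousOn.add ?_ (continuousOn_const.mul ?_)
      · exact hψ.comp ((continuousOn_redLag G'.subtypeₗᵢ).mono fun l hl => (hc l hl).of_comp)
          fun l hl => (hc l hl).comp
      · intro l hl
        refine ((Complex.continuousAt_arg ?_).comp
          (continuous_kappa e).continuousAt).continuousWithinAt
        exact Complex.mem_slitPlane_iff.2 (.inr (kappa_im_pos he0 hje hl).ne')
    · rw [dsq_eq_of_finrank_succ hG'.symm he1 hG'e (hc l hl).of_comp,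
        hψ' _ (hc l hl).comp, ← redLag_comp (hc l hl), hjj', mul_assoc, ← Complex.exp_add]
      congr 2
      push_cast
      ring

end Phase

/-! ### Angular functions of circle-valued maps -/

section Lifts

open Complex

theorem exp_mul_I_eq_circle (x : ℝ) : Complex.exp ((x : ℂ) * I) = (Circle.exp x : ℂ) :=
  (Circle.coe_exp x).symm

/-- A map to the unit circle defined on a retract of a simply connected space has a continuous
angle. -/
theorem exists_angle {A : Type*} [TopologicalSpace A] [SimplyConnectedSpace A]
    [LocallyPathConnectedSpace A] {s : Set A} {r : A → A} (hr : Continuous r)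
    (hrs : ∀ x, r x ∈ s) (hr' : ∀ x ∈ s, r x = x) {z : A → ℂ} (hz : ContinuousOn z s)
    (hn : ∀ x ∈ s, ‖z x‖ = 1) :
    ∃ θ : A → ℝ, Continuous θ ∧ ∀ x ∈ s, z x = Complex.exp ((θ x : ℂ) * I) := by
  let f : C(A, Circle) :=
    { toFun := fun x => ⟨z (r x), mem_sphere_zero_iff_norm.2 (hn _ (hrs x))⟩
      continuous_toFun := by
        refine Continuous.subtype_mk ?_ _
        exact hz.comp_continuous hr hrs }
  obtain ⟨x₀⟩ : Nonempty A := inferInstance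
  obtain ⟨t₀, ht₀⟩ := Circle.exp_surjective (f x₀)
  obtain ⟨θ, ⟨-, hθ⟩, -⟩ := Circle.isCoveringMap_exp.existsUnique_continuousMap_lifts f
    (a₀ := x₀) (e₀ := t₀) ht₀
  refine ⟨θ, θ.continuous, fun x hx => ?_⟩
  have h1 := congrFun hθ x
  rw [exp_mul_I_eq_circle]
  have h2 : Circle.exp (θ x) = f x := h1
  rw [h2]
  change z x = z (r x)
  rw [hr' x hx]

theorem exists_angle_Icc {a b : ℝ} (hab : a ≤ b) {z : ℝ → ℂ} (hz : ContinuousOn z (Icc a b))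
    (hn : ∀ t ∈ Icc a b, ‖z t‖ = 1) :
    ∃ θ : ℝ → ℝ, ContinuousOn θ (Icc a b) ∧
      ∀ t ∈ Icc a b, z t = Complex.exp ((θ t : ℂ) * I) := by
  obtain ⟨θ, h1, h2⟩ := exists_angle (r := fun t => (projIcc a b hab t : ℝ)) (by fun_prop)
    (fun t => (projIcc a b hab t).2) (fun t ht => by rw [projIcc_of_mem hab ht]) hz hn
  exact ⟨θ, h1.continuousOn, h2⟩

theorem exists_angle_Icc_prod {a b c d : ℝ} (hab : a ≤ b) (hcd : c ≤ d) {z : ℝ × ℝ → ℂ}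
    (hz : ContinuousOn z (Icc a b ×ˢ Icc c d)) (hn : ∀ t ∈ Icc a b ×ˢ Icc c d, ‖z t‖ = 1) :
    ∃ θ : ℝ × ℝ → ℝ, ContinuousOn θ (Icc a b ×ˢ Icc c d) ∧
      ∀ t ∈ Icc a b ×ˢ Icc c d, z t = Complex.exp ((θ t : ℂ) * I) := by
  obtain ⟨θ, h1, h2⟩ := exists_angle
    (r := fun t : ℝ × ℝ => ((projIcc a b hab t.1 : ℝ), (projIcc c d hcd t.2 : ℝ))) (by fun_prop)
    (s := Icc a b ×ˢ Icc c d)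
    (fun t => ⟨(projIcc a b hab t.1).2, (projIcc c d hcd t.2).2⟩)
    (fun t ht => Prod.ext (by simp only [projIcc_of_mem hab ht.1])
      (by simp only [projIcc_of_mem hcd ht.2])) hz hn
  exact ⟨θ, h1.continuousOn, h2⟩

theorem angle_sub_eq {a b : ℝ} (hab : a ≤ b) {θ θ' : ℝ → ℝ} (hθ : ContinuousOn θ (Icc a b))
    (hθ' : ContinuousOn θ' (Icc a b))
    (h : ∀ t ∈ Icc a b, Complex.exp ((θ t : ℂ) * I) = Complex.exp ((θ' t : ℂ) * I)) :
    θ b - θ a = θ' b - θ' a := by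
  have ha : a ∈ Icc a b := left_mem_Icc.2 hab
  have h1 : EqOn θ (fun t => θ' t + (θ a - θ' a)) (Icc a b) := by
    refine Circle.isCoveringMap_exp.eqOn_of_comp_eqOn isPreconnected_Icc hθ
      (hθ'.add continuousOn_const) (fun t ht => ?_) ha (by ring)
    have h2 : ∀ t ∈ Icc a b, Circle.exp (θ t) = Circle.exp (θ' t) := fun t ht =>
      Circle.ext (by rw [← exp_mul_I_eq_circle, ← exp_mul_I_eq_circle, h t ht])
    simp only [Function.comp_apply, Circle.exp_add, Circle.exp_sub, h2 t ht, h2 a ha, div_self',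
      mul_one]
  have := h1 (right_mem_Icc.2 hab)
  simp only at this
  linarith

theorem exists_int_of_exp_eq {x y : ℝ}
    (h : Complex.exp ((x : ℂ) * I) = Complex.exp ((y : ℂ) * I)) :
    ∃ k : ℤ, x - y = 2 * Real.pi * k := by
  have h2 : Circle.exp x = Circle.exp y :=
    Circle.ext (by rw [← exp_mul_I_eq_circle, ← exp_mul_I_eq_circle, h])
  obtain ⟨k, hk⟩ := Circle.exp_eq_exp.1 h2
  exact ⟨k, by rw [hk]; ring⟩

theorem exp_two_pi_int (m : ℤ) : Complex.exp (((2 * Real.pi * m : ℝ) : ℂ) * I) = 1 := by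
  rw [Complex.exp_eq_one_iff]
  exact ⟨m, by push_cast; ring⟩

theorem continuousOn_glue {X : Type*} [TopologicalSpace X] {f g : ℝ → X} {a b c : ℝ}
    (hab : a ≤ b) (hbc : b ≤ c) (hf : ContinuousOn f (Icc a b)) (hg : ContinuousOn g (Icc b c))
    (h : f b = g b) : ContinuousOn (fun t => if t ≤ b then f t else g t) (Icc a c) := by
  rw [← Icc_union_Icc_eq_Icc hab hbc]
  refine ContinuousOn.union_of_isClosed (hf.congr fun t ht => if_pos ht.2)
    (hg.congr fun t ht => ?_) isClosed_Icc isClosed_Icc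
  rcases ht.1.eq_or_lt with rfl | h1
  · simp [h]
  · exact if_neg (not_le.2 h1)

end Lifts

/-! ### The Maslov index relative to `F × {0}` in terms of angles -/

section RelIndex

open Complex

variable {F : Type*} [NormedAddCommGroup F] [InnerProductSpace ℝ F] [FiniteDimensional ℝ F]

/-- `φ` is a continuous choice of the angle of `det²` on the Lagrangian subspaces transverse to
`F × {0}`. -/
def IsPhase (φ : LagGr F → ℝ) : Prop :=
  ContinuousOn φ {l | IsTransverse l} ∧
    ∀ l, IsTransverse l → dsq l = Complex.exp ((φ l : ℂ) * I)

theorem isClean_of_isTransverse {E : Type*} [NormedAddCommGroup E] [InnerProductSpace ℝ E]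
    {j : E →ₗᵢ[ℝ] F} {l : LagGr F} (hl : IsTransverse l) : IsClean j l :=
  isClean_of_finiteDimensional fun _ _ h => isTransverse_iff.1 hl _ h rfl

variable (F) in
/-- On the contractible set of Lagrangian subspaces transverse to `F × {0}`, `det²` has a continuous
angle. This is the comparison with the reduction to the zero space. -/
theorem exists_isPhase : ∃ φ : LagGr F → ℝ, IsPhase φ := by
  let E := EuclideanSpace ℝ (Fin 0)
  let j : E →ₗᵢ[ℝ] F := ⟨0, fun x => by rw [Subsingleton.elim x 0, map_zero, norm_zero, norm_zero]⟩
  obtain ⟨ψ, h1, h2⟩ := exists_phase_of_isometry (Module.finrank ℝ F) j (by simp [E])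
  refine ⟨ψ, h1.mono fun l hl => isClean_of_isTransverse hl, fun l hl => ?_⟩
  have h3 : dsq (redLag j l) = 1 := by
    obtain ⟨n, e, v, h⟩ := isDetSq_dsq (redLag j l)
    have hn : n = 0 := by
      have := Module.finrank_eq_card_basis e.toBasis
      simpa [E] using this.symm
    subst hn
    rw [h]; simp
  rw [h2 l (isClean_of_isTransverse hl), h3, one_mul]

theorem isLagPair_one {C : F →L[ℝ] F} (hC : IsSelfAdjoint C) : IsLagPair C 1 :=
  ⟨hC, .one _, .one_right _, 1, one_pos, fun v => by simp⟩

/-- A Lagrangian subspace transverse to `F × {0}` is the transposed graph of a symmetric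
operator. -/
theorem exists_eq_pairLag_one {l : LagGr F} (hl : IsTransverse l) :
    ∃ C : F →L[ℝ] F, IsSelfAdjoint C ∧ l = pairLag C 1 := by
  have hsnd : Function.Injective ((WithLp.sndL 2 ℝ F F).toLinearMap ∘ₗ l.1.subtype) := by
    rw [injective_iff_map_eq_zero]
    intro z hz
    exact Subtype.ext (SympSpace.ext (isTransverse_iff.1 hl _ z.2 hz) hz)
  let e := LinearEquiv.ofInjectiveOfFinrankEq _ hsnd l.2.finrank_eq
  have he : ∀ y, ((e.symm y : l.1) : SympSpace F).snd = y := fun y => e.apply_symm_apply y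
  let C₀ : F →ₗ[ℝ] F := (WithLp.fstL 2 ℝ F F).toLinearMap ∘ₗ l.1.subtype ∘ₗ e.symm.toLinearMap
  have hC₀ : C₀.IsSymmetric := by
    intro x y
    have h := l.2.inner_comm (e.symm x).2 (e.symm y).2
    rw [he, he] at h
    exact (real_inner_comm _ _).trans h
  have hC : IsSelfAdjoint (LinearMap.toContinuousLinearMap C₀) :=
    LinearMap.IsSymmetric.isSelfAdjoint hC₀
  refine ⟨LinearMap.toContinuousLinearMap C₀, hC, Subtype.ext ?_⟩
  refine IsLagrangian.eq_of_le l.2 (pairLag _ _).2 fun z hz => ?_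
  rw [(isLagPair_one hC).coe_pairLag]
  have hz' : e.symm z.snd = ⟨z, hz⟩ := by
    rw [LinearEquiv.symm_apply_eq]; rfl
  refine ⟨z.snd, SympSpace.ext ?_ rfl⟩
  change ((e.symm z.snd : l.1) : SympSpace F).fst = z.fst
  rw [hz']

/-- The Lagrangian subspaces transverse to `F × {0}` form a path-connected set. -/
theorem exists_transverse_path {l₀ l₁ : LagGr F} (h₀ : IsTransverse l₀) (h₁ : IsTransverse l₁)
    (b : ℝ) : ∃ c : ℝ → LagGr F, Continuous c ∧ (∀ t, IsTransverse (c t)) ∧ c b = l₀ ∧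
      c (b + 1) = l₁ := by
  obtain ⟨C₀, hC₀, rfl⟩ := exists_eq_pairLag_one h₀
  obtain ⟨C₁, hC₁, rfl⟩ := exists_eq_pairLag_one h₁
  have hC : ∀ t : ℝ, IsSelfAdjoint (C₀ + (t - b) • (C₁ - C₀)) := fun t =>
    hC₀.add (IsSelfAdjoint.smul (.all (t - b)) (hC₁.sub hC₀))
  refine ⟨fun t => pairLag (C₀ + (t - b) • (C₁ - C₀)) 1, ?_, fun t => ?_, ?_, ?_⟩
  · rw [← continuousOn_univ]
    refine continuousOn_pairLag (Continuous.continuousOn ?_) continuousOn_const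
      fun t _ => isLagPair_one (hC t)
    exact continuous_const.add ((continuous_id.sub continuous_const).smul continuous_const)
  · exact (isLagPair_one (hC t)).isTransverse fun v hv => hv
  · beta_reduce
    rw [sub_self, zero_smul, add_zero]
  · beta_reduce
    rw [add_sub_cancel_left, one_smul, add_sub_cancel]

/-- The Maslov index relative to `F × {0}` is the variation of the angle of `det²` along the path,
corrected by the variation along a closing path, which is determined by the endpoints. -/
theorem hasRelMaslovIndex_iff {l : ℝ → LagGr F} {a b : ℝ} (hab : a ≤ b)
    (hl : ContinuousOn l (Icc a b)) (ha : IsTransverse (l a)) (hb : IsTransverse (l b))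
    {θ : ℝ → ℝ} (hθ : ContinuousOn θ (Icc a b))
    (hθ' : ∀ t ∈ Icc a b, dsq (l t) = Complex.exp ((θ t : ℂ) * I))
    {φ : LagGr F → ℝ} (hφ : IsPhase φ) {m : ℤ} :
    HasRelMaslovIndex (horizontal (⊤ : Submodule ℝ F)) l a b m ↔
      θ b - θ a - (φ (l b) - φ (l a)) = 2 * Real.pi * m := by
  have hb1 : b ≤ b + 1 := by linarith
  have hbI : b ∈ Icc a b := right_mem_Icc.2 hab
  constructor
  · rintro ⟨l', hl', h1, h2, h3, z, hz, θ', hθ1, hθ2, hθ3⟩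
    have e1 : θ' b - θ' a = θ b - θ a := by
      refine angle_sub_eq hab (hθ1.mono (Icc_subset_Icc_right hb1)) hθ fun t ht => ?_
      have ht' := Icc_subset_Icc_right hb1 ht
      rw [← hθ2 t ht', ← hθ' t ht, isDetSq_iff.1 (hz t ht'), h1 t ht]
    have e2 : θ' (b + 1) - θ' b = φ (l' (b + 1)) - φ (l' b) := by
      refine angle_sub_eq (θ' := fun t => φ (l' t)) hb1 (hθ1.mono (Icc_subset_Icc_left hab))
        (hφ.1.comp (hl'.mono (Icc_subset_Icc_left hab)) h2) fun t ht => ?_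
      have ht' := Icc_subset_Icc_left hab ht
      rw [← hθ2 t ht', ← hφ.2 _ (h2 t ht), isDetSq_iff.1 (hz t ht')]
    rw [h3, h1 b hbI] at e2
    linarith
  · intro h
    obtain ⟨c, hc, hct, hcb, hca⟩ := exists_transverse_path hb ha b
    set l' : ℝ → LagGr F := fun t => if t ≤ b then l t else c t with hl'
    have hl1 : ∀ t, t ≤ b → l' t = l t := fun t ht => if_pos ht
    have hl2 : ∀ t, b ≤ t → l' t = c t := fun t ht => by
      rcases ht.eq_or_lt with rfl | h1
      · rw [hl1 _ le_rfl, hcb]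
      · exact if_neg (not_le.2 h1)
    refine ⟨l', continuousOn_glue hab hb1 hl hc.continuousOn hcb.symm, fun t ht => hl1 t ht.2,
      fun t ht => ?_, ?_, fun t => dsq (l' t), fun t _ => isDetSq_dsq _,
      fun t => if t ≤ b then θ t else φ (c t) - φ (c b) + θ b, ?_, fun t ht => ?_, ?_⟩
    · rw [hl2 t ht.1]; exact hct t
    · rw [hl2 _ hb1, hca]
    · refine continuousOn_glue hab hb1 hθ ?_ (by simp)
      exact (((hφ.1.comp_continuous hc hct).sub continuous_const).add
        continuous_const).continuousOn
    · by_cases htb : t ≤ b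
      · simp only [if_pos htb]
        rw [hl1 t htb, hθ' t ⟨ht.1, htb⟩]
      · simp only [if_neg htb]
        rw [hl2 t (not_le.1 htb).le, hφ.2 _ (hct t)]
        have h4 : Complex.exp ((φ (c b) : ℂ) * I) = Complex.exp ((θ b : ℂ) * I) := by
          rw [← hφ.2 _ (hct b), hcb, hθ' b hbI]
        push_cast
        rw [add_mul, sub_mul, Complex.exp_add, Complex.exp_sub, h4,
          div_mul_cancel₀ _ (Complex.exp_ne_zero _)]
    · beta_reduce
      rw [if_neg (not_le.2 (lt_add_one b)), if_pos hab, hca, hcb]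
      linarith

theorem exists_angle_sub_eq {l : ℝ → LagGr F} {a b : ℝ} (ha : IsTransverse (l a))
    (hb : IsTransverse (l b)) {x y : ℝ} (hx : dsq (l a) = Complex.exp ((x : ℂ) * I))
    (hy : dsq (l b) = Complex.exp ((y : ℂ) * I)) {φ : LagGr F → ℝ} (hφ : IsPhase φ) :
    ∃ m : ℤ, y - x - (φ (l b) - φ (l a)) = 2 * Real.pi * m := by
  obtain ⟨k, hk⟩ := exists_int_of_exp_eq (hx.symm.trans (hφ.2 _ ha))
  obtain ⟨k', hk'⟩ := exists_int_of_exp_eq (hy.symm.trans (hφ.2 _ hb))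
  exact ⟨k' - k, by push_cast; linarith⟩

end RelIndex

/-! ### The generalized Maslov index of paths of Lagrangian subspaces -/

section GenIndex

open Complex

variable {H : Type*} [NormedAddCommGroup H] [InnerProductSpace ℝ H] [CompleteSpace H]

/-- The paths in `Λ(H)` which have a generalized Maslov index: continuous paths of Lagrangian
subspaces which form Fredholm pairs with `H × {0}`, with transverse endpoints. -/
structure IsAdmissiblePath (L : ℝ → LagGr H) (a b : ℝ) : Prop where
  continuousOn : ContinuousOn L (Icc a b)
  exists_clean : ∀ t ∈ Icc a b, ∃ (F : Submodule ℝ H) (_ : FiniteDimensional ℝ F),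
    IsCleanFor F (L t)
  left : IsTransverse (L a)
  right : IsTransverse (L b)

/-- The reduction of `L` modulo `Fᗮ × {0}`. -/
abbrev redFor (F : Submodule ℝ H) [FiniteDimensional ℝ F] (L : LagGr H) : LagGr F :=
  redLag F.subtypeₗᵢ L

theorem IsAdmissiblePath.exists_uniform {L : ℝ → LagGr H} {a b : ℝ} (h : IsAdmissiblePath L a b) :
    ∃ (F : Submodule ℝ H) (_ : FiniteDimensional ℝ F), ∀ t ∈ Icc a b, IsCleanFor F (L t) :=
  exists_uniform_isCleanFor isCompact_Icc h.continuousOn h.exists_clean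

theorem continuousOn_redFor {X : Type*} [TopologicalSpace X] {F : Submodule ℝ H}
    [FiniteDimensional ℝ F] {L : X → LagGr H} {s : Set X} (hL : ContinuousOn L s)
    (hF : ∀ t ∈ s, IsCleanFor F (L t)) : ContinuousOn (fun t => redFor F (L t)) s :=
  (continuousOn_redLag F.subtypeₗᵢ).comp hL hF

/-- The relative Maslov index of the reduced path does not change when `F` is enlarged. -/
theorem hasRelMaslovIndex_redFor_iff_of_le {F G : Submodule ℝ H} [FiniteDimensional ℝ F]
    [FiniteDimensional ℝ G] (hFG : F ≤ G) {L : ℝ → LagGr H} {a b : ℝ} (hab : a ≤ b)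
    (h : IsAdmissiblePath L a b) (hF : ∀ t ∈ Icc a b, IsCleanFor F (L t)) {m : ℤ} :
    HasRelMaslovIndex (horizontal (⊤ : Submodule ℝ F)) (fun t => redFor F (L t)) a b m ↔
      HasRelMaslovIndex (horizontal (⊤ : Submodule ℝ G)) (fun t => redFor G (L t)) a b m := by
  have hG : ∀ t ∈ Icc a b, IsCleanFor G (L t) := fun t ht => (hF t ht).mono hFG
  have ha := left_mem_Icc.2 hab
  have hb := right_mem_Icc.2 hab
  let j : F →ₗᵢ[ℝ] G := ⟨Submodule.inclusion hFG, fun _ => rfl⟩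
  have hj : G.subtypeₗᵢ.comp j = F.subtypeₗᵢ := rfl
  have hc : ∀ t ∈ Icc a b, IsClean (G.subtypeₗᵢ.comp j) (L t) := hF
  have hjc : ∀ t ∈ Icc a b, IsClean j (redFor G (L t)) := fun t ht => (hc t ht).comp
  have hjr : ∀ t ∈ Icc a b, redFor F (L t) = redLag j (redFor G (L t)) := fun t ht =>
    redLag_comp (hc t ht)
  have hlF := continuousOn_redFor h.continuousOn hF
  have hlG := continuousOn_redFor h.continuousOn hG
  obtain ⟨n, hn⟩ := Nat.exists_eq_add_of_le (Submodule.finrank_mono hFG)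
  obtain ⟨ψ, hψ, hψ'⟩ := exists_phase_of_isometry n j hn
  obtain ⟨θ, hθ, hθ'⟩ := exists_angle_Icc hab (continuous_dsq.comp_continuousOn hlF)
    fun t _ => norm_dsq _
  obtain ⟨φ, hφ⟩ := exists_isPhase F
  have hφG : IsPhase fun l => φ (redLag j l) + ψ l := by
    have hsub : {l : LagGr G | IsTransverse l} ⊆ {l | IsClean j l} := fun l hl =>
      isClean_of_isTransverse hl
    refine ⟨ContinuousOn.add ?_ (hψ.mono hsub), fun l hl => ?_⟩
    · exact hφ.1.comp ((continuousOn_redLag j).mono hsub) fun l hl =>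
        isTransverse_redLag (hsub hl) hl
    · rw [hψ' l (hsub hl), hφ.2 _ (isTransverse_redLag (hsub hl) hl), ← Complex.exp_add]
      push_cast
      rw [add_mul]
  rw [hasRelMaslovIndex_iff hab hlF (isTransverse_redLag (hF a ha) h.left)
      (isTransverse_redLag (hF b hb) h.right) hθ hθ' hφ,
    hasRelMaslovIndex_iff hab hlG (isTransverse_redLag (hG a ha) h.left)
      (isTransverse_redLag (hG b hb) h.right) (θ := fun t => θ t + ψ (redFor G (L t)))
      (hθ.add (hψ.comp hlG hjc)) (fun t ht => ?_) hφG]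
  · rw [hjr a ha, hjr b hb]
    refine Eq.congr ?_ rfl
    ring
  · rw [hψ' _ (hjc t ht), ← hjr t ht]
    have h1 := hθ' t ht
    simp only [Function.comp_apply] at h1
    rw [h1, ← Complex.exp_add]
    push_cast
    rw [add_mul]

theorem hasRelMaslovIndex_congr {F : Type*} [NormedAddCommGroup F] [InnerProductSpace ℝ F]
    [CompleteSpace F] {R : Submodule ℝ (SympSpace F)} {l l₁ : ℝ → LagGr F} {a b : ℝ} (hab : a ≤ b)
    (h : ∀ t ∈ Icc a b, l t = l₁ t) {m : ℤ} (hm : HasRelMaslovIndex R l a b m) :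
    HasRelMaslovIndex R l₁ a b m := by
  obtain ⟨l', h1, h2, h3, h4, h5⟩ := hm
  exact ⟨l', h1, fun t ht => (h2 t ht).trans (h t ht), h3,
    h4.trans (h a (left_mem_Icc.2 hab)), h5⟩

/-- The generalized Maslov index can be computed from any `F`. -/
theorem hasGenMaslovIndex_iff_redFor {F : Submodule ℝ H} [FiniteDimensional ℝ F]
    {L : ℝ → LagGr H} {a b : ℝ} (hab : a ≤ b)
    (h : IsAdmissiblePath L a b) (hF : ∀ t ∈ Icc a b, IsCleanFor F (L t)) {m : ℤ} :
    HasGenMaslovIndex L a b m ↔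
      HasRelMaslovIndex (horizontal (⊤ : Submodule ℝ F)) (fun t => redFor F (L t)) a b m := by
  constructor
  · rintro ⟨F', hF'd, hF', l, hl, hm⟩
    have hF'c : ∀ t ∈ Icc a b, IsCleanFor F' (L t) := fun t ht => cleanIntersection_iff.1 (hF' t ht)
    have hm' := hasRelMaslovIndex_congr (l₁ := fun t => redFor F' (L t)) hab (fun t ht =>
      Subtype.ext ((hl t ht).trans ((sympReduction_eq_red F' _).trans
        (hF'c t ht).redLag_coe.symm))) hm
    rwa [hasRelMaslovIndex_redFor_iff_of_le (le_sup_right : F' ≤ F ⊔ F') hab h hF'c,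
      ← hasRelMaslovIndex_redFor_iff_of_le (le_sup_left : F ≤ F ⊔ F') hab h hF] at hm'
  · intro hm
    exact ⟨F, inferInstance, fun t ht => cleanIntersection_iff.2 (hF t ht), _, fun t ht =>
      ((hF t ht).redLag_coe).trans (sympReduction_eq_red F _).symm, hm⟩

/-- The generalized Maslov index in terms of angles. -/
theorem hasGenMaslovIndex_iff {F : Submodule ℝ H} [FiniteDimensional ℝ F]
    {L : ℝ → LagGr H} {a b : ℝ} (hab : a ≤ b)
    (h : IsAdmissiblePath L a b) (hF : ∀ t ∈ Icc a b, IsCleanFor F (L t))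
    {θ : ℝ → ℝ} (hθ : ContinuousOn θ (Icc a b))
    (hθ' : ∀ t ∈ Icc a b, dsq (redFor F (L t)) = Complex.exp ((θ t : ℂ) * I))
    {φ : LagGr F → ℝ} (hφ : IsPhase φ) {m : ℤ} :
    HasGenMaslovIndex L a b m ↔
      θ b - θ a - (φ (redFor F (L b)) - φ (redFor F (L a))) = 2 * Real.pi * m := by
  rw [hasGenMaslovIndex_iff_redFor hab h hF,
    hasRelMaslovIndex_iff hab (continuousOn_redFor h.continuousOn hF)
      (isTransverse_redLag (hF a (left_mem_Icc.2 hab)) h.left)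
      (isTransverse_redLag (hF b (right_mem_Icc.2 hab)) h.right) hθ hθ' hφ]

theorem int_eq_of_two_pi_mul_eq {m n : ℤ} (h : 2 * Real.pi * (m : ℝ) = 2 * Real.pi * n) :
    m = n := by
  exact_mod_cast mul_left_cancel₀ Real.two_pi_pos.ne' h

/-- The generalized Maslov index exists and is unique. -/
theorem hasGenMaslovIndex_iff_eq {L : ℝ → LagGr H} {a b : ℝ} (hab : a ≤ b)
    (h : IsAdmissiblePath L a b) (m : ℤ) : HasGenMaslovIndex L a b m ↔ m = genMaslovIndex L a b := by
  obtain ⟨F, _, hF⟩ := h.exists_uniform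
  obtain ⟨φ, hφ⟩ := exists_isPhase F
  obtain ⟨θ, hθ, hθ'⟩ := exists_angle_Icc hab
    (continuous_dsq.comp_continuousOn (continuousOn_redFor h.continuousOn hF))
    fun t _ => norm_dsq _
  have key := fun m : ℤ => hasGenMaslovIndex_iff hab h hF hθ hθ' hφ (m := m)
  obtain ⟨k, hk⟩ := exists_angle_sub_eq (l := fun t => redFor F (L t))
    (isTransverse_redLag (hF a (left_mem_Icc.2 hab)) h.left)
    (isTransverse_redLag (hF b (right_mem_Icc.2 hab)) h.right)
    (hθ' a (left_mem_Icc.2 hab)) (hθ' b (right_mem_Icc.2 hab)) hφ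
  have hex : ∃ m : ℤ, HasGenMaslovIndex L a b m := ⟨k, (key k).2 hk⟩
  have hg : HasGenMaslovIndex L a b (genMaslovIndex L a b) := by
    rw [genMaslovIndex, dif_pos hex]
    exact hex.choose_spec
  refine ⟨fun hm => ?_, fun hm => hm ▸ hg⟩
  exact int_eq_of_two_pi_mul_eq (((key m).1 hm).symm.trans ((key _).1 hg))

theorem two_pi_mul_genMaslovIndex {F : Submodule ℝ H} [FiniteDimensional ℝ F]
    {L : ℝ → LagGr H} {a b : ℝ} (hab : a ≤ b)
    (h : IsAdmissiblePath L a b) (hF : ∀ t ∈ Icc a b, IsCleanFor F (L t))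
    {θ : ℝ → ℝ} (hθ : ContinuousOn θ (Icc a b))
    (hθ' : ∀ t ∈ Icc a b, dsq (redFor F (L t)) = Complex.exp ((θ t : ℂ) * I))
    {φ : LagGr F → ℝ} (hφ : IsPhase φ) :
    2 * Real.pi * genMaslovIndex L a b =
      θ b - θ a - (φ (redFor F (L b)) - φ (redFor F (L a))) :=
  ((hasGenMaslovIndex_iff hab h hF hθ hθ' hφ).1 ((hasGenMaslovIndex_iff_eq hab h _).2 rfl)).symm

theorem genMaslovIndex_eq_zero {L : ℝ → LagGr H} {a b : ℝ} (hab : a ≤ b)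
    (h : IsAdmissiblePath L a b) (h0 : ∀ t ∈ Icc a b, IsTransverse (L t)) :
    genMaslovIndex L a b = 0 := by
  obtain ⟨F, _, hF⟩ := h.exists_uniform
  obtain ⟨φ, hφ⟩ := exists_isPhase F
  have ht : ∀ t ∈ Icc a b, IsTransverse (redFor F (L t)) := fun t ht =>
    isTransverse_redLag (hF t ht) (h0 t ht)
  refine ((hasGenMaslovIndex_iff_eq hab h 0).1 ?_).symm
  rw [hasGenMaslovIndex_iff hab h hF (θ := fun t => φ (redFor F (L t)))
    (hφ.1.comp (continuousOn_redFor h.continuousOn hF) ht) (fun t h' => hφ.2 _ (ht t h')) hφ]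
  simp

theorem genMaslovIndex_congr {L L' : ℝ → LagGr H} {a b : ℝ} (hab : a ≤ b)
    (h : IsAdmissiblePath L a b) (hL : ∀ t ∈ Icc a b, L t = L' t) :
    genMaslovIndex L a b = genMaslovIndex L' a b := by
  have h' : IsAdmissiblePath L' a b :=
    ⟨h.continuousOn.congr fun t ht => (hL t ht).symm, fun t ht => hL t ht ▸ h.exists_clean t ht,
      hL a (left_mem_Icc.2 hab) ▸ h.left, hL b (right_mem_Icc.2 hab) ▸ h.right⟩
  obtain ⟨F, hFd, hF, l, hl, hm⟩ := (hasGenMaslovIndex_iff_eq hab h _).2 rfl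
  exact (hasGenMaslovIndex_iff_eq hab h' _).1 ⟨F, hFd, fun t ht => hL t ht ▸ hF t ht, l,
    fun t ht => hL t ht ▸ hl t ht, hm⟩

theorem IsAdmissiblePath.union {L : ℝ → LagGr H} {a c b : ℝ} (hac : a ≤ c) (hcb : c ≤ b)
    (h₁ : IsAdmissiblePath L a c) (h₂ : IsAdmissiblePath L c b) : IsAdmissiblePath L a b := by
  refine ⟨?_, fun t ht => ?_, h₁.left, h₂.right⟩
  · rw [← Icc_union_Icc_eq_Icc hac hcb]
    exact h₁.continuousOn.union_of_isClosed h₂.continuousOn isClosed_Icc isClosed_Icc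
  · rcases le_total t c with htc | htc
    · exact h₁.exists_clean t ⟨ht.1, htc⟩
    · exact h₂.exists_clean t ⟨htc, ht.2⟩

theorem genMaslovIndex_concat {L : ℝ → LagGr H} {a c b : ℝ} (hac : a ≤ c) (hcb : c ≤ b)
    (h₁ : IsAdmissiblePath L a c) (h₂ : IsAdmissiblePath L c b) :
    genMaslovIndex L a b = genMaslovIndex L a c + genMaslovIndex L c b := by
  have hab := hac.trans hcb
  have h := h₁.union hac hcb h₂
  obtain ⟨F, _, hF⟩ := h.exists_uniform
  obtain ⟨φ, hφ⟩ := exists_isPhase F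
  obtain ⟨θ, hθ, hθ'⟩ := exists_angle_Icc hab
    (continuous_dsq.comp_continuousOn (continuousOn_redFor h.continuousOn hF))
    fun t _ => norm_dsq _
  have s₁ : Icc a c ⊆ Icc a b := Icc_subset_Icc_right hcb
  have s₂ : Icc c b ⊆ Icc a b := Icc_subset_Icc_left hac
  have e := two_pi_mul_genMaslovIndex hab h hF hθ hθ' hφ
  have e₁ := two_pi_mul_genMaslovIndex hac h₁ (fun t ht => hF t (s₁ ht)) (hθ.mono s₁)
    (fun t ht => hθ' t (s₁ ht)) hφ
  have e₂ := two_pi_mul_genMaslovIndex hcb h₂ (fun t ht => hF t (s₂ ht)) (hθ.mono s₂)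
    (fun t ht => hθ' t (s₂ ht)) hφ
  refine int_eq_of_two_pi_mul_eq ?_
  push_cast
  linarith

/-- Homotopy invariance: an integer which depends continuously on the parameter is constant. One
subspace `F` serves the whole homotopy because the rectangle is compact. -/
theorem genMaslovIndex_homotopy {L : ℝ → ℝ → LagGr H} {a b : ℝ} (hab : a ≤ b)
    (hc : ContinuousOn (fun p : ℝ × ℝ => L p.1 p.2) (Icc 0 1 ×ˢ Icc a b))
    (h : ∀ s ∈ Icc (0 : ℝ) 1, IsAdmissiblePath (L s) a b) :
    genMaslovIndex (L 0) a b = genMaslovIndex (L 1) a b := by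
  obtain ⟨F, _, hF⟩ := exists_uniform_isCleanFor
    ((isCompact_Icc (a := (0 : ℝ)) (b := 1)).prod (isCompact_Icc (a := a) (b := b))) hc
    fun p hp => (h p.1 hp.1).exists_clean p.2 hp.2
  obtain ⟨φ, hφ⟩ := exists_isPhase F
  have hr := continuousOn_redFor hc hF
  obtain ⟨θ, hθ, hθ'⟩ := exists_angle_Icc_prod zero_le_one hab
    (continuous_dsq.comp_continuousOn hr) fun t _ => norm_dsq _
  have ha := left_mem_Icc.2 hab
  have hb := right_mem_Icc.2 hab
  have key : ∀ s ∈ Icc (0 : ℝ) 1, 2 * Real.pi * genMaslovIndex (L s) a b =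
      θ (s, b) - θ (s, a) - (φ (redFor F (L s b)) - φ (redFor F (L s a))) := by
    intro s hs
    refine two_pi_mul_genMaslovIndex hab (h s hs) (fun t ht => hF (s, t) ⟨hs, ht⟩)
      (θ := fun t => θ (s, t)) ?_ (fun t ht => hθ' (s, t) ⟨hs, ht⟩) hφ
    exact hθ.comp (by fun_prop) fun t ht => ⟨hs, ht⟩
  have hsl : ∀ t ∈ Icc a b, ContinuousOn (fun s : ℝ => (s, t)) (Icc 0 1) ∧
      MapsTo (fun s : ℝ => (s, t)) (Icc 0 1) (Icc 0 1 ×ˢ Icc a b) := fun t ht =>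
    ⟨by fun_prop, fun s hs => ⟨hs, ht⟩⟩
  have hLt : ∀ t ∈ Icc a b, ContinuousOn (fun s : ℝ => L s t) (Icc 0 1) := fun t ht =>
    ContinuousOn.comp (g := fun p : ℝ × ℝ => L p.1 p.2) (f := fun s : ℝ => (s, t)) hc
      (hsl t ht).1 (hsl t ht).2
  have hrt : ∀ t ∈ Icc a b, ContinuousOn (fun s : ℝ => redFor F (L s t)) (Icc 0 1) := fun t ht =>
    continuousOn_redFor (hLt t ht) fun s hs => hF (s, t) ⟨hs, ht⟩
  have hθt : ∀ t ∈ Icc a b, ContinuousOn (fun s : ℝ => θ (s, t)) (Icc 0 1) := fun t ht =>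
    hθ.comp (hsl t ht).1 (hsl t ht).2
  have hφt : ∀ t ∈ Icc a b, (∀ s ∈ Icc (0 : ℝ) 1, IsTransverse (L s t)) →
      ContinuousOn (fun s : ℝ => φ (redFor F (L s t))) (Icc 0 1) := fun t ht h' =>
    ContinuousOn.comp (g := φ) hφ.1 (hrt t ht) fun s hs =>
      isTransverse_redLag (hF (s, t) ⟨hs, ht⟩) (h' s hs)
  have hφb := hφt b hb fun s hs => (h s hs).right
  have hφa := hφt a ha fun s hs => (h s hs).left
  have hcont : ContinuousOn (fun s => 2 * Real.pi * (genMaslovIndex (L s) a b : ℝ)) (Icc 0 1) :=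
    (((hθt b hb).sub (hθt a ha)).sub (hφb.sub hφa)).congr key
  have h2 := angle_sub_eq zero_le_one hcont (θ' := fun _ => 0) continuousOn_const fun s _ => by
    rw [exp_two_pi_int]; simp
  refine int_eq_of_two_pi_mul_eq ?_
  linarith

end GenIndex

/-! ### The spectral flow as a generalized Maslov index -/

section Graphs

variable {H : Type*} [NormedAddCommGroup H] [InnerProductSpace ℝ H] [CompleteSpace H]

omit [CompleteSpace H] in
theorem mem_graphS {A : H →ₗ.[ℝ] H} {z : SympSpace H} :
    z ∈ graphS A ↔ ∃ x : A.domain, (x : H) = z.fst ∧ A x = z.snd :=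
  LinearPMap.mem_graph_iff A

theorem CGap.mem_graph {A : CGap H} {z : SympSpace H} :
    z ∈ A.graph.1 ↔ ∃ x : A.op.domain, (x : H) = z.fst ∧ A.op x = z.snd := mem_graphS

theorem CGap.isTransverse_graph {A : CGap H} : IsTransverse A.graph ↔ A.Injective := by
  rw [isTransverse_iff, CGap.Injective, LinearMap.ker_eq_bot']
  constructor
  · intro h x hx
    exact Subtype.ext (h (WithLp.toLp 2 ((x : H), 0)) (CGap.mem_graph.2 ⟨x, rfl, hx⟩) rfl)
  · intro h z hz h2
    obtain ⟨x, hx, hx'⟩ := CGap.mem_graph.1 hz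
    rw [← hx, h x (hx'.trans h2)]; rfl

theorem CGap.exists_isCleanFor (A : CGap H) :
    ∃ (F : Submodule ℝ H) (_ : FiniteDimensional ℝ F), IsCleanFor F A.graph := by
  obtain ⟨hk, hr, -⟩ := A.fredholm
  refine SpecFlow.exists_isCleanFor ?_ ?_
  · let f : LinearMap.ker A.op.toFun →ₗ[ℝ] SympSpace H :=
      (WithLp.linearEquiv 2 ℝ (H × H)).symm.toLinearMap ∘ₗ LinearMap.inl ℝ H H ∘ₗ
        A.op.domain.subtype ∘ₗ (LinearMap.ker A.op.toFun).subtype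
    refine Submodule.finiteDimensional_of_le (S₂ := LinearMap.range f) fun z hz => ?_
    obtain ⟨x, hx, hx'⟩ := CGap.mem_graph.1 hz.1
    exact ⟨⟨x, hx'.trans (mem_horizontal_top.1 hz.2)⟩,
      SympSpace.ext hx (mem_horizontal_top.1 hz.2).symm⟩
  · convert hr
    ext y
    constructor
    · rintro ⟨z, hz, rfl⟩
      obtain ⟨x, -, hx'⟩ := CGap.mem_graph.1 hz
      exact ⟨x, hx'⟩
    · rintro ⟨x, rfl⟩
      exact ⟨WithLp.toLp 2 ((x : H), A.op x), CGap.mem_graph.2 ⟨x, rfl, rfl⟩, rfl⟩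

theorem CGap.continuous_graph : Continuous (CGap.graph : CGap H → LagGr H) :=
  continuous_induced_dom

theorem IsAdmissible.isAdmissiblePath {𝒜 : ℝ → CGap H} {a b : ℝ} (h : IsAdmissible 𝒜 a b) :
    IsAdmissiblePath (fun t => (𝒜 t).graph) a b :=
  ⟨CGap.continuous_graph.comp_continuousOn h.1, fun t _ => (𝒜 t).exists_isCleanFor,
    CGap.isTransverse_graph.2 h.2.1, CGap.isTransverse_graph.2 h.2.2⟩

end Graphs

/-! ### Square roots and signs of self-adjoint operators -/

section SquareRoot

open Filter

variable {E : Type*} [NormedAddCommGroup E] [InnerProductSpace ℝ E] [CompleteSpace E]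

/-- The iteration `Y ↦ (B + Y ^ 2) / 2`, whose fixed points satisfy `(1 - Y) ^ 2 = 1 - B`. -/
def sqrtIter (B : E →L[ℝ] E) : ℕ → E →L[ℝ] E
  | 0 => 0
  | n + 1 => (1 / 2 : ℝ) • (B + sqrtIter B n * sqrtIter B n)

/-- The scalar iteration which dominates `sqrtIter` on the unit ball. -/
def sqrtIterScalar : ℕ → ℝ
  | 0 => 0
  | n + 1 => 1 / 2 * (1 + sqrtIterScalar n * sqrtIterScalar n)

theorem sqrtIterScalar_mem (n : ℕ) : 0 ≤ sqrtIterScalar n ∧ sqrtIterScalar n ≤ 1 := by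
  induction n with
  | zero => simp [sqrtIterScalar]
  | succ n ih =>
    obtain ⟨h0, h1⟩ := ih
    simp only [sqrtIterScalar]
    constructor <;> nlinarith

omit [CompleteSpace E] in
theorem norm_sqrtIter_le {B : E →L[ℝ] E} (hB : ‖B‖ ≤ 1) (n : ℕ) :
    ‖sqrtIter B n‖ ≤ sqrtIterScalar n := by
  induction n with
  | zero => simp [sqrtIter, sqrtIterScalar]
  | succ n ih =>
    simp only [sqrtIter, sqrtIterScalar]
    rw [norm_smul, Real.norm_of_nonneg (by norm_num)]
    refine mul_le_mul_of_nonneg_left ((norm_add_le _ _).trans (add_le_add hB ?_)) (by norm_num)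
    exact (norm_mul_le _ _).trans (mul_le_mul ih ih (norm_nonneg _) (sqrtIterScalar_mem n).1)

omit [CompleteSpace E] in
theorem norm_sqrtIter_sub_le {B : E →L[ℝ] E} (hB : ‖B‖ ≤ 1) (n : ℕ) :
    ‖sqrtIter B (n + 1) - sqrtIter B n‖ ≤ sqrtIterScalar (n + 1) - sqrtIterScalar n := by
  induction n with
  | zero => simpa [sqrtIter, sqrtIterScalar] using norm_sqrtIter_le hB 1
  | succ n ih =>
    have h1 : sqrtIter B (n + 1 + 1) - sqrtIter B (n + 1) = (1 / 2 : ℝ) •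
        (sqrtIter B (n + 1) * (sqrtIter B (n + 1) - sqrtIter B n) +
          (sqrtIter B (n + 1) - sqrtIter B n) * sqrtIter B n) := by
      rw [sqrtIter, mul_sub, sub_mul, sub_add_sub_cancel]
      conv_lhs => rw [show sqrtIter B (n + 1) = (1 / 2 : ℝ) •
        (B + sqrtIter B n * sqrtIter B n) from rfl]
      rw [← smul_sub, ← sqrtIter, add_sub_add_left_eq_sub]
    have h2 : sqrtIterScalar (n + 1 + 1) - sqrtIterScalar (n + 1) = 1 / 2 *
        (sqrtIterScalar (n + 1) * (sqrtIterScalar (n + 1) - sqrtIterScalar n) +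
          (sqrtIterScalar (n + 1) - sqrtIterScalar n) * sqrtIterScalar n) := by
      have e1 : sqrtIterScalar (n + 1) = 1 / 2 * (1 + sqrtIterScalar n * sqrtIterScalar n) := rfl
      have e2 : sqrtIterScalar (n + 1 + 1) =
        1 / 2 * (1 + sqrtIterScalar (n + 1) * sqrtIterScalar (n + 1)) := rfl
      linear_combination e2 - e1
    have h0 : 0 ≤ sqrtIterScalar (n + 1) - sqrtIterScalar n := (norm_nonneg _).trans ih
    rw [h1, h2, norm_smul, Real.norm_of_nonneg (by norm_num)]
    refine mul_le_mul_of_nonneg_left ((norm_add_le _ _).trans (add_le_add ?_ ?_)) (by norm_num)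
    · exact (norm_mul_le _ _).trans (mul_le_mul (norm_sqrtIter_le hB _) ih (norm_nonneg _)
        (sqrtIterScalar_mem _).1)
    · exact (norm_mul_le _ _).trans (mul_le_mul ih (norm_sqrtIter_le hB _) (norm_nonneg _) h0)

/-- The square root of `P`, meaningful for `‖1 - P‖ ≤ 1`. -/
def opSqrt (P : E →L[ℝ] E) : E →L[ℝ] E := 1 - limUnder atTop (sqrtIter (1 - P))

/-- The iteration converges in norm even if `‖B‖ = 1`, because it is dominated by a bounded
monotone scalar sequence. -/
theorem tendsto_sqrtIter {P : E →L[ℝ] E} (hP : ‖1 - P‖ ≤ 1) :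
    Tendsto (sqrtIter (1 - P)) atTop (𝓝 (1 - opSqrt P)) := by
  have hs : Summable fun n => sqrtIterScalar (n + 1) - sqrtIterScalar n := by
    refine summable_of_sum_range_le (c := 1)
      (fun n => (norm_nonneg _).trans (norm_sqrtIter_sub_le hP n)) fun n => ?_
    rw [Finset.sum_range_sub]
    simpa [sqrtIterScalar] using (sqrtIterScalar_mem n).2
  have hc : CauchySeq (sqrtIter (1 - P)) := cauchySeq_of_dist_le_of_summable _ (fun n => by
    rw [dist_eq_norm, ← norm_neg, neg_sub]
    exact norm_sqrtIter_sub_le hP n) hs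
  rw [opSqrt, sub_sub_cancel]
  exact hc.tendsto_limUnder

theorem opSqrt_mul_self {P : E →L[ℝ] E} (hP : ‖1 - P‖ ≤ 1) : opSqrt P * opSqrt P = P := by
  have h1 := tendsto_sqrtIter hP
  have h2 := ((tendsto_add_atTop_iff_nat 1).2 h1)
  have h3 : Tendsto (fun n => sqrtIter (1 - P) (n + 1)) atTop
      (𝓝 ((1 / 2 : ℝ) • ((1 - P) + (1 - opSqrt P) * (1 - opSqrt P)))) :=
    (tendsto_const_nhds.add (h1.mul h1)).const_smul _
  have h4 := tendsto_nhds_unique h2 h3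
  have h5 : (2 : ℝ) • (1 - opSqrt P) = (1 - P) + (1 - opSqrt P) * (1 - opSqrt P) := by
    conv_lhs => rw [h4]
    rw [smul_smul]; norm_num
  rw [two_smul] at h5
  have h6 : (1 - opSqrt P) * (1 - opSqrt P) = 1 - opSqrt P - opSqrt P + opSqrt P * opSqrt P := by
    noncomm_ring
  rw [h6] at h5
  have h7 : opSqrt P * opSqrt P - P = (1 - P + (1 - opSqrt P - opSqrt P + opSqrt P * opSqrt P)) -
    (1 - opSqrt P + (1 - opSqrt P)) := by abel
  rw [← h5, sub_self] at h7
  exact sub_eq_zero.1 h7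

theorem commute_opSqrt {P C : E →L[ℝ] E} (hP : ‖1 - P‖ ≤ 1) (h : Commute C P) :
    Commute C (opSqrt P) := by
  have h1 : ∀ n, Commute C (sqrtIter (1 - P) n) := by
    intro n
    induction n with
    | zero => exact .zero_right _
    | succ n ih => exact ((((Commute.one_right C).sub_right h).add_right (ih.mul_right ih))).smul_right _
  have h2 := tendsto_sqrtIter hP
  have h3 : C * (1 - opSqrt P) = (1 - opSqrt P) * C :=
    tendsto_nhds_unique (tendsto_const_nhds.mul h2)
      ((h2.mul tendsto_const_nhds).congr fun n => ((h1 n).eq).symm)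
  rw [mul_sub, sub_mul, mul_one, one_mul, sub_right_inj] at h3
  exact h3

theorem norm_one_sub_opSqrt {P : E →L[ℝ] E} (hP : ‖1 - P‖ ≤ 1) : ‖1 - opSqrt P‖ ≤ 1 :=
  le_of_tendsto (tendsto_sqrtIter hP).norm
    (.of_forall fun n => (norm_sqrtIter_le hP n).trans (sqrtIterScalar_mem n).2)

theorem isSelfAdjoint_opSqrt {P : E →L[ℝ] E} (hP : ‖1 - P‖ ≤ 1) (h : IsSelfAdjoint P) :
    IsSelfAdjoint (opSqrt P) := by
  have h1 : ∀ n, IsSelfAdjoint (sqrtIter (1 - P) n) := by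
    intro n
    induction n with
    | zero => exact .zero _
    | succ n ih =>
      exact IsSelfAdjoint.smul (.all _) (((IsSelfAdjoint.one _).sub h).add
        (ih.commute_iff ih |>.1 (Commute.refl _)))
  have h2 := tendsto_sqrtIter hP
  have h3 : star (1 - opSqrt P) = 1 - opSqrt P :=
    tendsto_nhds_unique ((continuous_star.tendsto _).comp h2)
      (h2.congr fun n => (h1 n).star_eq.symm)
  rw [star_sub, star_one, sub_right_inj] at h3
  exact h3

theorem inner_opSqrt_nonneg {P : E →L[ℝ] E} (hP : ‖1 - P‖ ≤ 1) (x : E) :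
    0 ≤ ⟪opSqrt P x, x⟫_ℝ := by
  have h1 : ⟪(1 - opSqrt P) x, x⟫_ℝ ≤ ‖x‖ * ‖x‖ := by
    refine (real_inner_le_norm _ _).trans (mul_le_mul_of_nonneg_right ?_ (norm_nonneg _))
    refine ((1 - opSqrt P).le_of_opNorm_le (norm_one_sub_opSqrt hP) x).trans_eq (one_mul _)
  rw [sub_apply, one_apply_eq_self, inner_sub_left, real_inner_self_eq_norm_mul_norm] at h1
  linarith

/-- Square roots of operators with compact difference have compact difference, because this holds
for the approximations by the iteration and compact operators form a closed set. -/
theorem isCompactOperator_opSqrt_sub {P P' : E →L[ℝ] E} (hP : ‖1 - P‖ ≤ 1) (hP' : ‖1 - P'‖ ≤ 1)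
    (h : IsCompactOperator (P - P')) : IsCompactOperator (opSqrt P - opSqrt P') := by
  have h1 : ∀ n, IsCompactOperator
      (sqrtIter (1 - P') n - sqrtIter (1 - P) n : E →L[ℝ] E) := by
    intro n
    induction n with
    | zero => simpa [sqrtIter] using isCompactOperator_zero
    | succ n ih =>
      have e : sqrtIter (1 - P') (n + 1) - sqrtIter (1 - P) (n + 1) = (1 / 2 : ℝ) • ((P - P') +
          (sqrtIter (1 - P') n ∘L (sqrtIter (1 - P') n - sqrtIter (1 - P) n) +
          (sqrtIter (1 - P') n - sqrtIter (1 - P) n) ∘L sqrtIter (1 - P) n)) := by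
        simp only [sqrtIter, ← smul_sub, ← ContinuousLinearMap.mul_def]
        congr 1
        noncomm_ring
      rw [e]
      exact (h.add ((ih.clm_comp _).add (ih.comp_clm _))).smul _
  have h2 := (tendsto_sqrtIter hP').sub (tendsto_sqrtIter hP)
  rw [sub_sub_sub_cancel_left] at h2
  exact isCompactOperator_of_tendsto h2 (.of_forall h1)

end SquareRoot

section Sign

open Filter

variable {E : Type*} [NormedAddCommGroup E] [InnerProductSpace ℝ E] [CompleteSpace E]

theorem norm_one_sub_mul_self_le {R : E →L[ℝ] E} (hR : IsSelfAdjoint R) (h : ‖R‖ ≤ 1) :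
    ‖1 - R * R‖ ≤ 1 := by
  refine ContinuousLinearMap.opNorm_le_bound _ zero_le_one fun x => ?_
  rw [one_mul]
  refine le_of_sq_le_sq ?_ (norm_nonneg _)
  have h1 : ∀ y, ‖R y‖ ≤ ‖y‖ := fun y => (R.le_of_opNorm_le h y).trans_eq (one_mul _)
  have h2 : ⟪x, R (R x)⟫_ℝ = ‖R x‖ ^ 2 := by
    rw [← real_inner_self_eq_norm_sq]
    exact (hR.isSymmetric x (R x)).symm
  rw [sub_apply, one_apply_eq_self, mul_apply_eq_comp, norm_sub_sq_real, h2]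
  have h3 := h1 (R x)
  have h4 := sq_le_sq' (by linarith [norm_nonneg (R (R x)), norm_nonneg (R x)]) h3
  nlinarith [sq_nonneg ‖R x‖]

/-- The absolute value of a self-adjoint contraction. -/
def absOp (R : E →L[ℝ] E) : E →L[ℝ] E := opSqrt (R * R)

/-- The sign of an injective self-adjoint contraction: the reflection which is `1` on the kernel of
`|R| - R`. -/
def signOp (R : E →L[ℝ] E) : E →L[ℝ] E := (2 : ℝ) • (absOp R - R).ker.starProjection - 1

variable {R : E →L[ℝ] E}

theorem absOp_mul_self (hR : IsSelfAdjoint R) (h : ‖R‖ ≤ 1) : absOp R * absOp R = R * R :=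
  opSqrt_mul_self (norm_one_sub_mul_self_le hR h)

theorem isSelfAdjoint_absOp (hR : IsSelfAdjoint R) (h : ‖R‖ ≤ 1) : IsSelfAdjoint (absOp R) :=
  isSelfAdjoint_opSqrt (norm_one_sub_mul_self_le hR h) (hR.commute_iff hR |>.1 (Commute.refl _))

theorem inner_absOp_nonneg (hR : IsSelfAdjoint R) (h : ‖R‖ ≤ 1) (x : E) :
    0 ≤ ⟪absOp R x, x⟫_ℝ := inner_opSqrt_nonneg (norm_one_sub_mul_self_le hR h) x

theorem commute_absOp (hR : IsSelfAdjoint R) (h : ‖R‖ ≤ 1) {C : E →L[ℝ] E}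
    (hC : Commute C (R * R)) : Commute C (absOp R) :=
  commute_opSqrt (norm_one_sub_mul_self_le hR h) hC

theorem norm_absOp_apply (hR : IsSelfAdjoint R) (h : ‖R‖ ≤ 1) (x : E) : ‖absOp R x‖ = ‖R x‖ := by
  have h1 : ∀ {T : E →L[ℝ] E}, IsSelfAdjoint T → ‖T x‖ ^ 2 = ⟪(T * T) x, x⟫_ℝ := fun hT => by
    rw [← real_inner_self_eq_norm_sq]
    exact (hT.isSymmetric _ _).symm
  have h2 : ‖absOp R x‖ ^ 2 = ‖R x‖ ^ 2 := by
    rw [h1 (isSelfAdjoint_absOp hR h), h1 hR, absOp_mul_self hR h]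
  exact (sq_eq_sq₀ (norm_nonneg _) (norm_nonneg _)).1 h2

theorem norm_absOp_le (hR : IsSelfAdjoint R) (h : ‖R‖ ≤ 1) : ‖absOp R‖ ≤ 1 :=
  ContinuousLinearMap.opNorm_le_bound _ zero_le_one fun x => by
    rw [norm_absOp_apply hR h]; exact R.le_of_opNorm_le h x

theorem absOp_eq_zero_iff (hR : IsSelfAdjoint R) (h : ‖R‖ ≤ 1) {x : E} :
    absOp R x = 0 ↔ R x = 0 := by
  rw [← norm_eq_zero, norm_absOp_apply hR h, norm_eq_zero]

omit [CompleteSpace E] in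
theorem eq_of_mul_eq_mul_of_dense {S X Y : E →L[ℝ] E} (hS : DenseRange S) (h : X * S = Y * S) :
    X = Y := by
  refine ContinuousLinearMap.ext fun x => congrFun (hS.equalizer X.continuous Y.continuous ?_) x
  exact funext fun x => congrArg (fun T : E →L[ℝ] E => T x) h

theorem denseRange_of_injective {S : E →L[ℝ] E} (hS : IsSelfAdjoint S)
    (h : ∀ x, S x = 0 → x = 0) : DenseRange S := by
  have h1 : S.rangeᗮ = ⊥ := by
    rw [Submodule.eq_bot_iff]
    intro x hx
    refine h x (ext_inner_left ℝ fun v => ?_)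
    rw [inner_zero_right]
    exact (hS.isSymmetric v x).symm.trans (hx _ ⟨v, rfl⟩)
  have h2 := Submodule.topologicalClosure_eq_top_iff.2 h1
  have h3 : Dense (S.range : Set E) := by
    rw [dense_iff_closure_eq, ← Submodule.topologicalClosure_coe, h2]; rfl
  rwa [LinearMap.coe_range] at h3

theorem isSelfAdjoint_signOp : IsSelfAdjoint (signOp R) :=
  (IsSelfAdjoint.smul (.all 2) (isSelfAdjoint_starProjection _)).sub (.one _)

theorem signOp_mul_self : signOp R * signOp R = 1 := by
  set p := (absOp R - R).ker.starProjection with hp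
  have h1 : p * p = p := (Submodule.isIdempotentElem_starProjection _)
  have h2 : signOp R * signOp R = (4 : ℝ) • (p * p) - (4 : ℝ) • p + 1 := by
    rw [signOp, ← hp, two_smul, show (4 : ℝ) = 2 + 2 by norm_num, add_smul, add_smul, two_smul,
      two_smul]
    noncomm_ring
  rw [h2, h1, sub_self, zero_add]

/-- Polar decomposition. Since `|R| ^ 2 = R ^ 2`, the range of `|R| + R` is contained in the kernel
of `|R| - R`, and the projector onto this kernel annihilates `|R| - R`. -/
theorem signOp_mul_absOp (hR : IsSelfAdjoint R) (h : ‖R‖ ≤ 1) : signOp R * absOp R = R := by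
  set S := absOp R with hS
  set p := (S - R).ker.starProjection with hp
  have hSs : IsSelfAdjoint S := isSelfAdjoint_absOp hR h
  have hSR : Commute R S := commute_absOp hR h ((Commute.refl R).mul_right (Commute.refl R))
  have hSS : S * S = R * R := absOp_mul_self hR h
  have h1 : p * (S + R) = S + R := by
    ext x
    refine Submodule.starProjection_eq_self_iff.2 ?_
    change ((S - R) * (S + R)) x = 0
    have : (S - R) * (S + R) = S * S - R * R + (S * R - R * S) := by noncomm_ring
    rw [this, hSS, hSR.eq, sub_self, sub_self, add_zero]; rfl
  have h2 : p * (S - R) = 0 := by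
    ext x
    refine (Submodule.starProjection_apply_eq_zero_iff _).2 fun v hv => ?_
    rw [← (hSs.sub hR).isSymmetric v x]
    have hv' : (S - R) v = 0 := hv
    change ⟪(S - R) v, x⟫_ℝ = 0
    rw [hv', inner_zero_left]
  have h3 : (2 : ℝ) • (p * S) = S + R := by
    rw [mul_add] at h1; rw [mul_sub] at h2
    rw [two_smul, ← h1, ← sub_eq_zero, add_sub_add_left_eq_sub, h2]
  change ((2 : ℝ) • p - 1) * S = R
  rw [sub_mul, one_mul, smul_mul_assoc, h3, add_sub_cancel_left]

theorem absOp_mul_signOp (hR : IsSelfAdjoint R) (h : ‖R‖ ≤ 1) : absOp R * signOp R = R := by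
  have h1 := congrArg star (signOp_mul_absOp hR h)
  rwa [star_mul, (isSelfAdjoint_absOp hR h).star_eq, isSelfAdjoint_signOp.star_eq,
    hR.star_eq] at h1

theorem signOp_mul (hR : IsSelfAdjoint R) (h : ‖R‖ ≤ 1) : signOp R * R = absOp R := by
  calc signOp R * R = signOp R * (signOp R * absOp R) := by rw [signOp_mul_absOp hR h]
    _ = absOp R := by rw [← mul_assoc, signOp_mul_self, one_mul]

theorem mul_signOp (hR : IsSelfAdjoint R) (h : ‖R‖ ≤ 1) : R * signOp R = absOp R := by
  calc R * signOp R = absOp R * signOp R * signOp R := by rw [absOp_mul_signOp hR h]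
    _ = absOp R := by rw [mul_assoc, signOp_mul_self, mul_one]

theorem denseRange_absOp (hR : IsSelfAdjoint R) (h : ‖R‖ ≤ 1) (h0 : ∀ x, R x = 0 → x = 0) :
    DenseRange (absOp R) :=
  denseRange_of_injective (isSelfAdjoint_absOp hR h) fun x hx => h0 x ((absOp_eq_zero_iff hR h).1 hx)

theorem commute_signOp (hR : IsSelfAdjoint R) (h : ‖R‖ ≤ 1) (h0 : ∀ x, R x = 0 → x = 0)
    {C : E →L[ℝ] E} (hC : Commute C R) : Commute C (signOp R) := by
  refine eq_of_mul_eq_mul_of_dense (denseRange_absOp hR h h0) ?_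
  have hCS := commute_absOp hR h (hC.mul_right hC)
  rw [mul_assoc, signOp_mul_absOp hR h, mul_assoc, hCS.eq, ← mul_assoc, signOp_mul_absOp hR h,
    hC.eq]

end Sign

/-! ### A Sylvester equation -/

section Sylvester

open Filter

variable {E : Type*} [NormedAddCommGroup E] [InnerProductSpace ℝ E] [CompleteSpace E]

omit [CompleteSpace E] in
theorem norm_le_of_abs_inner_le {T : E →L[ℝ] E} {M : ℝ} (hM : 0 ≤ M)
    (h : ∀ x y, |⟪y, T x⟫_ℝ| ≤ M * (‖x‖ ^ 2 + ‖y‖ ^ 2)) : ‖T‖ ≤ 2 * M := by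
  refine T.opNorm_le_bound (by positivity) fun x => ?_
  rcases eq_or_ne (T x) 0 with h0 | h0
  · rw [h0, norm_zero]; positivity
  have hT : 0 < ‖T x‖ := norm_pos_iff.2 h0
  have h1 := h x ((‖x‖ / ‖T x‖) • T x)
  rw [real_inner_smul_left, real_inner_self_eq_norm_sq, norm_smul, Real.norm_of_nonneg
    (by positivity), div_mul_cancel₀ _ hT.ne', abs_of_nonneg (by positivity)] at h1
  have h2 : ‖x‖ / ‖T x‖ * ‖T x‖ ^ 2 = ‖x‖ * ‖T x‖ := by field_simp
  rw [h2] at h1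
  rcases (norm_nonneg x).eq_or_lt with hx | hx
  · exact absurd (by rw [norm_eq_zero.1 hx.symm, map_zero]) h0
  · exact le_of_mul_le_mul_left (by linarith) hx

/-- A self-adjoint operator with `0 ≤ S ≤ 1`. -/
structure IsPosContraction (S : E →L[ℝ] E) : Prop where
  selfAdjoint : IsSelfAdjoint S
  nonneg : ∀ x, 0 ≤ ⟪S x, x⟫_ℝ
  norm_le : ‖S‖ ≤ 1

variable {S : E →L[ℝ] E}

theorem IsPosContraction.inner_le (hS : IsPosContraction S) (x : E) : ⟪S x, x⟫_ℝ ≤ ‖x‖ ^ 2 := by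
  refine (real_inner_le_norm _ _).trans ?_
  rw [sq]
  exact mul_le_mul_of_nonneg_right ((S.le_of_opNorm_le hS.norm_le x).trans_eq (one_mul _))
    (norm_nonneg _)

theorem IsPosContraction.norm_sq_le (hS : IsPosContraction S) (x : E) :
    ‖S x‖ ^ 2 ≤ 2 * ⟪S x, x⟫_ℝ := by
  have h1 := hS.nonneg (x - (1 / 2 : ℝ) • S x)
  have h2 := hS.inner_le (S x)
  have h3 : ⟪S (S x), x⟫_ℝ = ‖S x‖ ^ 2 := by
    rw [← real_inner_self_eq_norm_sq]; exact hS.selfAdjoint.isSymmetric _ _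
  rw [map_sub, map_smul, inner_sub_left, inner_sub_right, inner_sub_right, real_inner_smul_left,
    real_inner_smul_left, real_inner_smul_right, real_inner_smul_right, h3,
    real_inner_self_eq_norm_sq] at h1
  nlinarith [sq_nonneg ‖S x‖]

theorem IsPosContraction.isUnit (hS : IsPosContraction S) : IsUnit (1 + S) := by
  refine ContinuousLinearMap.isUnit_of_forall_le_norm_inner_map _ (c := 1) one_pos fun x => ?_
  rw [add_apply, one_apply_eq_self, inner_add_left, real_inner_self_eq_norm_sq]
  have := hS.nonneg x
  rw [Real.norm_of_nonneg (by positivity)]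
  simpa using this

/-- The operator `(1 + S)⁻¹`. -/
def cayleyInv (S : E →L[ℝ] E) : E →L[ℝ] E := Ring.inverse (1 + S)

/-- The operator `S (1 + S)⁻¹ = 1 - (1 + S)⁻¹`. -/
def cayleyFrac (S : E →L[ℝ] E) : E →L[ℝ] E := 1 - cayleyInv S

/-- The Cayley transform `(1 - S) (1 + S)⁻¹`. -/
def cayley (S : E →L[ℝ] E) : E →L[ℝ] E := 1 - 2 • cayleyFrac S

theorem IsPosContraction.mul_cayleyInv (hS : IsPosContraction S) :
    S * cayleyInv S = cayleyFrac S := by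
  have h := Ring.mul_inverse_cancel _ hS.isUnit
  rw [add_mul, one_mul] at h
  rw [cayleyFrac, ← h, cayleyInv, add_sub_cancel_left]

theorem IsPosContraction.cayleyInv_mul (hS : IsPosContraction S) :
    cayleyInv S * S = cayleyFrac S := by
  have h := Ring.inverse_mul_cancel _ hS.isUnit
  rw [mul_add, mul_one] at h
  rw [cayleyFrac, ← h, cayleyInv, add_sub_cancel_left]

theorem IsPosContraction.one_add_mul_cayley (hS : IsPosContraction S) :
    (1 + S) * cayley S = 1 - S := by
  have h : (1 + S) * cayleyInv S = 1 := Ring.mul_inverse_cancel _ hS.isUnit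
  have : (1 + S) * cayley S = 2 • ((1 + S) * cayleyInv S) - (1 + S) := by
    rw [cayley, cayleyFrac]; noncomm_ring
  rw [this, h]
  noncomm_ring

theorem IsPosContraction.commute_cayley (hS : IsPosContraction S) : Commute S (cayley S) := by
  have h : Commute S (cayleyInv S) := hS.mul_cayleyInv.trans hS.cayleyInv_mul.symm
  exact (Commute.one_right S).sub_right (((Commute.one_right S).sub_right h).smul_right 2)

/-- The quadratic form of `S` decreases along the orbits of the Cayley transform `c`, because
`S - c S c = 4 d ^ 2` for `d = S (1 + S)⁻¹`. -/
theorem IsPosContraction.four_mul_norm_sq (hS : IsPosContraction S) (x : E) :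
    4 * ‖cayleyFrac S x‖ ^ 2 = ⟪S x, x⟫_ℝ - ⟪S (cayley S x), cayley S x⟫_ℝ := by
  -- write `x = (1 + S) y`
  set y := cayleyInv S x with hy
  have hx : x = y + S y := by
    have h := congrArg (fun T : E →L[ℝ] E => T x) (Ring.mul_inverse_cancel _ hS.isUnit)
    exact h.symm
  have hd : cayleyFrac S x = S y := congrArg (fun T : E →L[ℝ] E => T x) hS.mul_cayleyInv.symm
  have hc : cayley S x = y - S y := by
    have : cayley S x = x - 2 • cayleyFrac S x := rfl
    rw [this, hd, two_nsmul]
    nth_rw 1 [hx]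
    abel
  have h3 : ⟪S (S y), y⟫_ℝ = ‖S y‖ ^ 2 := by
    rw [← real_inner_self_eq_norm_sq]; exact hS.selfAdjoint.isSymmetric _ _
  rw [hd, hc, hx, map_add, map_sub]
  simp only [inner_add_left, inner_add_right, inner_sub_left, inner_sub_right, h3,
    real_inner_self_eq_norm_sq]
  ring

theorem IsPosContraction.four_mul_inner (hS : IsPosContraction S) (x : E) :
    4 * ⟪S x, x⟫_ℝ = ‖(1 + S) x‖ ^ 2 - ‖(1 + S) (cayley S x)‖ ^ 2 := by
  have h : (1 + S) (cayley S x) = (1 - S) x :=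
    congrArg (fun T : E →L[ℝ] E => T x) hS.one_add_mul_cayley
  rw [h, add_apply, sub_apply, one_apply_eq_self, norm_add_sq_real,
    norm_sub_sq_real, real_inner_comm]
  ring

theorem IsPosContraction.antitone (hS : IsPosContraction S) (x : E) :
    Antitone fun k => ⟪S ((cayley S)^[k] x), (cayley S)^[k] x⟫_ℝ := by
  refine antitone_nat_of_succ_le fun k => ?_
  have h := hS.four_mul_norm_sq ((cayley S)^[k] x)
  rw [Function.iterate_succ_apply']
  linarith [sq_nonneg ‖cayleyFrac S ((cayley S)^[k] x)‖]

/-- The quadratic form of `S` is summable along the orbits of the Cayley transform by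
`IsPosContraction.four_mul_inner`; as it decreases, it is `O(1 / m)`. -/
theorem IsPosContraction.mul_inner_iterate_le (hS : IsPosContraction S) (x : E) (m : ℕ) :
    m * ⟪S ((cayley S)^[m] x), (cayley S)^[m] x⟫_ℝ ≤ ‖x‖ ^ 2 := by
  have h1 : ∑ k ∈ Finset.range m, 4 * ⟪S ((cayley S)^[k] x), (cayley S)^[k] x⟫_ℝ =
      ‖(1 + S) x‖ ^ 2 - ‖(1 + S) ((cayley S)^[m] x)‖ ^ 2 := by
    have := Finset.sum_range_sub' (fun k => ‖(1 + S) ((cayley S)^[k] x)‖ ^ 2) m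
    rw [Function.iterate_zero, id] at this
    rw [← this]
    refine Finset.sum_congr rfl fun k _ => ?_
    rw [hS.four_mul_inner, Function.iterate_succ_apply']
  have h2 : (m : ℝ) * (4 * ⟪S ((cayley S)^[m] x), (cayley S)^[m] x⟫_ℝ) ≤
      ∑ k ∈ Finset.range m, 4 * ⟪S ((cayley S)^[k] x), (cayley S)^[k] x⟫_ℝ := by
    rw [← nsmul_eq_mul]
    refine (Finset.card_nsmul_le_sum _ _ _ fun k hk => ?_).trans_eq' (by rw [Finset.card_range])
    have := hS.antitone x (Finset.mem_range.1 hk).le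
    simp only at this
    linarith
  have h3 : ‖(1 + S) x‖ ≤ 2 * ‖x‖ := by
    rw [add_apply, one_apply_eq_self]
    refine (norm_add_le _ _).trans ?_
    have := S.le_of_opNorm_le hS.norm_le x
    linarith
  have h4 : ‖(1 + S) x‖ ^ 2 ≤ (2 * ‖x‖) ^ 2 := pow_le_pow_left₀ (norm_nonneg _) h3 2
  nlinarith [sq_nonneg ‖(1 + S) ((cayley S)^[m] x)‖]

theorem IsPosContraction.tendsto_inner_iterate (hS : IsPosContraction S) (x : E) :
    Tendsto (fun m => ⟪S ((cayley S)^[m] x), (cayley S)^[m] x⟫_ℝ) atTop (𝓝 0) := by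
  have h1 : Tendsto (fun m : ℕ => ‖x‖ ^ 2 / m) atTop (𝓝 0) :=
    tendsto_const_div_atTop_nhds_zero_nat _
  refine tendsto_of_tendsto_of_tendsto_of_le_of_le' tendsto_const_nhds h1
    (.of_forall fun m => hS.nonneg _) ?_
  filter_upwards [eventually_gt_atTop 0] with m hm
  rw [le_div_iff₀ (by exact_mod_cast hm), mul_comm]
  exact hS.mul_inner_iterate_le x m

theorem IsPosContraction.iterate_cayley_apply (hS : IsPosContraction S) (w : E) (m : ℕ) :
    (cayley S)^[m] (S w) = S ((cayley S)^[m] w) := by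
  induction m with
  | zero => rfl
  | succ m ih =>
    rw [Function.iterate_succ_apply', Function.iterate_succ_apply', ih]
    exact congrArg (fun T : E →L[ℝ] E => T _) hS.commute_cayley.eq.symm

theorem IsPosContraction.tendsto_iterate (hS : IsPosContraction S) (w : E) :
    Tendsto (fun m => (cayley S)^[m] (S w)) atTop (𝓝 0) := by
  rw [tendsto_zero_iff_norm_tendsto_zero]
  have h1 : Tendsto (fun m => ‖(cayley S)^[m] (S w)‖ ^ 2) atTop (𝓝 0) := by
    have h2 := (hS.tendsto_inner_iterate w).const_mul 2
    rw [mul_zero] at h2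
    refine squeeze_zero (fun m => sq_nonneg _) (fun m => ?_) h2
    rw [hS.iterate_cayley_apply]
    exact hS.norm_sq_le _
  have h3 := (Real.continuous_sqrt.tendsto 0).comp h1
  rw [Real.sqrt_zero] at h3
  exact h3.congr fun m => Real.sqrt_sq (norm_nonneg _)

end Sylvester

section Sylvester

open Filter

variable {E : Type*} [NormedAddCommGroup E] [InnerProductSpace ℝ E] [CompleteSpace E]
  {S S' X K : E →L[ℝ] E}

theorem IsPosContraction.isSelfAdjoint_cayley (hS : IsPosContraction S) :
    IsSelfAdjoint (cayley S) ∧ IsSelfAdjoint (cayleyFrac S) := by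
  have h1 : IsSelfAdjoint (1 + S) := (IsSelfAdjoint.one _).add hS.selfAdjoint
  have h2 : IsSelfAdjoint (cayleyInv S) := by
    have h3 : (1 + S) * cayleyInv S = 1 := Ring.mul_inverse_cancel _ hS.isUnit
    have h4 : star (cayleyInv S) * (1 + S) = 1 := by
      have := congrArg star h3
      rwa [star_mul, h1.star_eq, star_one] at this
    exact left_inv_eq_right_inv h4 h3
  have h3 : IsSelfAdjoint (cayleyFrac S) := (IsSelfAdjoint.one _).sub h2
  refine ⟨(IsSelfAdjoint.one _).sub ?_, h3⟩
  rw [two_nsmul]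
  exact h3.add h3

/-- The Cayley transforms turn the Sylvester equation into a Stein equation. -/
theorem stein_of_sylvester (hS : IsPosContraction S) (hS' : IsPosContraction S')
    (h : X * S + S' * X = S' * K * S) :
    X - cayley S' * X * cayley S = 2 • (cayleyFrac S' * K * cayleyFrac S) := by
  have h1 : cayleyInv S' * (X * S + S' * X) * cayleyInv S =
      cayleyInv S' * X * (S * cayleyInv S) + cayleyInv S' * S' * X * cayleyInv S := by noncomm_ring
  have h2 : cayleyInv S' * (S' * K * S) * cayleyInv S =
      cayleyInv S' * S' * K * (S * cayleyInv S) := by noncomm_ring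
  rw [h, h2, hS.mul_cayleyInv, hS'.cayleyInv_mul] at h1
  rw [h1, cayley, cayley, cayleyFrac, cayleyFrac]
  noncomm_ring

/-- A partial sum of the expansion of `X` obtained by iterating the Stein equation: each term is
bounded by `‖K‖` times the decrements of the quadratic forms of `S` and `S'`, and these telescope.
-/
theorem abs_inner_iterate_le (hS : IsPosContraction S) (hS' : IsPosContraction S')
    (h : X * S + S' * X = S' * K * S) (x y : E) (m n : ℕ) :
    |⟪(cayley S')^[m] y, X ((cayley S)^[m] x)⟫_ℝ -
        ⟪(cayley S')^[m + n] y, X ((cayley S)^[m + n] x)⟫_ℝ| ≤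
      ‖K‖ / 4 * (⟪S ((cayley S)^[m] x), (cayley S)^[m] x⟫_ℝ +
        ⟪S' ((cayley S')^[m] y), (cayley S')^[m] y⟫_ℝ -
        (⟪S ((cayley S)^[m + n] x), (cayley S)^[m + n] x⟫_ℝ +
        ⟪S' ((cayley S')^[m + n] y), (cayley S')^[m + n] y⟫_ℝ)) := by
  induction n with
  | zero => simp
  | succ n ih =>
    set u := (cayley S)^[m + n] x with hu
    set v := (cayley S')^[m + n] y with hv
    have hu' : (cayley S)^[m + (n + 1)] x = cayley S u := Function.iterate_succ_apply' _ _ _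
    have hv' : (cayley S')^[m + (n + 1)] y = cayley S' v := Function.iterate_succ_apply' _ _ _
    rw [hu', hv']
    have hst : X u - cayley S' (X (cayley S u)) = 2 • cayleyFrac S' (K (cayleyFrac S u)) :=
      congrArg (fun T : E →L[ℝ] E => T u) (stein_of_sylvester hS hS' h)
    have e1 : ⟪v, X u⟫_ℝ - ⟪cayley S' v, X (cayley S u)⟫_ℝ =
        2 * ⟪cayleyFrac S' v, K (cayleyFrac S u)⟫_ℝ := by
      have e2 : ⟪cayley S' v, X (cayley S u)⟫_ℝ = ⟪v, cayley S' (X (cayley S u))⟫_ℝ :=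
        hS'.isSelfAdjoint_cayley.1.isSymmetric _ _
      have e3 : ⟪cayleyFrac S' v, K (cayleyFrac S u)⟫_ℝ =
          ⟪v, cayleyFrac S' (K (cayleyFrac S u))⟫_ℝ :=
        hS'.isSelfAdjoint_cayley.2.isSymmetric _ _
      rw [e2, e3, ← inner_sub_right, hst, two_nsmul, inner_add_right, two_mul]
    have e4 : |⟪v, X u⟫_ℝ - ⟪cayley S' v, X (cayley S u)⟫_ℝ| ≤
        ‖K‖ * (‖cayleyFrac S u‖ ^ 2 + ‖cayleyFrac S' v‖ ^ 2) := by
      rw [e1, abs_mul, abs_two]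
      have e5 := abs_real_inner_le_norm (cayleyFrac S' v) (K (cayleyFrac S u))
      have e6 := K.le_opNorm (cayleyFrac S u)
      have e7 := mul_le_mul_of_nonneg_left e6 (norm_nonneg (cayleyFrac S' v))
      nlinarith [mul_nonneg (norm_nonneg K) (sq_nonneg (‖cayleyFrac S u‖ - ‖cayleyFrac S' v‖))]
    have e8 := hS.four_mul_norm_sq u
    have e9 := hS'.four_mul_norm_sq v
    have e10 : ‖K‖ * (‖cayleyFrac S u‖ ^ 2 + ‖cayleyFrac S' v‖ ^ 2) =
      ‖K‖ / 4 * (4 * ‖cayleyFrac S u‖ ^ 2 + 4 * ‖cayleyFrac S' v‖ ^ 2) := by ring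
    rw [e10, e8, e9] at e4
    refine (abs_sub_le _ ⟪v, X u⟫_ℝ _).trans ((add_le_add ih e4).trans_eq ?_)
    ring

/-- The expansion of `X` started at the `m`-th iterates, summed to infinity. -/
theorem abs_inner_iterate_le_of_sylvester (hS : IsPosContraction S) (hS' : IsPosContraction S')
    (hd : DenseRange S) (h : X * S + S' * X = S' * K * S) (x y : E) (m : ℕ) :
    |⟪(cayley S')^[m] y, X ((cayley S)^[m] x)⟫_ℝ| ≤
      ‖K‖ / 4 * (⟪S ((cayley S)^[m] x), (cayley S)^[m] x⟫_ℝ +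
        ⟪S' ((cayley S')^[m] y), (cayley S')^[m] y⟫_ℝ) := by
  have hcont : Continuous ((cayley S)^[m]) := (cayley S).continuous.iterate m
  refine hd.induction_on (p := fun x => |⟪(cayley S')^[m] y, X ((cayley S)^[m] x)⟫_ℝ| ≤
      ‖K‖ / 4 * (⟪S ((cayley S)^[m] x), (cayley S)^[m] x⟫_ℝ +
        ⟪S' ((cayley S')^[m] y), (cayley S')^[m] y⟫_ℝ)) x
    (isClosed_le (by fun_prop) (by fun_prop)) fun w => ?_
  -- on the range of `S` the remainder of the expansion tends to zero
  have hb : ∀ n, ‖(cayley S')^[n] y‖ ≤ ‖y‖ := by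
    intro n
    induction n with
    | zero => rfl
    | succ n ih =>
      rw [Function.iterate_succ_apply']
      refine le_trans ?_ ih
      set z := (cayley S')^[n] y
      -- `‖(1 - S') q‖ ≤ ‖(1 + S') q‖` with `z = (1 + S') q`
      set q := cayleyInv S' z with hq
      have hx : z = q + S' q :=
        (congrArg (fun T : E →L[ℝ] E => T z) (Ring.mul_inverse_cancel _ hS'.isUnit)).symm
      have hd : cayleyFrac S' z = S' q :=
        congrArg (fun T : E →L[ℝ] E => T z) hS'.mul_cayleyInv.symm
      have hc : cayley S' z = q - S' q := by
        have : cayley S' z = z - 2 • cayleyFrac S' z := rfl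
        rw [this, hd, two_nsmul]
        nth_rw 1 [hx]
        abel
      refine le_of_sq_le_sq ?_ (norm_nonneg _)
      have h1 := hS'.nonneg q
      rw [real_inner_comm] at h1
      rw [hc, hx, norm_sub_sq_real, norm_add_sq_real]
      linarith
  have hlim : Tendsto (fun n => ⟪(cayley S')^[m + n] y, X ((cayley S)^[m + n] (S w))⟫_ℝ) atTop
      (𝓝 0) := by
    have h1 : Tendsto (fun n => ‖y‖ * (‖X‖ * ‖(cayley S)^[m + n] (S w)‖)) atTop (𝓝 0) := by
      have h2 := (hS.tendsto_iterate w).norm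
      have h3 := (((tendsto_add_atTop_iff_nat m).2 h2).const_mul ‖X‖).const_mul ‖y‖
      rw [norm_zero, mul_zero, mul_zero] at h3
      exact h3.congr fun n => by rw [add_comm]
    refine squeeze_zero_norm (fun n => ?_) h1
    refine (norm_inner_le_norm _ _).trans ?_
    exact mul_le_mul (hb _) (X.le_opNorm _) (norm_nonneg _) (norm_nonneg _)
  have hlim2 := ((tendsto_const_nhds
    (x := ⟪(cayley S')^[m] y, X ((cayley S)^[m] (S w))⟫_ℝ)).sub hlim).abs
  rw [sub_zero] at hlim2
  refine le_of_tendsto hlim2 (.of_forall fun n => ?_)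
  refine (abs_inner_iterate_le hS hS' h (S w) y m n).trans ?_
  refine mul_le_mul_of_nonneg_left ?_ (by positivity)
  linarith [hS.nonneg ((cayley S)^[m + n] (S w)), hS'.nonneg ((cayley S')^[m + n] y)]

theorem norm_iterate_le_of_sylvester (hS : IsPosContraction S) (hS' : IsPosContraction S')
    (hd : DenseRange S) (h : X * S + S' * X = S' * K * S) (m : ℕ) :
    ‖(cayley S') ^ (m + 1) * X * (cayley S) ^ (m + 1)‖ ≤ ‖K‖ / 2 / (m + 1) := by
  have hm : (0 : ℝ) < m + 1 := by positivity
  have h1 := norm_le_of_abs_inner_le (T := (cayley S') ^ (m + 1) * X * (cayley S) ^ (m + 1))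
    (M := ‖K‖ / 4 / (m + 1)) (by positivity) fun x y => ?_
  · exact h1.trans_eq (by ring)
  · have e1 : ⟪y, ((cayley S') ^ (m + 1) * X * (cayley S) ^ (m + 1)) x⟫_ℝ =
        ⟪(cayley S')^[m + 1] y, X ((cayley S)^[m + 1] x)⟫_ℝ := by
      have e2 := (hS'.isSelfAdjoint_cayley.1.pow (m + 1)).isSymmetric y
        (X (((cayley S) ^ (m + 1)) x))
      rw [← FunLike.coe_pow_eq_iterate, ← FunLike.coe_pow_eq_iterate]
      exact e2.symm
    rw [e1]
    refine (abs_inner_iterate_le_of_sylvester hS hS' hd h x y (m + 1)).trans ?_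
    have e3 := hS.mul_inner_iterate_le x (m + 1)
    have e4 := hS'.mul_inner_iterate_le y (m + 1)
    push_cast at e3 e4
    have e5 : ‖K‖ / 4 / (m + 1) * (‖x‖ ^ 2 + ‖y‖ ^ 2) =
      ‖K‖ / 4 * ((‖x‖ ^ 2 + ‖y‖ ^ 2) / (m + 1)) := by ring
    rw [e5]
    refine mul_le_mul_of_nonneg_left ?_ (by positivity)
    rw [le_div_iff₀ hm]
    linarith

/-- Solutions of the Sylvester equation `X S + S' X = S' K S` are bounded in terms of `K` alone,
even if `S` and `S'` are not invertible. Formally `X` is the integral of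
`exp (-t S'⁻¹) K exp (-t S⁻¹)` over `t > 0`; the powers of the Cayley transforms are a discrete substitute for the two
semigroups. -/
theorem norm_le_of_sylvester (hS : IsPosContraction S) (hS' : IsPosContraction S')
    (hd : DenseRange S) (h : X * S + S' * X = S' * K * S) : ‖X‖ ≤ ‖K‖ / 2 := by
  refine (norm_le_of_abs_inner_le (M := ‖K‖ / 4) (by positivity) fun x y => ?_).trans_eq (by ring)
  refine (abs_inner_iterate_le_of_sylvester hS hS' hd h x y 0).trans ?_
  exact mul_le_mul_of_nonneg_left (add_le_add (hS.inner_le x) (hS'.inner_le y)) (by positivity)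

omit [CompleteSpace E] in
theorem isCompactOperator_mul_left (C : E →L[ℝ] E) {T : E →L[ℝ] E} (h : IsCompactOperator T) :
    IsCompactOperator (C * T : E →L[ℝ] E) := h.clm_comp C

omit [CompleteSpace E] in
theorem isCompactOperator_mul_right {T : E →L[ℝ] E} (h : IsCompactOperator T) (C : E →L[ℝ] E) :
    IsCompactOperator (T * C : E →L[ℝ] E) := h.comp_clm C

/-- The solution of the Sylvester equation is compact if `K` is, being a norm limit of the partial
sums of its expansion. -/
theorem isCompactOperator_of_sylvester (hS : IsPosContraction S) (hS' : IsPosContraction S')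
    (hd : DenseRange S) (h : X * S + S' * X = S' * K * S) (hK : IsCompactOperator K) :
    IsCompactOperator X := by
  have h1 : ∀ m : ℕ, IsCompactOperator
      (X - (cayley S') ^ m * X * (cayley S) ^ m : E →L[ℝ] E) := by
    intro m
    induction m with
    | zero => simpa using isCompactOperator_zero
    | succ m ih =>
      have e1 : X - (cayley S') ^ (m + 1) * X * (cayley S) ^ (m + 1) =
          (X - (cayley S') ^ m * X * (cayley S) ^ m) +
            (cayley S') ^ m * (X - cayley S' * X * cayley S) * (cayley S) ^ m := by
        rw [pow_succ (cayley S'), pow_succ' (cayley S)]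
        noncomm_ring
      rw [e1, stein_of_sylvester hS hS' h, two_nsmul]
      have h2 := isCompactOperator_mul_right
        (isCompactOperator_mul_left (cayleyFrac S') hK) (cayleyFrac S)
      exact ih.add (isCompactOperator_mul_right (isCompactOperator_mul_left _ (h2.add h2)) _)
  have h3 : Tendsto (fun m : ℕ => X - (cayley S') ^ (m + 1) * X * (cayley S) ^ (m + 1)) atTop
      (𝓝 (X - 0)) := by
    refine tendsto_const_nhds.sub (squeeze_zero_norm (norm_iterate_le_of_sylvester hS hS' hd h) ?_)
    exact (tendsto_const_div_atTop_nhds_zero_nat (‖K‖ / 2)).comp (tendsto_add_atTop_nat 1)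
      |>.congr fun m => by simp
  rw [sub_zero] at h3
  exact isCompactOperator_of_tendsto h3 (.of_forall fun m => h1 (m + 1))

theorem isPosContraction_absOp {R : E →L[ℝ] E} (hR : IsSelfAdjoint R) (h : ‖R‖ ≤ 1) :
    IsPosContraction (absOp R) :=
  ⟨isSelfAdjoint_absOp hR h, inner_absOp_nonneg hR h, norm_absOp_le hR h⟩

/-- If `R - R' = R' K R`, that is `R'⁻¹ - R⁻¹ = K`, then the difference of the signs of `R` and `R'`
solves a Sylvester equation. -/
theorem signOp_sylvester {R R' K : E →L[ℝ] E} (hR : IsSelfAdjoint R) (h : ‖R‖ ≤ 1)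
    (hR' : IsSelfAdjoint R') (h' : ‖R'‖ ≤ 1) (hK : R - R' = R' * K * R) :
    (signOp R' - signOp R) * absOp R + absOp R' * (signOp R' - signOp R) =
      absOp R' * (K - signOp R' * K * signOp R) * absOp R := by
  have e1 : (signOp R' - signOp R) * absOp R + absOp R' * (signOp R' - signOp R) =
      signOp R' * absOp R - absOp R' * signOp R - (R - R') := by
    rw [sub_mul, mul_sub, signOp_mul_absOp hR h, absOp_mul_signOp hR' h']
    noncomm_ring
  have e2 : signOp R' * absOp R - absOp R' * signOp R = signOp R' * (R - R') * signOp R := by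
    rw [← mul_signOp hR h, ← signOp_mul hR' h']
    noncomm_ring
  have e3 : absOp R' * (K - signOp R' * K * signOp R) * absOp R =
      absOp R' * K * absOp R - absOp R' * signOp R' * K * (signOp R * absOp R) := by noncomm_ring
  rw [e1, e2, e3, hK, signOp_mul_absOp hR h, absOp_mul_signOp hR' h']
  congr 1
  calc signOp R' * (R' * K * R) * signOp R = signOp R' * R' * K * (R * signOp R) := by noncomm_ring
    _ = _ := by rw [signOp_mul hR' h', mul_signOp hR h]

theorem norm_signOp_le (R : E →L[ℝ] E) : ‖signOp R‖ ≤ 1 := by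
  refine ContinuousLinearMap.opNorm_le_bound _ zero_le_one fun x => ?_
  rw [one_mul]
  refine le_of_sq_le_sq (le_of_eq ?_) (norm_nonneg _)
  rw [← real_inner_self_eq_norm_sq, ← real_inner_self_eq_norm_sq]
  refine ((isSelfAdjoint_signOp (R := R)).isSymmetric x (signOp R x)).trans ?_
  exact congrArg (fun T : E →L[ℝ] E => ⟪x, T x⟫_ℝ) (signOp_mul_self (R := R))

theorem norm_signOp_sub_le {R R' K : E →L[ℝ] E} (hR : IsSelfAdjoint R) (h : ‖R‖ ≤ 1)
    (h0 : ∀ x, R x = 0 → x = 0) (hR' : IsSelfAdjoint R') (h' : ‖R'‖ ≤ 1) (hK : R - R' = R' * K * R) :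
    ‖signOp R' - signOp R‖ ≤ ‖K‖ := by
  refine (norm_le_of_sylvester (isPosContraction_absOp hR h) (isPosContraction_absOp hR' h')
    (denseRange_absOp hR h h0) (signOp_sylvester hR h hR' h' hK)).trans ?_
  have h1 : ‖signOp R' * K * signOp R‖ ≤ ‖K‖ := by
    calc ‖signOp R' * K * signOp R‖ ≤ ‖signOp R'‖ * ‖K‖ * ‖signOp R‖ :=
          (norm_mul_le _ _).trans (mul_le_mul_of_nonneg_right (norm_mul_le _ _) (norm_nonneg _))
      _ ≤ 1 * ‖K‖ * 1 := by
          gcongr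
          · exact norm_signOp_le R'
          · exact norm_signOp_le R
      _ = ‖K‖ := by ring
  have h2 := norm_sub_le K (signOp R' * K * signOp R)
  linarith

theorem isCompactOperator_signOp_sub {R R' K : E →L[ℝ] E} (hR : IsSelfAdjoint R) (h : ‖R‖ ≤ 1)
    (h0 : ∀ x, R x = 0 → x = 0) (hR' : IsSelfAdjoint R') (h' : ‖R'‖ ≤ 1) (hK : R - R' = R' * K * R)
    (hc : IsCompactOperator K) :
    IsCompactOperator (signOp R' - signOp R : E →L[ℝ] E) :=
  isCompactOperator_of_sylvester (isPosContraction_absOp hR h) (isPosContraction_absOp hR' h')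
    (denseRange_absOp hR h h0) (signOp_sylvester hR h hR' h' hK)
    (hc.sub (isCompactOperator_mul_right (isCompactOperator_mul_left _ hc) _))

end Sylvester

/-! ### Bounded polar coordinates of the graph of a self-adjoint operator -/

section Polar

variable {H : Type*} [NormedAddCommGroup H] [InnerProductSpace ℝ H]

/-- The operator on `S(H)` with components `X` and `Y`. -/
def sympProd (X Y : SympSpace H →L[ℝ] H) : SympSpace H →L[ℝ] SympSpace H :=
  (WithLp.prodContinuousLinearEquiv 2 ℝ H H).symm.toContinuousLinearMap ∘L X.prod Y

@[simp] theorem sympProd_fst (X Y : SympSpace H →L[ℝ] H) (z : SympSpace H) :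
    (sympProd X Y z).fst = X z := rfl
@[simp] theorem sympProd_snd (X Y : SympSpace H →L[ℝ] H) (z : SympSpace H) :
    (sympProd X Y z).snd = Y z := rfl

/-- The block diagonal operator on `S(H)` with blocks `X` and `Y`. -/
def sympDiag (X Y : H →L[ℝ] H) : SympSpace H →L[ℝ] SympSpace H :=
  sympProd (X ∘L WithLp.fstL 2 ℝ H H) (Y ∘L WithLp.sndL 2 ℝ H H)

@[simp] theorem sympDiag_fst (X Y : H →L[ℝ] H) (z : SympSpace H) :
    (sympDiag X Y z).fst = X z.fst := rfl
@[simp] theorem sympDiag_snd (X Y : H →L[ℝ] H) (z : SympSpace H) :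
    (sympDiag X Y z).snd = Y z.snd := rfl

omit [InnerProductSpace ℝ H] in
theorem norm_sq_sympSpace (z : SympSpace H) : ‖z‖ ^ 2 = ‖z.fst‖ ^ 2 + ‖z.snd‖ ^ 2 :=
  WithLp.prod_norm_sq_eq_of_L2 _

omit [InnerProductSpace ℝ H] in
theorem norm_fst_le_sympSpace (z : SympSpace H) : ‖z.fst‖ ≤ ‖z‖ :=
  le_of_sq_le_sq (by rw [norm_sq_sympSpace z]; nlinarith [sq_nonneg ‖z.snd‖]) (norm_nonneg _)

omit [InnerProductSpace ℝ H] in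
theorem norm_snd_le_sympSpace (z : SympSpace H) : ‖z.snd‖ ≤ ‖z‖ :=
  le_of_sq_le_sq (by rw [norm_sq_sympSpace z]; nlinarith [sq_nonneg ‖z.fst‖]) (norm_nonneg _)

theorem norm_sympDiag_neg_le (K : H →L[ℝ] H) : ‖sympDiag K (-K)‖ ≤ ‖K‖ := by
  refine ContinuousLinearMap.opNorm_le_bound _ (norm_nonneg _) fun z => ?_
  refine le_of_sq_le_sq ?_ (by positivity)
  rw [mul_pow, norm_sq_sympSpace, norm_sq_sympSpace z, sympDiag_fst, sympDiag_snd,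
    neg_apply, norm_neg, mul_add, ← mul_pow, ← mul_pow]
  exact add_le_add (pow_le_pow_left₀ (norm_nonneg _) (K.le_opNorm _) 2)
    (pow_le_pow_left₀ (norm_nonneg _) (K.le_opNorm _) 2)

theorem isCompactOperator_sympDiag {X Y : H →L[ℝ] H} (hX : IsCompactOperator X)
    (hY : IsCompactOperator Y) : IsCompactOperator (sympDiag X Y) := by
  have h1 := (hX.comp_clm (WithLp.fstL 2 ℝ H H)).clm_comp (pairMap (H := H) 1 0)
  have h2 := (hY.comp_clm (WithLp.sndL 2 ℝ H H)).clm_comp (pairMap (H := H) 0 1)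
  have e : sympDiag X Y = pairMap 1 0 ∘L (X ∘L WithLp.fstL 2 ℝ H H) +
      pairMap 0 1 ∘L (Y ∘L WithLp.sndL 2 ℝ H H) := by
    refine ContinuousLinearMap.ext fun z => SympSpace.ext ?_ ?_
    · change X z.fst = X z.fst + 0
      rw [add_zero]
    · change Y z.snd = 0 + Y z.snd
      rw [zero_add]
  rw [e]
  exact h1.add h2

variable [CompleteSpace H]

/-- For the graph of a self-adjoint operator `A` this is the inverse of the block operator with
rows `(A, 1)` and `(1, -A)`, that is, `(1 + A ^ 2)⁻¹` times this block operator. -/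
def dres (L : LagGr H) : SympSpace H →L[ℝ] SympSpace H :=
  sympProd (WithLp.fstL 2 ℝ H H ∘L L.proj ∘L sympProd (WithLp.sndL 2 ℝ H H) (WithLp.fstL 2 ℝ H H))
    (WithLp.fstL 2 ℝ H H - WithLp.sndL 2 ℝ H H ∘L L.proj ∘L
      sympProd (WithLp.sndL 2 ℝ H H) (WithLp.fstL 2 ℝ H H))

theorem dres_mem_left (L : LagGr H) (z : SympSpace H) :
    (WithLp.toLp 2 ((dres L z).fst, z.fst - (dres L z).snd) : SympSpace H) ∈ L.1 := by
  have h : (WithLp.toLp 2 ((dres L z).fst, z.fst - (dres L z).snd) : SympSpace H) =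
      L.proj (WithLp.toLp 2 (z.snd, z.fst)) :=
    SympSpace.ext rfl (sub_sub_cancel _ _)
  rw [h]
  exact Submodule.starProjection_apply_mem _ _

theorem dres_mem_right (L : LagGr H) (z : SympSpace H) :
    (WithLp.toLp 2 ((dres L z).snd, (dres L z).fst - z.snd) : SympSpace H) ∈ L.1 := by
  set y : SympSpace H := WithLp.toLp 2 (z.snd, z.fst) with hy
  have h1 : complexJ H (y - L.proj y) ∈ L.1 :=
    L.2.mem_orthogonal_iff.1 (Submodule.sub_starProjection_mem_orthogonal y)
  have h : (WithLp.toLp 2 ((dres L z).snd, (dres L z).fst - z.snd) : SympSpace H) =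
      -complexJ H (y - L.proj y) := by
    refine SympSpace.ext ?_ ?_
    · change z.fst - (L.proj y).snd = - -(z.fst - (L.proj y).snd)
      rw [neg_neg]
    · change (L.proj y).fst - z.snd = -(z.snd - (L.proj y).fst)
      rw [neg_sub]
  rw [h]
  exact neg_mem h1

/-- The vector `dres L z` is assembled from the orthogonal components in `L` and `Lᗮ` of `z` with
its coordinates exchanged. -/
theorem norm_dres_le (L : LagGr H) : ‖dres L‖ ≤ 1 := by
  refine ContinuousLinearMap.opNorm_le_bound _ zero_le_one fun z => ?_
  rw [one_mul]
  refine le_of_sq_le_sq ?_ (norm_nonneg _)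
  set y : SympSpace H := WithLp.toLp 2 (z.snd, z.fst) with hy
  have h1 : ‖z‖ ^ 2 = ‖L.proj y‖ ^ 2 + ‖y - L.proj y‖ ^ 2 := by
    have h2 : ‖y‖ ^ 2 = ‖z‖ ^ 2 := by
      rw [norm_sq_sympSpace, norm_sq_sympSpace z, add_comm]; rfl
    have h3 : ⟪L.proj y, y - L.proj y⟫_ℝ = 0 := by
      rw [real_inner_comm]
      exact Submodule.starProjection_inner_eq_zero _ _ (Submodule.starProjection_apply_mem _ _)
    have h4 := norm_add_sq_real (L.proj y) (y - L.proj y)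
    rw [add_sub_cancel, h2, h3] at h4
    linarith
  have h2 : ‖dres L z‖ ^ 2 = ‖(L.proj y).fst‖ ^ 2 + ‖(y - L.proj y).snd‖ ^ 2 :=
    norm_sq_sympSpace _
  rw [h2, h1, norm_sq_sympSpace (L.proj y), norm_sq_sympSpace (y - L.proj y)]
  linarith [sq_nonneg ‖(L.proj y).snd‖, sq_nonneg ‖(y - L.proj y).fst‖]

attribute [irreducible] dres

theorem dres_unique {L : LagGr H} {z w : SympSpace H}
    (h1 : (WithLp.toLp 2 (w.fst, z.fst - w.snd) : SympSpace H) ∈ L.1)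
    (h2 : (WithLp.toLp 2 (w.snd, w.fst - z.snd) : SympSpace H) ∈ L.1) : dres L z = w := by
  set u := dres L z
  have h3 := sub_mem (dres_mem_left L z) h1
  have h4 := sub_mem (dres_mem_right L z) h2
  have h5 := L.2.inner_comm h3 h4
  simp only [WithLp.sub_fst, WithLp.sub_snd, WithLp.toLp_fst, WithLp.toLp_snd,
    sub_sub_sub_cancel_left, sub_sub_sub_cancel_right] at h5
  change ⟪u.fst - w.fst, u.fst - w.fst⟫_ℝ = ⟪w.snd - u.snd, u.snd - w.snd⟫_ℝ at h5
  rw [← neg_sub u.snd w.snd, inner_neg_left, real_inner_self_eq_norm_sq,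
    real_inner_self_eq_norm_sq] at h5
  have h6 : ‖u.fst - w.fst‖ = 0 := by nlinarith [sq_nonneg ‖u.snd - w.snd‖, sq_nonneg ‖u.fst - w.fst‖]
  have h7 : ‖u.snd - w.snd‖ = 0 := by nlinarith [sq_nonneg ‖u.snd - w.snd‖, sq_nonneg ‖u.fst - w.fst‖]
  exact SympSpace.ext (sub_eq_zero.1 (norm_eq_zero.1 h6)) (sub_eq_zero.1 (norm_eq_zero.1 h7))

theorem isSelfAdjoint_dres (L : LagGr H) : IsSelfAdjoint (dres L) := by
  rw [ContinuousLinearMap.isSelfAdjoint_iff_isSymmetric]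
  intro z z'
  change ⟪dres L z, z'⟫_ℝ = ⟪z, dres L z'⟫_ℝ
  have h1 := L.2.inner_comm (dres_mem_left L z) (dres_mem_left L z')
  have h2 := L.2.inner_comm (dres_mem_right L z) (dres_mem_right L z')
  simp only [WithLp.toLp_fst, WithLp.toLp_snd, inner_sub_left] at h1 h2
  rw [inner_sympSpace, inner_sympSpace, real_inner_comm z'.fst, real_inner_comm z'.snd]
  rw [real_inner_comm (dres L z).fst (dres L z').snd] at h1
  rw [real_inner_comm (dres L z').fst (dres L z).snd] at h1
  linarith

/-- `L` contains no nonzero vector of `{0} × H`, as is the case for graphs of operators. -/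
def IsGraphLike (L : LagGr H) : Prop :=
  ∀ y : H, (WithLp.toLp 2 (0, y) : SympSpace H) ∈ L.1 → y = 0

theorem IsGraphLike.dres_injective {L : LagGr H} (hL : IsGraphLike L) (z : SympSpace H)
    (h : dres L z = 0) : z = 0 := by
  have h1 := dres_mem_left L z
  have h2 := dres_mem_right L z
  rw [h] at h1 h2
  simp only [WithLp.zero_fst, WithLp.zero_snd, sub_zero, zero_sub] at h1 h2
  exact SympSpace.ext (hL _ h1) (neg_eq_zero.1 (hL _ h2))

/-- An operator which preserves `L` componentwise commutes with `dres L`. -/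
theorem commute_dres {L : LagGr H} {T : H →L[ℝ] H}
    (hT : ∀ z ∈ L.1, (WithLp.toLp 2 (T z.fst, T z.snd) : SympSpace H) ∈ L.1) :
    Commute (sympDiag T T) (dres L) := by
  refine ContinuousLinearMap.ext fun z => ?_
  change sympDiag T T (dres L z) = dres L (sympDiag T T z)
  refine (dres_unique ?_ ?_).symm
  · convert hT _ (dres_mem_left L z) using 1
    exact SympSpace.ext rfl (map_sub T _ _).symm
  · convert hT _ (dres_mem_right L z) using 1
    exact SympSpace.ext rfl (map_sub T _ _).symm

/-- The second resolvent identity. -/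
theorem dres_sub_dres {L L' : LagGr H} {K : H →L[ℝ] H}
    (hK : ∀ z ∈ L.1, (WithLp.toLp 2 (z.fst, z.snd + K z.fst) : SympSpace H) ∈ L'.1) :
    dres L - dres L' = dres L' * sympDiag K (-K) * dres L := by
  refine ContinuousLinearMap.ext fun z => ?_
  change dres L z - dres L' z = dres L' (sympDiag K (-K) (dres L z))
  refine (dres_unique ?_ ?_).symm
  · convert sub_mem (hK _ (dres_mem_left L z)) (dres_mem_left L' z) using 1
    refine SympSpace.ext rfl ?_
    change K (dres L z).fst - ((dres L z).snd - (dres L' z).snd) =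
      z.fst - (dres L z).snd + K (dres L z).fst - (z.fst - (dres L' z).snd)
    abel
  · convert sub_mem (hK _ (dres_mem_right L z)) (dres_mem_right L' z) using 1
    refine SympSpace.ext rfl ?_
    change (dres L z).fst - (dres L' z).fst - -K (dres L z).snd =
      (dres L z).fst - z.snd + K (dres L z).snd - ((dres L' z).fst - z.snd)
    abel

theorem dres_complexJ (L : LagGr H) (z : SympSpace H) :
    dres L (complexJ H z) = -complexJ H (dres L z) := by
  refine dres_unique ?_ ?_
  · convert dres_mem_right L z using 1
    refine SympSpace.ext ?_ ?_
    · change - -(dres L z).snd = (dres L z).snd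
      rw [neg_neg]
    · change -z.snd - -(dres L z).fst = (dres L z).fst - z.snd
      abel
  · convert neg_mem (dres_mem_left L z) using 1
    refine SympSpace.ext rfl ?_
    change - -(dres L z).snd - z.fst = -(z.fst - (dres L z).snd)
    abel

/-- The operator `A (1 + A ^ 2)⁻¹`, if `L` is the graph of `A`. -/
def resAlpha (L : LagGr H) : H →L[ℝ] H := WithLp.fstL 2 ℝ H H ∘L dres L ∘L pairMap 1 0

/-- The operator `(1 + A ^ 2)⁻¹`, if `L` is the graph of `A`. -/
def resBeta (L : LagGr H) : H →L[ℝ] H := WithLp.sndL 2 ℝ H H ∘L dres L ∘L pairMap 1 0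

omit [CompleteSpace H] in
theorem eq_fst_add_complexJ_snd (z : SympSpace H) :
    z = pairMap 1 0 z.fst + complexJ H (pairMap 1 0 z.snd) := by
  refine SympSpace.ext ?_ ?_
  · change z.fst = z.fst + -0
    rw [neg_zero, add_zero]
  · change z.snd = 0 + z.snd
    rw [zero_add]

theorem dres_apply (L : LagGr H) (z : SympSpace H) :
    dres L z = WithLp.toLp 2 (resAlpha L z.fst + resBeta L z.snd,
      resBeta L z.fst - resAlpha L z.snd) := by
  conv_lhs => rw [eq_fst_add_complexJ_snd z]
  rw [map_add, dres_complexJ]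
  refine SympSpace.ext ?_ ?_
  · change resAlpha L z.fst + - -resBeta L z.snd = _
    rw [neg_neg]; rfl
  · change resBeta L z.fst + -resAlpha L z.snd = _
    rw [← sub_eq_add_neg]; rfl

attribute [irreducible] resAlpha resBeta

theorem resBeta_resAlpha_mem (L : LagGr H) (v : H) :
    (WithLp.toLp 2 (resBeta L v, resAlpha L v) : SympSpace H) ∈ L.1 := by
  have h := dres_mem_right L (WithLp.toLp 2 (v, 0))
  rw [dres_apply] at h
  simpa using h

theorem resAlpha_sub_resBeta_mem (L : LagGr H) (v : H) :
    (WithLp.toLp 2 (resAlpha L v, v - resBeta L v) : SympSpace H) ∈ L.1 := by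
  have h := dres_mem_left L (WithLp.toLp 2 (v, 0))
  rw [dres_apply] at h
  simpa using h

theorem resBeta_eq_resAlpha {L : LagGr H} {z : SympSpace H} (hz : z ∈ L.1) :
    resBeta L z.snd = resAlpha L z.fst := by
  have h : dres L (WithLp.toLp 2 (0, z.snd)) =
      WithLp.toLp 2 (resAlpha L z.fst, resBeta L z.fst - z.fst) := by
    refine dres_unique ?_ ?_
    · simpa using resAlpha_sub_resBeta_mem L z.fst
    · exact sub_mem (resBeta_resAlpha_mem L z.fst) hz
  rw [dres_apply] at h
  have := congrArg WithLp.fst h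
  simpa using this

theorem resBeta_mul_resAlpha (L : LagGr H) (v : H) :
    resBeta L (resAlpha L v) = resAlpha L (resBeta L v) :=
  resBeta_eq_resAlpha (resBeta_resAlpha_mem L v)

theorem resAlpha_sq_add_resBeta_sq (L : LagGr H) (v : H) :
    resAlpha L (resAlpha L v) + resBeta L (resBeta L v) = resBeta L v := by
  have h := resBeta_eq_resAlpha (resAlpha_sub_resBeta_mem L v)
  simp only [WithLp.toLp_fst, WithLp.toLp_snd, map_sub] at h
  rw [← h, sub_add_cancel]

theorem dres_dres (L : LagGr H) : dres L * dres L = sympDiag (resBeta L) (resBeta L) := by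
  refine ContinuousLinearMap.ext fun z => ?_
  change dres L (dres L z) = _
  rw [dres_apply L (dres L z), dres_apply L z]
  refine SympSpace.ext ?_ ?_
  · change resAlpha L (resAlpha L z.fst + resBeta L z.snd) +
      resBeta L (resBeta L z.fst - resAlpha L z.snd) = resBeta L z.fst
    rw [map_add, map_sub, resBeta_mul_resAlpha, add_add_sub_cancel, resAlpha_sq_add_resBeta_sq]
  · change resBeta L (resAlpha L z.fst + resBeta L z.snd) -
      resAlpha L (resBeta L z.fst - resAlpha L z.snd) = resBeta L z.snd
    rw [map_add, map_sub, resBeta_mul_resAlpha, add_sub_sub_cancel, add_comm,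
      resAlpha_sq_add_resBeta_sq]

/-- The operator `A (1 + A ^ 2) ^ (-1 / 2)`, if `L` is the graph of `A`. -/
def polarF (L : LagGr H) : H →L[ℝ] H := WithLp.fstL 2 ℝ H H ∘L signOp (dres L) ∘L pairMap 1 0

/-- The operator `(1 + A ^ 2) ^ (-1 / 2)`, if `L` is the graph of `A`. -/
def polarG (L : LagGr H) : H →L[ℝ] H := WithLp.sndL 2 ℝ H H ∘L signOp (dres L) ∘L pairMap 1 0

theorem signOp_dres_complexJ {L : LagGr H} (hL : IsGraphLike L) (z : SympSpace H) :
    signOp (dres L) (complexJ H z) = -complexJ H (signOp (dres L) z) := by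
  have hR := isSelfAdjoint_dres L
  have hn := norm_dres_le L
  let C : SympSpace H →L[ℝ] SympSpace H := (complexJ H).toContinuousLinearEquiv
  have hCR : C * dres L = -(dres L * C) := by
    refine ContinuousLinearMap.ext fun z => ?_
    change complexJ H (dres L z) = -dres L (complexJ H z)
    rw [dres_complexJ, neg_neg]
  have hCS : Commute C (absOp (dres L)) := by
    refine commute_absOp hR hn ?_
    refine ContinuousLinearMap.ext fun z => ?_
    change complexJ H (dres L (dres L z)) = dres L (dres L (complexJ H z))
    rw [dres_complexJ, map_neg, dres_complexJ, neg_neg]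
  have h : signOp (dres L) * C = -(C * signOp (dres L)) := by
    refine eq_of_mul_eq_mul_of_dense (denseRange_absOp hR hn hL.dres_injective) ?_
    rw [neg_mul, mul_assoc, mul_assoc, signOp_mul_absOp hR hn, hCS.eq, ← mul_assoc,
      signOp_mul_absOp hR hn, hCR, neg_neg]
  exact congrArg (fun T : SympSpace H →L[ℝ] SympSpace H => T z) h

theorem signOp_dres_apply {L : LagGr H} (hL : IsGraphLike L) (z : SympSpace H) :
    signOp (dres L) z = WithLp.toLp 2 (polarF L z.fst + polarG L z.snd,
      polarG L z.fst - polarF L z.snd) := by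
  conv_lhs => rw [eq_fst_add_complexJ_snd z]
  rw [map_add, signOp_dres_complexJ hL]
  refine SympSpace.ext ?_ ?_
  · change polarF L z.fst + - -polarG L z.snd = _
    rw [neg_neg]; rfl
  · change polarG L z.fst + -polarF L z.snd = _
    rw [← sub_eq_add_neg]; rfl

theorem norm_polar_sub_le (L L' : LagGr H) :
    ‖polarF L' - polarF L‖ ≤ ‖signOp (dres L') - signOp (dres L)‖ ∧
      ‖polarG L' - polarG L‖ ≤ ‖signOp (dres L') - signOp (dres L)‖ := by
  have h1 : ∀ v : H, ‖(signOp (dres L') - signOp (dres L)) (pairMap 1 0 v)‖ ≤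
      ‖signOp (dres L') - signOp (dres L)‖ * ‖v‖ := by
    intro v
    refine ((signOp (dres L') - signOp (dres L)).le_opNorm _).trans_eq ?_
    congr 1
    have h2 := norm_pairMap_sq (1 : H →L[ℝ] H) 0 v
    rw [one_apply_eq_self, zero_apply, norm_zero] at h2
    refine (sq_eq_sq₀ (norm_nonneg _) (norm_nonneg _)).1 ?_
    rw [h2]; ring
  constructor
  · exact ContinuousLinearMap.opNorm_le_bound _ (norm_nonneg _) fun v =>
      (norm_fst_le_sympSpace _).trans (h1 v)
  · exact ContinuousLinearMap.opNorm_le_bound _ (norm_nonneg _) fun v =>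
      (norm_snd_le_sympSpace _).trans (h1 v)

theorem isCompactOperator_polar_sub {L L' : LagGr H}
    (h : IsCompactOperator (signOp (dres L') - signOp (dres L) : SympSpace H →L[ℝ] SympSpace H)) :
    IsCompactOperator (polarF L' - polarF L : H →L[ℝ] H) :=
  (h.comp_clm (pairMap (H := H) 1 0)).clm_comp (WithLp.fstL 2 ℝ H H)

attribute [irreducible] polarF polarG

variable {L : LagGr H}

theorem isSelfAdjoint_polarF (hL : IsGraphLike L) : IsSelfAdjoint (polarF L) := by
  rw [ContinuousLinearMap.isSelfAdjoint_iff_isSymmetric]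
  intro u v
  have h : ⟪signOp (dres L) (WithLp.toLp 2 (u, 0)), (WithLp.toLp 2 (v, 0) : SympSpace H)⟫_ℝ =
      ⟪(WithLp.toLp 2 (u, 0) : SympSpace H), signOp (dres L) (WithLp.toLp 2 (v, 0))⟫_ℝ :=
    (isSelfAdjoint_signOp (R := dres L)).isSymmetric _ _
  rw [signOp_dres_apply hL, signOp_dres_apply hL, inner_sympSpace, inner_sympSpace] at h
  simpa using h

theorem isSelfAdjoint_polarG (hL : IsGraphLike L) : IsSelfAdjoint (polarG L) := by
  rw [ContinuousLinearMap.isSelfAdjoint_iff_isSymmetric]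
  intro u v
  have h : ⟪signOp (dres L) (WithLp.toLp 2 (0, u)), (WithLp.toLp 2 (v, 0) : SympSpace H)⟫_ℝ =
      ⟪(WithLp.toLp 2 (0, u) : SympSpace H), signOp (dres L) (WithLp.toLp 2 (v, 0))⟫_ℝ :=
    (isSelfAdjoint_signOp (R := dres L)).isSymmetric _ _
  rw [signOp_dres_apply hL, signOp_dres_apply hL, inner_sympSpace, inner_sympSpace] at h
  simpa using h

theorem polar_relations (hL : IsGraphLike L) (v : H) :
    polarF L (polarF L v) + polarG L (polarG L v) = v ∧
      polarG L (polarF L v) = polarF L (polarG L v) := by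
  have h : signOp (dres L) (signOp (dres L) (WithLp.toLp 2 (v, 0))) = WithLp.toLp 2 (v, 0) :=
    congrArg (fun T : SympSpace H →L[ℝ] SympSpace H => T (WithLp.toLp 2 (v, 0)))
      (signOp_mul_self (R := dres L))
  rw [signOp_dres_apply hL, signOp_dres_apply hL] at h
  constructor
  · simpa using congrArg WithLp.fst h
  · simpa [sub_eq_zero] using congrArg WithLp.snd h

theorem commute_polar (hL : IsGraphLike L) : Commute (polarG L) (polarF L) :=
  ContinuousLinearMap.ext fun v => (polar_relations hL v).2

/-- An operator which preserves `L` componentwise commutes with the polar coordinates. -/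
theorem commute_polar_of_preserves (hL : IsGraphLike L) {T : H →L[ℝ] H}
    (hT : ∀ z ∈ L.1, (WithLp.toLp 2 (T z.fst, T z.snd) : SympSpace H) ∈ L.1) :
    Commute T (polarF L) ∧ Commute T (polarG L) := by
  have h1 := commute_signOp (isSelfAdjoint_dres L) (norm_dres_le L) hL.dres_injective
    (commute_dres hT)
  have h2 : ∀ v, sympDiag T T (signOp (dres L) (WithLp.toLp 2 (v, 0))) =
      signOp (dres L) (sympDiag T T (WithLp.toLp 2 (v, 0))) := fun v =>
    congrArg (fun S : SympSpace H →L[ℝ] SympSpace H => S (WithLp.toLp 2 (v, 0))) h1.eq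
  constructor
  · refine ContinuousLinearMap.ext fun v => ?_
    have h3 := congrArg WithLp.fst (h2 v)
    rw [signOp_dres_apply hL, signOp_dres_apply hL] at h3
    simpa using h3
  · refine ContinuousLinearMap.ext fun v => ?_
    have h3 := congrArg WithLp.snd (h2 v)
    rw [signOp_dres_apply hL, signOp_dres_apply hL] at h3
    simpa using h3

/-- The absolute value of `dres L` is block diagonal with both blocks equal to `polarG L`. -/
theorem absOp_dres (hL : IsGraphLike L) :
    absOp (dres L) = sympDiag (polarG L) (polarG L) ∧ DenseRange (polarG L) ∧
      ∀ v, polarG L (polarG L v) = resBeta L v ∧ polarF L (polarG L v) = resAlpha L v := by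
  have hR := isSelfAdjoint_dres L
  have hn := norm_dres_le L
  set S := absOp (dres L) with hS
  let C : SympSpace H →L[ℝ] SympSpace H := (complexJ H).toContinuousLinearEquiv
  have hdiag : ∀ T : SympSpace H →L[ℝ] SympSpace H,
      Commute T (sympDiag (resBeta L) (resBeta L)) → Commute T S := fun T hT =>
    commute_absOp hR hn (by rwa [dres_dres])
  have hCS : Commute C S := hdiag C (ContinuousLinearMap.ext fun z =>
    SympSpace.ext (map_neg (resBeta L) z.snd).symm rfl)
  have hτS : Commute (sympDiag (1 : H →L[ℝ] H) (-1)) S :=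
    hdiag _ (ContinuousLinearMap.ext fun z =>
      SympSpace.ext rfl (map_neg (resBeta L) z.snd).symm)
  let s : H →L[ℝ] H := WithLp.fstL 2 ℝ H H ∘L S ∘L pairMap 1 0
  have hs1 : ∀ v, S (pairMap 1 0 v) = pairMap 1 0 (s v) := by
    intro v
    refine SympSpace.ext rfl ?_
    have h : sympDiag (1 : H →L[ℝ] H) (-1) (S (pairMap 1 0 v)) =
        S (sympDiag (1 : H →L[ℝ] H) (-1) (pairMap 1 0 v)) :=
      congrArg (fun T : SympSpace H →L[ℝ] SympSpace H => T (pairMap 1 0 v)) hτS.eq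
    have h2 : sympDiag (1 : H →L[ℝ] H) (-1) (pairMap 1 0 v) = pairMap 1 0 v :=
      SympSpace.ext rfl (neg_zero)
    rw [h2] at h
    have h3 : -(S (pairMap 1 0 v)).snd = (S (pairMap 1 0 v)).snd := congrArg WithLp.snd h
    have h4 : (2 : ℝ) • (S (pairMap 1 0 v)).snd = 0 := by
      rw [two_smul]
      nth_rw 1 [← h3]
      exact neg_add_cancel _
    exact (smul_eq_zero.1 h4).resolve_left two_ne_zero
  have hs : S = sympDiag s s := by
    refine ContinuousLinearMap.ext fun z => ?_
    have h : S (complexJ H (pairMap 1 0 z.snd)) = complexJ H (S (pairMap 1 0 z.snd)) :=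
      (congrArg (fun T : SympSpace H →L[ℝ] SympSpace H => T (pairMap 1 0 z.snd)) hCS.eq).symm
    conv_lhs => rw [eq_fst_add_complexJ_snd z]
    rw [map_add, h, hs1, hs1]
    exact (eq_fst_add_complexJ_snd (sympDiag s s z)).symm
  have hdense : DenseRange s := by
    have h1 := denseRange_absOp hR hn hL.dres_injective
    have h2 : DenseRange (WithLp.fstL 2 ℝ H H ∘ S) :=
      (show Function.Surjective (WithLp.fstL 2 ℝ H H) from fun v => ⟨pairMap 1 0 v, rfl⟩).denseRange.comp
        h1 (WithLp.fstL 2 ℝ H H).continuous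
    refine h2.mono ?_
    rintro _ ⟨z, rfl⟩
    refine ⟨z.fst, ?_⟩
    change s z.fst = (S z).fst
    rw [hs]; rfl
  have hJS : ∀ v, polarF L (s v) = resAlpha L v ∧ polarG L (s v) = resBeta L v := by
    intro v
    have h : signOp (dres L) (S (WithLp.toLp 2 (v, 0))) = dres L (WithLp.toLp 2 (v, 0)) :=
      congrArg (fun T : SympSpace H →L[ℝ] SympSpace H => T (WithLp.toLp 2 (v, 0)))
        (signOp_mul_absOp hR hn)
    rw [signOp_dres_apply hL, dres_apply, hs] at h
    exact ⟨by simpa using congrArg WithLp.fst h, by simpa using congrArg WithLp.snd h⟩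
  have hss : ∀ v, s (s v) = resBeta L v := by
    intro v
    have h : S (S (WithLp.toLp 2 (v, 0))) = (dres L * dres L) (WithLp.toLp 2 (v, 0)) :=
      congrArg (fun T : SympSpace H →L[ℝ] SympSpace H => T (WithLp.toLp 2 (v, 0)))
        (absOp_mul_self hR hn)
    rw [dres_dres, hs] at h
    exact congrArg WithLp.fst h
  have hG : polarG L = s := by
    refine eq_of_mul_eq_mul_of_dense hdense (ContinuousLinearMap.ext fun v => ?_)
    exact ((hJS v).2).trans (hss v).symm
  rw [hG]
  exact ⟨hs, hdense, fun v => ⟨hss v, (hJS v).1⟩⟩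

theorem inner_polarG_nonneg (hL : IsGraphLike L) (v : H) : 0 ≤ ⟪polarG L v, v⟫_ℝ := by
  have h := inner_absOp_nonneg (isSelfAdjoint_dres L) (norm_dres_le L) (WithLp.toLp 2 (v, 0))
  rw [(absOp_dres hL).1, inner_sympSpace] at h
  simpa using h

theorem polar_mem (hL : IsGraphLike L) (v : H) :
    (WithLp.toLp 2 (polarG L v, polarF L v) : SympSpace H) ∈ L.1 := by
  obtain ⟨-, hd, hr⟩ := absOp_dres hL
  refine hd.induction_on (p := fun v => pairMap (polarG L) (polarF L) v ∈ L.1) v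
    (L.isClosed.preimage (pairMap (polarG L) (polarF L)).continuous) fun w => ?_
  have h : pairMap (polarG L) (polarF L) (polarG L w) =
      WithLp.toLp 2 (resBeta L w, resAlpha L w) := SympSpace.ext (hr w).1 (hr w).2
  rw [h]
  exact resBeta_resAlpha_mem L w

theorem polarG_injective (hL : IsGraphLike L) {v : H} (h : polarG L v = 0) : v = 0 := by
  have h1 := polar_mem hL v
  rw [h] at h1
  have h2 := (polar_relations hL v).1
  rwa [hL _ h1, h, map_zero, map_zero, zero_add, eq_comm] at h2

theorem norm_sq_polar (hL : IsGraphLike L) (v : H) :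
    ‖polarG L v‖ ^ 2 + ‖polarF L v‖ ^ 2 = ‖v‖ ^ 2 := by
  have h1 : ⟪polarG L v, polarG L v⟫_ℝ = ⟪v, polarG L (polarG L v)⟫_ℝ :=
    (isSelfAdjoint_polarG hL).isSymmetric _ _
  have h2 : ⟪polarF L v, polarF L v⟫_ℝ = ⟪v, polarF L (polarF L v)⟫_ℝ :=
    (isSelfAdjoint_polarF hL).isSymmetric _ _
  rw [← real_inner_self_eq_norm_sq, ← real_inner_self_eq_norm_sq, h1, h2, ← inner_add_right,
    add_comm, (polar_relations hL v).1, real_inner_self_eq_norm_sq]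

/-- The polar coordinates parametrize `L`, also after moving `polarG L` along the segment to the
identity. -/
theorem isLagPair_polar (hL : IsGraphLike L) {r : ℝ} (hr : r ∈ Icc (0 : ℝ) 1) :
    IsLagPair ((1 - r) • polarG L + r • 1) (polarF L) := by
  refine ⟨((IsSelfAdjoint.all (1 - r)).smul (isSelfAdjoint_polarG hL)).add
    ((IsSelfAdjoint.all r).smul (.one _)), isSelfAdjoint_polarF hL,
    ((commute_polar hL).smul_left _).add_left ((Commute.one_left _).smul_left _), 1 / 2,
    by norm_num, fun v => ?_⟩
  have h1 : ((1 - r) • polarG L + r • (1 : H →L[ℝ] H)) v = (1 - r) • polarG L v + r • v := rfl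
  have h2 := norm_sq_polar hL v
  have h3 := inner_polarG_nonneg hL v
  rw [h1, norm_add_sq_real, norm_smul, norm_smul, real_inner_smul_left, real_inner_smul_right,
    mul_pow, mul_pow, Real.norm_eq_abs, Real.norm_eq_abs, sq_abs, sq_abs]
  have h4 : 0 ≤ (1 - r) * (r * ⟪polarG L v, v⟫_ℝ) :=
    mul_nonneg (by linarith [hr.2]) (mul_nonneg hr.1 h3)
  have h5 : (1 - r) ^ 2 * ‖polarF L v‖ ^ 2 ≤ 1 * ‖polarF L v‖ ^ 2 :=
    mul_le_mul_of_nonneg_right (by nlinarith [hr.1, hr.2]) (sq_nonneg _)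
  have h6 : (1 - r) ^ 2 * (‖polarG L v‖ ^ 2 + ‖polarF L v‖ ^ 2) = (1 - r) ^ 2 * ‖v‖ ^ 2 := by
    rw [h2]
  have h7 : 0 ≤ (2 * r - 1) ^ 2 * ‖v‖ ^ 2 := by positivity
  nlinarith

theorem eq_pairLag_polar (hL : IsGraphLike L) : L = pairLag (polarG L) (polarF L) := by
  have h := isLagPair_polar hL (r := 0) (by simp)
  rw [sub_zero, one_smul, zero_smul, add_zero] at h
  refine Subtype.ext (IsLagrangian.eq_of_le (pairLag _ _).2 L.2 ?_).symm
  rw [h.coe_pairLag]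
  rintro _ ⟨v, rfl⟩
  exact polar_mem hL v

theorem mem_iff_polar (hL : IsGraphLike L) {z : SympSpace H} :
    z ∈ L.1 ↔ ∃ v, polarG L v = z.fst ∧ polarF L v = z.snd := by
  have h := isLagPair_polar hL (r := 0) (by simp)
  rw [sub_zero, one_smul, zero_smul, add_zero] at h
  constructor
  · intro hz
    rw [eq_pairLag_polar hL, h.coe_pairLag] at hz
    obtain ⟨v, rfl⟩ := hz
    exact ⟨v, rfl, rfl⟩
  · rintro ⟨v, h1, h2⟩
    have := polar_mem hL v
    rw [h1, h2] at this
    exact this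

end Polar

/-! ### Compact perturbations of invertible operators -/

section Fredholm

variable {E : Type*} [NormedAddCommGroup E] [InnerProductSpace ℝ E] [CompleteSpace E]

omit [CompleteSpace E] in
/-- On the kernel of a compact perturbation of an invertible operator the identity is compact. -/
theorem finiteDimensional_ker_of_isCompactOperator {T U : E →L[ℝ] E} (hU : IsUnit U)
    (hc : IsCompactOperator (T - U : E →L[ℝ] E)) : FiniteDimensional ℝ T.ker := by
  obtain ⟨V, hV⟩ := hU.exists_left_inv
  have h1 : IsCompactOperator (-(V * (T - U)) : E →L[ℝ] E) := (isCompactOperator_mul_left V hc).neg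
  have h2 : ∀ x ∈ T.ker, (-(V * (T - U)) : E →L[ℝ] E) x = x := by
    intro x hx
    have hx' : T x = 0 := hx
    change -(V (T x - U x)) = x
    rw [hx', zero_sub, map_neg, neg_neg]
    exact congrArg (fun W : E →L[ℝ] E => W x) hV
  have hV : ∀ x ∈ T.ker, ((-(V * (T - U)) : E →L[ℝ] E) : E →ₗ[ℝ] E) x ∈ T.ker := fun x hx =>
    (h2 x hx).symm ▸ hx
  have h3 := h1.restrict (f := ((-(V * (T - U)) : E →L[ℝ] E) : E →ₗ[ℝ] E)) hV T.isClosed_ker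
  have h4 : ⇑(((-(V * (T - U)) : E →L[ℝ] E) : E →ₗ[ℝ] E).restrict hV) = id :=
    funext fun x : T.ker => Subtype.ext (h2 x x.2)
  rw [h4] at h3
  exact FiniteDimensional.of_isCompactOperator_id (𝕜 := ℝ) h3

omit [CompleteSpace E] in
/-- An injective compact perturbation of an invertible operator is bounded below. -/
theorem exists_bound_of_isCompactOperator {T U : E →L[ℝ] E} (hU : IsUnit U)
    (hc : IsCompactOperator (T - U : E →L[ℝ] E)) (h0 : ∀ x, T x = 0 → x = 0) :
    ∃ K, AntilipschitzWith K T := by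
  obtain ⟨V, hV⟩ := hU.exists_left_inv
  obtain ⟨W, hW⟩ := hU.exists_right_inv
  have hVW : V = W := left_inv_eq_right_inv hV hW
  have h1 := isCompactOperator_mul_left V hc
  have e1 : V * (T - U) - (-1 : ℝ) • 1 = V * T := by
    rw [mul_sub, hV, neg_smul, one_smul, sub_neg_eq_add, sub_add_cancel]
  obtain ⟨K, hK⟩ := IsCompactOperator.antilipschitz_of_not_hasEigenvalue h1
    (neg_ne_zero.2 one_ne_zero) (fun hμ => by
      obtain ⟨x, hx⟩ := hμ.exists_hasEigenvector
      have h2 : (V * (T - U)) x = (-1 : ℝ) • x := hx.apply_eq_smul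
      have h3 : V (T x) = 0 := by
        have h4 : (V * (T - U) - (-1 : ℝ) • 1) x = 0 := by
          change (V * (T - U)) x - (-1 : ℝ) • x = 0
          rw [h2, sub_self]
        rwa [e1] at h4
      have h5 : T x = 0 := by
        have h6 : (U * V) (T x) = T x := by rw [hVW, hW]; rfl
        rw [← h6]
        change U (V (T x)) = 0
        rw [h3, map_zero]
      exact hx.2 (h0 x h5))
  rw [e1] at hK
  refine ⟨K * ‖V‖₊, AddMonoidHomClass.antilipschitz_of_bound T fun x => ?_⟩
  have h2 : ‖x‖ ≤ K * ‖V (T x)‖ := by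
    have := hK.le_mul_dist x 0
    rw [map_zero, dist_zero_right, dist_zero_right] at this
    exact this
  refine h2.trans ?_
  rw [NNReal.coe_mul, coe_nnnorm, mul_assoc]
  exact mul_le_mul_of_nonneg_left (V.le_opNorm _) K.2

/-- A self-adjoint compact perturbation of an invertible operator has closed range. -/
theorem isClosed_range_of_isCompactOperator {T U : E →L[ℝ] E} (hT : IsSelfAdjoint T)
    (hU : IsUnit U) (hc : IsCompactOperator (T - U : E →L[ℝ] E)) :
    IsClosed (range T) := by
  have hfd := finiteDimensional_ker_of_isCompactOperator hU hc
  -- adding the projector onto the kernel makes the operator injective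
  set p := T.ker.starProjection with hp
  have hpc : IsCompactOperator p := by
    have h1 : IsCompactOperator (id : T.ker → T.ker) :=
      isCompactOperator_id_iff_locallyCompactSpace.2 inferInstance
    exact (h1.comp_clm T.ker.orthogonalProjectionOnto).clm_comp T.ker.subtypeL
  have hperp : ∀ x, ∀ v ∈ T.ker, ⟪v, T x⟫_ℝ = 0 := by
    intro x v hv
    have h1 : ⟪T v, x⟫_ℝ = ⟪v, T x⟫_ℝ := hT.isSymmetric v x
    rw [← h1, show T v = 0 from hv, inner_zero_left]
  obtain ⟨K, hK⟩ := exists_bound_of_isCompactOperator (T := T + p) hU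
    (by rw [add_sub_right_comm]; exact hc.add hpc) (fun x hx => by
      have h1 : T x + p x = 0 := hx
      have hpx : p x ∈ T.ker := Submodule.starProjection_apply_mem _ x
      have h2 : ⟪p x, T x + p x⟫_ℝ = ‖p x‖ ^ 2 := by
        rw [inner_add_right, hperp x _ hpx, zero_add, real_inner_self_eq_norm_sq]
      rw [h1, inner_zero_right] at h2
      have h3 : p x = 0 := norm_eq_zero.1 (pow_eq_zero_iff two_ne_zero |>.1 h2.symm)
      rw [h3, add_zero] at h1
      rw [← Submodule.starProjection_eq_self_iff.2 (show x ∈ T.ker from h1)]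
      exact h3)
  have h1 : range T = (T + p) '' (T.kerᗮ : Set E) := by
    ext y
    constructor
    · rintro ⟨x, rfl⟩
      refine ⟨x - p x, Submodule.sub_starProjection_mem_orthogonal x, ?_⟩
      have h2 : p (x - p x) = 0 := (Submodule.starProjection_apply_eq_zero_iff _).2
        (Submodule.sub_starProjection_mem_orthogonal x)
      have h3 : T (p x) = 0 := Submodule.starProjection_apply_mem T.ker x
      change T (x - p x) + p (x - p x) = T x
      rw [h2, map_sub, h3, sub_zero, add_zero]
    · rintro ⟨x, hx, rfl⟩
      refine ⟨x, ?_⟩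
      change T x = T x + p x
      rw [(Submodule.starProjection_apply_eq_zero_iff _).2 hx, add_zero]
  rw [h1]
  exact (hK.isClosedEmbedding (T + p).uniformContinuous).isClosedMap _
    (Submodule.isClosed_orthogonal _)

end Fredholm

/-! ### Signs of invertible operators -/

section InvertibleSign

variable {E : Type*} [NormedAddCommGroup E] [InnerProductSpace ℝ E] [CompleteSpace E]

theorem exists_inner_absOp_ge {F : E →L[ℝ] E} (hF : IsSelfAdjoint F) (h : ‖F‖ ≤ 1) {c : ℝ}
    (hc : 0 < c) (hb : ∀ x, c * ‖x‖ ≤ ‖F x‖) (x : E) :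
    c ^ 2 / 2 * ‖x‖ ^ 2 ≤ ⟪absOp F x, x⟫_ℝ := by
  have h1 := (isPosContraction_absOp hF h).norm_sq_le x
  have h2 := pow_le_pow_left₀ (by positivity) (hb x) 2
  rw [norm_absOp_apply hF h] at h1
  rw [mul_pow] at h2
  linarith

theorem isUnit_of_inner_ge {T : E →L[ℝ] E} {c : ℝ} (hc : 0 < c)
    (h : ∀ x, c * ‖x‖ ^ 2 ≤ ⟪T x, x⟫_ℝ) : IsUnit T := by
  refine ContinuousLinearMap.isUnit_of_forall_le_norm_inner_map _ (c := ⟨c, hc.le⟩) hc fun x => ?_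
  rw [mul_comm]
  exact (h x).trans (Real.le_norm_self _)

/-- If `F` is bounded below and `F' - F` is compact, then so is the difference of the signs. The
difference `(sgn F' - sgn F) |F|` is compact, because the square roots `|F'|` and `|F|` have compact
difference, and `|F|` is invertible. -/
theorem isCompactOperator_signOp_sub_of_invertible {F F' : E →L[ℝ] E} (hF : IsSelfAdjoint F)
    (h : ‖F‖ ≤ 1) {c : ℝ} (hc : 0 < c) (hb : ∀ x, c * ‖x‖ ≤ ‖F x‖) (hF' : IsSelfAdjoint F')
    (h' : ‖F'‖ ≤ 1) (hcpt : IsCompactOperator (F' - F : E →L[ℝ] E)) :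
    IsCompactOperator (signOp F' - signOp F : E →L[ℝ] E) := by
  have h1 : IsCompactOperator (F' * F' - F * F : E →L[ℝ] E) := by
    have e : F' * F' - F * F = F' * (F' - F) + (F' - F) * F := by noncomm_ring
    rw [e]
    exact (isCompactOperator_mul_left _ hcpt).add (isCompactOperator_mul_right hcpt _)
  have h2 : IsCompactOperator (absOp F' - absOp F : E →L[ℝ] E) :=
    isCompactOperator_opSqrt_sub (norm_one_sub_mul_self_le hF' h') (norm_one_sub_mul_self_le hF h) h1
  obtain ⟨V, hV⟩ := (isUnit_of_inner_ge (by positivity)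
    (exists_inner_absOp_ge hF h hc hb)).exists_right_inv
  have e : signOp F' - signOp F =
      ((F' - F) - signOp F' * (absOp F' - absOp F)) * V := by
    have e1 : (F' - F) - signOp F' * (absOp F' - absOp F) =
        (signOp F' - signOp F) * absOp F := by
      rw [mul_sub, signOp_mul_absOp hF' h', sub_mul, signOp_mul_absOp hF h]
      abel
    rw [e1, mul_assoc, hV, mul_one]
  rw [e]
  exact isCompactOperator_mul_right (hcpt.sub (isCompactOperator_mul_left _ h2)) _

/-- The segment from an invertible operator to its sign consists of invertible operators. -/
theorem isUnit_segment_signOp {F : E →L[ℝ] E} (hF : IsSelfAdjoint F)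
    (h : ‖F‖ ≤ 1) {c : ℝ} (hc : 0 < c) (hb : ∀ x, c * ‖x‖ ≤ ‖F x‖) {s : ℝ}
    (hs : s ∈ Icc (0 : ℝ) 1) : IsUnit ((1 - s) • F + s • signOp F) := by
  have e : (1 - s) • F + s • signOp F = signOp F * ((1 - s) • absOp F + s • 1) := by
    rw [mul_add, mul_smul_comm, mul_smul_comm, signOp_mul_absOp hF h, mul_one]
  have h1 : IsUnit (signOp F) :=
    ⟨⟨signOp F, signOp F, signOp_mul_self, signOp_mul_self⟩, rfl⟩
  rw [e]
  refine h1.mul (isUnit_of_inner_ge (c := min (c ^ 2 / 2) 1) (by positivity) fun x => ?_)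
  have h2 := exists_inner_absOp_ge hF h hc hb x
  have h3 : ⟪((1 - s) • absOp F + s • (1 : E →L[ℝ] E)) x, x⟫_ℝ =
      (1 - s) * ⟪absOp F x, x⟫_ℝ + s * ‖x‖ ^ 2 := by
    change ⟪(1 - s) • absOp F x + s • x, x⟫_ℝ = _
    rw [inner_add_left, real_inner_smul_left, real_inner_smul_left, real_inner_self_eq_norm_sq]
  rw [h3]
  have h4 : min (c ^ 2 / 2) 1 * ‖x‖ ^ 2 ≤ ⟪absOp F x, x⟫_ℝ :=
    (mul_le_mul_of_nonneg_right (min_le_left _ _) (sq_nonneg _)).trans h2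
  have h5 : min (c ^ 2 / 2) 1 * ‖x‖ ^ 2 ≤ ‖x‖ ^ 2 :=
    (mul_le_mul_of_nonneg_right (min_le_right _ _) (sq_nonneg _)).trans_eq (one_mul _)
  have h6 := mul_le_mul_of_nonneg_left h4 (by linarith [hs.2] : (0 : ℝ) ≤ 1 - s)
  have h7 := mul_le_mul_of_nonneg_left h5 hs.1
  linarith

end InvertibleSign

/-! ### Spectral subspaces -/

section SpectralSubspaces

variable {H : Type*} [NormedAddCommGroup H] [InnerProductSpace ℝ H]

theorem starProjection_ker_sub_one {J : H →L[ℝ] H} (hs : ∀ x y, ⟪J x, y⟫_ℝ = ⟪x, J y⟫_ℝ)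
    (hJ : J * J = 1) [(J - 1).ker.HasOrthogonalProjection] :
    (J - 1).ker.starProjection = (1 / 2 : ℝ) • (1 + J) := by
  have hJ' : ∀ x, J (J x) = x := fun x => congrArg (fun T : H →L[ℝ] H => T x) hJ
  refine ContinuousLinearMap.ext fun x => ?_
  refine Submodule.eq_starProjection_of_mem_orthogonal ?_ fun m hm => ?_
  · change J ((1 / 2 : ℝ) • (x + J x)) - (1 / 2 : ℝ) • (x + J x) = 0
    rw [map_smul, map_add, hJ', add_comm, sub_self]
  · have hm' : J m = m := sub_eq_zero.1 hm
    change ⟪m, x - (1 / 2 : ℝ) • (x + J x)⟫_ℝ = 0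
    rw [inner_sub_right, real_inner_smul_right, inner_add_right, ← hs, hm']
    ring

theorem reduces_iff {M : Submodule ℝ H} [M.HasOrthogonalProjection] {A : H →ₗ.[ℝ] H} :
    Reduces M A ↔ ∀ z ∈ graphS A,
      (WithLp.toLp 2 (M.starProjection z.fst, M.starProjection z.snd) : SympSpace H) ∈ graphS A := by
  constructor
  · intro h z hz
    obtain ⟨x, hx, hx'⟩ := mem_graphS.1 hz
    obtain ⟨h1, h2⟩ := h x
    refine mem_graphS.2 ⟨⟨_, h1⟩, ?_, ?_⟩
    · change M.starProjection (x : H) = M.starProjection z.fst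
      rw [hx]
    · rw [h2, hx']; rfl
  · intro h x
    obtain ⟨y, hy, hy'⟩ := mem_graphS.1 (h (WithLp.toLp 2 ((x : H), A x))
      (mem_graphS.2 ⟨x, rfl, rfl⟩))
    have hy1 : (y : H) = M.starProjection (x : H) := hy
    have h1 : M.starProjection (x : H) ∈ A.domain := hy1 ▸ y.2
    refine ⟨h1, ?_⟩
    have h2 : (⟨M.starProjection (x : H), h1⟩ : A.domain) = y := Subtype.ext hy1.symm
    rw [h2, hy']; rfl

/-- The positive spectral subspace of an operator with graph `{(G v, F v)}` is the eigenspace of the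
sign `J` of `F` for the eigenvalue `1`. -/
theorem posSpectralSubspace_eq [CompleteSpace H] {A : H →ₗ.[ℝ] H} {G F J : H →L[ℝ] H}
    (hgr : ∀ z, z ∈ graphS A ↔ ∃ v, G v = z.fst ∧ F v = z.snd)
    (hG : ∀ v, G v = 0 → v = 0) (hs : IsSelfAdjoint J) (hJ : J * J = 1)
    (hJF : Commute J F) (hJG : Commute J G) (hpos : ∀ v, v ≠ 0 → 0 < ⟪J (F v), G v⟫_ℝ)
    (hcomm : ∀ T : H →L[ℝ] H, (∀ z ∈ graphS A,
      (WithLp.toLp 2 (T z.fst, T z.snd) : SympSpace H) ∈ graphS A) → Commute T J ∧ Commute T G) :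
    posSpectralSubspace A = (J - 1).ker := by
  have hp : (J - 1).ker.starProjection = (1 / 2 : ℝ) • (1 + J) :=
    starProjection_ker_sub_one hs.isSymmetric hJ
  have hJG' : ∀ v, J (G v) = G (J v) := fun v => congrArg (fun T : H →L[ℝ] H => T v) hJG.eq
  have hJF' : ∀ v, J (F v) = F (J v) := fun v => congrArg (fun T : H →L[ℝ] H => T v) hJF.eq
  have hJ' : ∀ x, J (J x) = x := fun x => congrArg (fun T : H →L[ℝ] H => T x) hJ
  refine le_antisymm (sSup_le ?_) (le_sSup ⟨inferInstance, ?_, ?_⟩)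
  · rintro M ⟨hM, hred, hMpos⟩ m hm
    obtain ⟨h1, h2⟩ := hcomm _ (reduces_iff.1 hred)
    have hT : ∀ x, x ∈ M ↔ M.starProjection x = x := fun x =>
      Submodule.starProjection_eq_self_iff.symm
    -- the component of `m` in the negative eigenspace
    set n := m - J m with hn
    have hnM : n ∈ M := by
      rw [hT, hn, map_sub, (hT m).1 hm]
      congr 1
      refine (congrArg (fun T : H →L[ℝ] H => T m) h1.eq).trans ?_
      change J (M.starProjection m) = J m
      rw [(hT m).1 hm]
    have hGn : G n ∈ M := by
      rw [hT]
      refine (congrArg (fun T : H →L[ℝ] H => T n) h2.eq).trans ?_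
      change G (M.starProjection n) = G n
      rw [(hT n).1 hnM]
    have hJn : J n = -n := by rw [hn, map_sub, hJ', neg_sub]
    obtain ⟨x, hx, hx'⟩ := mem_graphS.1 ((hgr (WithLp.toLp 2 (G n, F n))).2 ⟨n, rfl, rfl⟩)
    have hx1 : (x : H) = G n := hx
    have hx2 : A x = F n := hx'
    have hn0 : n = 0 := by
      by_contra hne
      have h3 := hMpos x (hx1 ▸ hGn) (hx1 ▸ fun h0 => hne (hG _ h0))
      have h4 := hpos n hne
      rw [hJF', hJn, map_neg, inner_neg_left] at h4
      rw [hx1, hx2] at h3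
      linarith
    exact sub_eq_zero.2 (sub_eq_zero.1 (hn ▸ hn0)).symm
  · rw [reduces_iff, hp]
    intro z hz
    obtain ⟨v, h1, h2⟩ := (hgr z).1 hz
    refine (hgr _).2 ⟨((1 / 2 : ℝ) • (1 + J)) v, ?_, ?_⟩
    · change G ((1 / 2 : ℝ) • (v + J v)) = (1 / 2 : ℝ) • (z.fst + J z.fst)
      rw [map_smul, map_add, ← hJG', h1]
    · change F ((1 / 2 : ℝ) • (v + J v)) = (1 / 2 : ℝ) • (z.snd + J z.snd)
      rw [map_smul, map_add, ← hJF', h2]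
  · intro x hx hx0
    obtain ⟨v, h1, h2⟩ := (hgr (WithLp.toLp 2 ((x : H), A x))).1 (mem_graphS.2 ⟨x, rfl, rfl⟩)
    simp only [WithLp.toLp_fst, WithLp.toLp_snd] at h1 h2
    have hv0 : v ≠ 0 := by
      rintro rfl
      exact hx0 (by rw [← h1, map_zero])
    have hJv : J v = v := by
      refine sub_eq_zero.1 (hG _ ?_)
      have h3 : J x = x := sub_eq_zero.1 hx
      rw [map_sub, ← hJG', h1, h3, sub_self]
    have h4 := hpos v hv0
    rwa [hJF', hJv, h2, h1] at h4

theorem mem_graphS_neg {A : H →ₗ.[ℝ] H} {z : SympSpace H} :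
    z ∈ graphS (-A) ↔ (WithLp.toLp 2 (z.fst, -z.snd) : SympSpace H) ∈ graphS A := by
  rw [mem_graphS, mem_graphS]
  refine exists_congr fun x => and_congr_right fun _ => ?_
  rw [LinearPMap.neg_apply, neg_eq_iff_eq_neg]
  rfl

end SpectralSubspaces

/-! ### The Maslov index of the segment between two symmetries -/

section ModelPath

theorem pairLag_eq_of_forall {H : Type*} [NormedAddCommGroup H] [InnerProductSpace ℝ H]
    [CompleteSpace H] {X Y : H →L[ℝ] H} {L : LagGr H} (h : IsLagPair X Y)
    (hv : ∀ v, (WithLp.toLp 2 (X v, Y v) : SympSpace H) ∈ L.1) : pairLag X Y = L := by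
  refine Subtype.ext (IsLagrangian.eq_of_le (pairLag _ _).2 L.2 ?_)
  rw [h.coe_pairLag]
  rintro _ ⟨v, rfl⟩
  exact hv v

section Rotation

variable {F : Type*} [NormedAddCommGroup F] [InnerProductSpace ℝ F]

theorem norm_apply_of_mul_self_eq_one [CompleteSpace F] {E : F →L[ℝ] F} (hE : IsSelfAdjoint E)
    (h1 : E * E = 1) (v : F) : ‖E v‖ = ‖v‖ := by
  have h2 : E (E v) = v := congrArg (fun T : F →L[ℝ] F => T v) h1
  have h3 : ⟪E v, E v⟫_ℝ = ⟪v, E (E v)⟫_ℝ := hE.isSymmetric _ _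
  rw [h2, real_inner_self_eq_norm_sq, real_inner_self_eq_norm_sq] at h3
  exact (sq_eq_sq₀ (norm_nonneg _) (norm_nonneg _)).1 h3

theorem isLagPair_one_left [CompleteSpace F] {T : F →L[ℝ] F} (hT : IsSelfAdjoint T) :
    IsLagPair 1 T :=
  ⟨.one _, hT, .one_left _, 1, one_pos, fun v => by
    rw [one_apply_eq_self, one_mul]; exact le_add_of_nonneg_right (sq_nonneg _)⟩

theorem isLagPair_rotation [CompleteSpace F] {E : F →L[ℝ] F} (hE : IsSelfAdjoint E)
    (h1 : E * E = 1) (β : ℝ) : IsLagPair (Real.cos β • 1) (Real.sin β • E) := by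
  refine ⟨IsSelfAdjoint.smul (.all _) (.one _), IsSelfAdjoint.smul (.all _) hE,
    ((Commute.one_left E).smul_left _).smul_right _, 1, one_pos, fun v => le_of_eq ?_⟩
  rw [smul_apply, smul_apply, norm_smul, norm_smul, norm_apply_of_mul_self_eq_one hE h1,
    one_apply_eq_self, mul_pow, mul_pow, ← add_mul, Real.norm_eq_abs, Real.norm_eq_abs, sq_abs,
    sq_abs, Real.cos_sq_add_sin_sq]

variable [FiniteDimensional ℝ F]

/-- The trace of a symmetry is the difference of the dimensions of its eigenspaces. -/
theorem trace_eq_finrank_sub {E : F →L[ℝ] F} (h1 : E * E = 1) :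
    LinearMap.trace ℝ F E.toLinearMap =
      (Module.finrank ℝ (E - 1).ker : ℝ) - Module.finrank ℝ (-E - 1).ker := by
  have hE : ∀ v, E (E v) = v := fun v => congrArg (fun T : F →L[ℝ] F => T v) h1
  have key : ∀ S : F →L[ℝ] F, (∀ v, S (S v) = v) →
      LinearMap.trace ℝ F ((1 / 2 : ℝ) • (1 + S.toLinearMap)) =
        (Module.finrank ℝ (S - 1).ker : ℝ) := by
    intro S hS
    refine LinearMap.IsProj.trace ⟨fun v => ?_, fun v hv => ?_⟩
    · change S ((1 / 2 : ℝ) • (v + S v)) - (1 / 2 : ℝ) • (v + S v) = 0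
      rw [map_smul, map_add, hS, add_comm, sub_self]
    · have hv' : S v = v := sub_eq_zero.1 hv
      change (1 / 2 : ℝ) • (v + S v) = v
      rw [hv', ← two_smul ℝ v, smul_smul]; norm_num
  rw [← key E hE, ← key (-E) fun v => by rw [neg_apply, neg_apply, map_neg, neg_neg, hE], ← map_sub]
  congr 1
  refine LinearMap.ext fun v => ?_
  change E v = (1 / 2 : ℝ) • (v + E v) - (1 / 2 : ℝ) • (v + -E v)
  module

/-- The value of `det²` at the rotation by the angle `β` of the graph of a symmetry: in an
eigenbasis of `E` the frame matrix is diagonal with the entries `exp (± i β)`. -/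
theorem dsq_rotation [CompleteSpace F] {E : F →L[ℝ] F} (hE : IsSelfAdjoint E) (h1 : E * E = 1)
    (β : ℝ) : dsq (pairLag (Real.cos β • 1) (Real.sin β • E)) =
      Complex.exp (((2 * β * ((Module.finrank ℝ (E - 1).ker : ℝ) -
        Module.finrank ℝ (-E - 1).ker) : ℝ) : ℂ) * Complex.I) := by
  have hs : E.toLinearMap.IsSymmetric := hE.isSymmetric
  set e := hs.eigenvectorBasis rfl with he
  set μ := hs.eigenvalues rfl with hμ
  have hEe : ∀ i, E (e i) = μ i • e i := fun i => hs.apply_eigenvectorBasis rfl i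
  have hμ1 : ∀ i, μ i = 1 ∨ μ i = -1 := by
    intro i
    have h2 : E (E (e i)) = e i := congrArg (fun T : F →L[ℝ] F => T (e i)) h1
    rw [hEe, map_smul, hEe, smul_smul] at h2
    have h3 : (μ i * μ i - 1) • e i = 0 := by rw [sub_smul, h2, one_smul, sub_self]
    rcases smul_eq_zero.1 h3 with h | h
    · exact mul_self_eq_one_iff.1 (sub_eq_zero.1 h)
    · exact absurd h (e.orthonormal.ne_zero i)
  let w : Fin (Module.finrank ℝ F) → SympSpace F := fun i =>
    pairMap (Real.cos β • 1) (Real.sin β • E) (e i)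
  have hw : ∀ i, w i ∈ (pairLag (Real.cos β • 1) (Real.sin β • E)).1 := fun i => by
    rw [(isLagPair_rotation hE h1 β).coe_pairLag]; exact ⟨e i, rfl⟩
  have hM : frameMatrix e w =
      Matrix.diagonal fun i => Complex.exp (((β * μ i : ℝ) : ℂ) * Complex.I) := by
    ext k j
    change (⟨⟪e k, Real.cos β • e j⟫_ℝ, ⟪e k, Real.sin β • E (e j)⟫_ℝ⟩ : ℂ) = _
    rw [hEe, inner_smul_right, inner_smul_right, inner_smul_right,
      orthonormal_iff_ite.1 e.orthonormal k j]
    rcases eq_or_ne k j with rfl | hkj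
    · rw [Matrix.diagonal_apply_eq, if_pos rfl, Complex.exp_mul_I, ← Complex.ofReal_cos,
        ← Complex.ofReal_sin]
      rcases hμ1 k with h | h <;> rw [h] <;> refine Complex.ext ?_ ?_ <;>
        simp [-Complex.ofReal_cos, -Complex.ofReal_sin]
    · rw [Matrix.diagonal_apply_ne _ hkj, if_neg hkj]
      refine Complex.ext ?_ ?_ <;> simp
  have hdet : (frameMatrix e w).det = Complex.exp (((β * ∑ i, μ i : ℝ) : ℂ) * Complex.I) := by
    rw [hM, Matrix.det_diagonal, ← Complex.exp_sum]
    congr 1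
    push_cast
    rw [Finset.mul_sum, Finset.sum_mul]
  rw [dsq_eq_of_frame e hw (by rw [hdet]; exact Complex.exp_ne_zero _), hdet,
    Complex.norm_exp_ofReal_mul_I, one_pow, Complex.ofReal_one, div_one, ← Complex.exp_nat_mul]
  congr 1
  have ht : LinearMap.trace ℝ F E.toLinearMap = ∑ i, μ i := hs.trace_eq_sum_eigenvalues rfl
  rw [← trace_eq_finrank_sub h1, ht]
  push_cast
  ring

/-- The path of graphs of `c E`, with `c` increasing from `-1` to `1`, is closed up by rotation. -/
theorem hasRelMaslovIndex_symmetry [CompleteSpace F] {E : F →L[ℝ] F} (hE : IsSelfAdjoint E)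
    (h1 : E * E = 1) {l : ℝ → LagGr F} {a b : ℝ} (hab : a < b)
    (hl : ∀ t ∈ Icc a b, l t = pairLag 1 ((2 * ((t - a) / (b - a)) - 1) • E)) :
    HasRelMaslovIndex (horizontal (⊤ : Submodule ℝ F)) l a b
      ((Module.finrank ℝ (E - 1).ker : ℤ) - Module.finrank ℝ (-E - 1).ker) := by
  have hba : b - a ≠ 0 := (sub_pos.2 hab).ne'
  set β : ℝ → ℝ := fun t => Real.arctan (2 * ((min t b - a) / (b - a)) - 1) +
    Real.pi / 2 * max (t - b) 0 with hβ
  have hβc : Continuous β := by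
    refine Continuous.add (Real.continuous_arctan.comp ?_) (by fun_prop)
    fun_prop
  have hβ1 : ∀ t ∈ Icc a b, β t = Real.arctan (2 * ((t - a) / (b - a)) - 1) := fun t ht => by
    simp only [hβ]
    rw [min_eq_left ht.2, max_eq_right (sub_nonpos.2 ht.2), mul_zero, add_zero]
  have hβ2 : ∀ t ∈ Icc b (b + 1), β t = Real.pi / 4 + Real.pi / 2 * (t - b) := fun t ht => by
    simp only [hβ]
    rw [min_eq_right ht.1, max_eq_left (sub_nonneg.2 ht.1), div_self hba]
    norm_num
  have hβa : β a = -(Real.pi / 4) := by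
    rw [hβ1 a (left_mem_Icc.2 hab.le), sub_self, zero_div, mul_zero, zero_sub, Real.arctan_neg,
      Real.arctan_one]
  have hβb : β (b + 1) = Real.pi / 4 + Real.pi / 2 := by
    rw [hβ2 _ ⟨by linarith, le_rfl⟩]; ring
  have hT : ∀ t, IsLagPair 1 ((2 * ((t - a) / (b - a)) - 1) • E) := fun t =>
    isLagPair_one_left (IsSelfAdjoint.smul (.all _) hE)
  have heq : ∀ t ∈ Icc a b,
      pairLag (Real.cos (β t) • 1) (Real.sin (β t) • E) = l t := fun t ht => by
    rw [hl t ht]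
    refine pairLag_eq_of_forall (isLagPair_rotation hE h1 _) fun v => ?_
    rw [(hT t).coe_pairLag]
    refine ⟨Real.cos (β t) • v, SympSpace.ext rfl ?_⟩
    have h2 : 2 * ((t - a) / (b - a)) - 1 = Real.sin (β t) / Real.cos (β t) := by
      rw [← Real.tan_eq_sin_div_cos, hβ1 t ht, Real.tan_arctan]
    have h3 : Real.cos (β t) ≠ 0 := by rw [hβ1 t ht]; exact (Real.cos_arctan_pos _).ne'
    change (2 * ((t - a) / (b - a)) - 1) • E (Real.cos (β t) • v) = Real.sin (β t) • E v
    rw [map_smul, smul_smul, h2, div_mul_cancel₀ _ h3]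
  refine ⟨fun t => pairLag (Real.cos (β t) • 1) (Real.sin (β t) • E), ?_, heq, ?_, ?_, fun t => _,
    fun t _ => isDetSq_dsq _, fun t => 2 * β t * ((Module.finrank ℝ (E - 1).ker : ℝ) -
        Module.finrank ℝ (-E - 1).ker), ?_, fun t _ => dsq_rotation hE h1 _, ?_⟩
  · exact continuousOn_pairLag
      ((Real.continuous_cos.comp hβc).smul continuous_const).continuousOn
      ((Real.continuous_sin.comp hβc).smul continuous_const).continuousOn
      fun t _ => isLagPair_rotation hE h1 _
  · intro t ht
    refine (isLagPair_rotation hE h1 (β t)).isTransverse fun v hv => ?_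
    have h2 : 0 < Real.sin (β t) := by
      rw [hβ2 t ht]
      have := Real.pi_pos
      refine Real.sin_pos_of_pos_of_lt_pi ?_ ?_ <;> nlinarith [ht.1, ht.2]
    have h3 : Real.sin (β t) • E v = 0 := hv
    rw [← norm_eq_zero, ← norm_apply_of_mul_self_eq_one hE h1, norm_eq_zero]
    exact (smul_eq_zero.1 h3).resolve_left h2.ne'
  · -- rotation by the angle `π` is multiplication by `-1`
    rw [← heq a (left_mem_Icc.2 hab.le)]
    refine pairLag_eq_of_forall (isLagPair_rotation hE h1 _) fun v => ?_
    rw [(isLagPair_rotation hE h1 _).coe_pairLag]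
    have h2 : β (b + 1) = β a + Real.pi := by rw [hβa, hβb]; ring
    refine ⟨-v, SympSpace.ext ?_ ?_⟩
    · change Real.cos (β a) • -v = Real.cos (β (b + 1)) • v
      rw [h2, Real.cos_add_pi, smul_neg, neg_smul]
    · change Real.sin (β a) • E (-v) = Real.sin (β (b + 1)) • E v
      rw [h2, Real.sin_add_pi, map_neg, smul_neg, neg_smul]
  · exact ((continuous_const.mul hβc).mul continuous_const).continuousOn
  · simp only [hβa, hβb]
    push_cast
    ring

end Rotation

variable {H : Type*} [NormedAddCommGroup H] [InnerProductSpace ℝ H] [CompleteSpace H]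
  {J J' : H →L[ℝ] H}

omit [CompleteSpace H] in
/-- A zero of a convex combination of symmetries occurs at the midpoint, for reasons of norm. -/
theorem add_apply_eq_zero_of_segment (hJ : ∀ v, ‖J v‖ = ‖v‖) (hJ' : ∀ v, ‖J' v‖ = ‖v‖) {u : ℝ}
    (hu : u ∈ Icc (0 : ℝ) 1) {v : H} (h : (1 - u) • J v + u • J' v = 0) : J v + J' v = 0 := by
  have h1 : ‖(1 - u) • J v‖ = ‖u • J' v‖ := by rw [eq_neg_of_add_eq_zero_left h, norm_neg]
  rw [norm_smul, norm_smul, hJ, hJ', Real.norm_of_nonneg (sub_nonneg.2 hu.2),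
    Real.norm_of_nonneg hu.1] at h1
  rcases eq_or_ne v 0 with rfl | hv
  · simp
  · have h2 : 1 - u = u := mul_right_cancel₀ (norm_ne_zero_iff.2 hv) h1
    rw [h2, ← smul_add] at h
    refine (smul_eq_zero.1 h).resolve_left fun h0 => ?_
    rw [h0] at h2
    norm_num at h2

theorem isCleanFor_pairLag {X Y : H →L[ℝ] H} (h : IsLagPair X Y) {F : Submodule ℝ H}
    [FiniteDimensional ℝ F] (h1 : ∀ v, Y v = 0 → X v ∈ F) (h2 : IsClosed (range Y)) :
    IsCleanFor F (pairLag X Y) := by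
  have e : WithLp.snd '' ((pairLag X Y).1 : Set (SympSpace H)) = range Y := by
    rw [h.coe_pairLag]
    ext y
    constructor
    · rintro ⟨_, ⟨v, rfl⟩, rfl⟩
      exact ⟨v, rfl⟩
    · rintro ⟨v, rfl⟩
      exact ⟨_, ⟨v, rfl⟩, rfl⟩
  refine isCleanFor_of_le ?_ (e ▸ h2)
  rw [h.coe_pairLag]
  rintro _ ⟨v, rfl⟩ hv
  exact h1 v hv

omit [CompleteSpace H] in
/-- On `F = ker (S + S')` the operators `S'` and `-S` agree, so that the fixed vectors of the
restriction `E` are the common fixed vectors of `-S` and `S'`. -/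
theorem map_subtype_ker_sub_one {S S' : H →L[ℝ] H} {F : Submodule ℝ H}
    (hF : ∀ v, v ∈ F ↔ S v + S' v = 0) {E : F →L[ℝ] F} (hE : ∀ v : F, (E v : H) = S' v) :
    (E - 1).ker.map F.subtype = (-S - 1).ker ⊓ (S' - 1).ker := by
  ext v
  constructor
  · rintro ⟨w, hw, rfl⟩
    have h1 : E w = w := sub_eq_zero.1 hw
    have h2 : S' (w : H) = w := by rw [← hE, h1]
    have h3 := (hF _).1 w.2
    refine ⟨?_, ?_⟩
    · change -S (w : H) - (w : H) = 0
      rw [eq_neg_of_add_eq_zero_left h3, neg_neg, h2, sub_self]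
    · change S' (w : H) - (w : H) = 0
      rw [h2, sub_self]
  · rintro ⟨h1, h2⟩
    have h1' : -S v = v := sub_eq_zero.1 h1
    have h2' : S' v = v := sub_eq_zero.1 h2
    have h3 : v ∈ F := (hF v).2 (by rw [h2', neg_eq_iff_eq_neg.1 h1', neg_add_cancel])
    refine ⟨⟨v, h3⟩, ?_, rfl⟩
    change E ⟨v, h3⟩ - ⟨v, h3⟩ = 0
    rw [sub_eq_zero]
    exact Subtype.ext ((hE _).trans h2')

/-- The segment from `J` to `J'`, traversed during `[a, b]`. -/
def segment (J J' : H →L[ℝ] H) (a b t : ℝ) : H →L[ℝ] H :=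
  (1 - (t - a) / (b - a)) • J + ((t - a) / (b - a)) • J'

omit [CompleteSpace H] in
theorem continuous_segment (a b : ℝ) : Continuous (segment J J' a b) :=
  ((continuous_const.sub ((continuous_id.sub continuous_const).div_const _)).smul
    continuous_const).add
    (((continuous_id.sub continuous_const).div_const _).smul continuous_const)

theorem isSelfAdjoint_segment (hJ : IsSelfAdjoint J) (hJ' : IsSelfAdjoint J') (a b t : ℝ) :
    IsSelfAdjoint (segment J J' a b t) :=
  (IsSelfAdjoint.smul (.all _) hJ).add (IsSelfAdjoint.smul (.all _) hJ')

omit [CompleteSpace H] in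
theorem segment_left (a b : ℝ) : segment J J' a b a = J := by
  rw [segment, sub_self, zero_div, sub_zero, one_smul, zero_smul, add_zero]

omit [CompleteSpace H] in
theorem segment_right {a b : ℝ} (hab : a < b) : segment J J' a b b = J' := by
  rw [segment, div_self (sub_pos.2 hab).ne', sub_self, zero_smul, one_smul, zero_add]

omit [CompleteSpace H] in
theorem isCompactOperator_segment_sub (hc : IsCompactOperator (J' - J : H →L[ℝ] H)) (a b t : ℝ) :
    IsCompactOperator (segment J J' a b t - J : H →L[ℝ] H) := by
  have e : segment J J' a b t - J = ((t - a) / (b - a)) • (J' - J) := by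
    rw [segment]; module
  rw [e]
  exact hc.smul _

theorem isUnit_of_mul_self_eq_one {M : Type*} [Monoid M] {x : M} (h : x * x = 1) : IsUnit x :=
  ⟨⟨x, x, h, h⟩, rfl⟩

/-- If the symmetries `J` and `J'` differ by a compact operator, then the path of graphs of the
convex combinations of `J` and `J'` has Maslov index
`dim (ker (J + 1) ∩ ker (J' - 1)) - dim (ker (J' + 1) ∩ ker (J - 1))`. The kernel `F` of `J + J'`
reduces the path to the multiples of the symmetry `J'|F = -J|F`. -/
theorem genMaslovIndex_segment (hJ : IsSelfAdjoint J) (hJ1 : J * J = 1) (hJ' : IsSelfAdjoint J')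
    (hJ1' : J' * J' = 1) (hc : IsCompactOperator (J' - J : H →L[ℝ] H)) {a b : ℝ} (hab : a < b) :
    FiniteDimensional ℝ ↥((-J - 1).ker ⊓ (J' - 1).ker) ∧
    FiniteDimensional ℝ ↥((-J' - 1).ker ⊓ (J - 1).ker) ∧
    genMaslovIndex (fun t => pairLag 1 (segment J J' a b t)) a b =
      (Module.finrank ℝ ↥((-J - 1).ker ⊓ (J' - 1).ker) : ℤ) -
        Module.finrank ℝ ↥((-J' - 1).ker ⊓ (J - 1).ker) := by
  have hn := norm_apply_of_mul_self_eq_one hJ hJ1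
  have hn' := norm_apply_of_mul_self_eq_one hJ' hJ1'
  set F : Submodule ℝ H := (J + J').ker with hF
  have hFm : ∀ v, v ∈ F ↔ J v + J' v = 0 := fun v => Iff.rfl
  have hFm' : ∀ v, v ∈ F ↔ J' v + J v = 0 := fun v => by rw [hFm, add_comm]
  have hFd : FiniteDimensional ℝ F := by
    have h2 : IsUnit ((2 : ℝ) • J) := by
      refine ⟨⟨(2 : ℝ) • J, (1 / 2 : ℝ) • J, ?_, ?_⟩, rfl⟩ <;>
      · rw [smul_mul_smul_comm, hJ1]; norm_num
    refine finiteDimensional_ker_of_isCompactOperator h2 ?_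
    have e : J + J' - (2 : ℝ) • J = J' - J := by module
    rw [e]
    exact hc
  have hFJ : ∀ v ∈ F, J' v ∈ F := fun v hv => by
    have h1 : J v = -J' v := eq_neg_of_add_eq_zero_left ((hFm v).1 hv)
    have h2 : J (J v) = v := congrArg (fun T : H →L[ℝ] H => T v) hJ1
    have h3 : J' (J' v) = v := congrArg (fun T : H →L[ℝ] H => T v) hJ1'
    rw [hFm, h3, ← neg_neg (J' v), ← h1, map_neg, h2, neg_add_cancel]
  let E : F →L[ℝ] F := J'.restrict hFJ
  have hEv : ∀ v : F, (E v : H) = J' v := fun v => rfl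
  have hE : IsSelfAdjoint E := by
    rw [ContinuousLinearMap.isSelfAdjoint_iff_isSymmetric]
    exact fun v w => hJ'.isSymmetric (v : H) (w : H)
  have hE1 : E * E = 1 := ContinuousLinearMap.ext fun v => Subtype.ext
    (congrArg (fun T : H →L[ℝ] H => T v) hJ1')
  have hN1 : (E - 1).ker.map F.subtype = (-J - 1).ker ⊓ (J' - 1).ker :=
    map_subtype_ker_sub_one hFm hEv
  have hN2 : (-E - 1).ker.map F.subtype = (-J' - 1).ker ⊓ (J - 1).ker :=
    map_subtype_ker_sub_one hFm' fun v => by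
      rw [eq_neg_of_add_eq_zero_left ((hFm v).1 v.2)]; rfl
  rw [← hN1, ← hN2, Submodule.finrank_map_subtype_eq, Submodule.finrank_map_subtype_eq]
  refine ⟨inferInstance, inferInstance, ?_⟩
  set L : ℝ → LagGr H := fun t => pairLag 1 (segment J J' a b t) with hL
  have hpair : ∀ t, IsLagPair 1 (segment J J' a b t) := fun t =>
    isLagPair_one_left (isSelfAdjoint_segment hJ hJ' a b t)
  have hclean : ∀ t ∈ Icc a b, IsCleanFor F (L t) := fun t ht => by
    refine isCleanFor_pairLag (hpair t) (fun v hv => ?_)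
      (isClosed_range_of_isCompactOperator (isSelfAdjoint_segment hJ hJ' a b t)
        (isUnit_of_mul_self_eq_one hJ1) (isCompactOperator_segment_sub hc a b t))
    exact add_apply_eq_zero_of_segment hn hn'
      ⟨div_nonneg (sub_nonneg.2 ht.1) (sub_pos.2 hab).le,
        div_le_one_of_le₀ (by linarith [ht.2]) (sub_pos.2 hab).le⟩ hv
  have hadm : IsAdmissiblePath L a b := by
    refine ⟨continuousOn_pairLag continuousOn_const (continuous_segment a b).continuousOn
      fun t _ => hpair t, fun t ht => ⟨F, hFd, hclean t ht⟩,
      (hpair a).isTransverse fun v hv => ?_, (hpair b).isTransverse fun v hv => ?_⟩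
    · rwa [segment_left, ← norm_eq_zero, hn, norm_eq_zero] at hv
    · rwa [segment_right hab, ← norm_eq_zero, hn', norm_eq_zero] at hv
  refine ((hasGenMaslovIndex_iff_eq hab.le hadm _).1
    ((hasGenMaslovIndex_iff_redFor hab.le hadm hclean).2
      (hasRelMaslovIndex_symmetry hE hE1 hab fun t ht => ?_))).symm
  refine (pairLag_eq_of_forall (isLagPair_one_left (IsSelfAdjoint.smul (.all _) hE))
    fun v => ?_).symm
  rw [(hclean t ht).redLag_coe, (hpair t).coe_pairLag]
  refine ⟨v, ⟨v, SympSpace.ext rfl ?_⟩, fun f => rfl⟩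
  change (1 - (t - a) / (b - a)) • J v + ((t - a) / (b - a)) • J' v =
    (2 * ((t - a) / (b - a)) - 1) • J' v
  rw [eq_neg_of_add_eq_zero_left ((hFm v).1 v.2)]
  module

end ModelPath

/-! ### Compact perturbations -/

section CompactPerturbation

variable {H : Type*} [NormedAddCommGroup H] [InnerProductSpace ℝ H] [CompleteSpace H]

section Polar

variable {L : LagGr H}

theorem norm_polarF_le (hL : IsGraphLike L) : ‖polarF L‖ ≤ 1 :=
  ContinuousLinearMap.opNorm_le_bound _ zero_le_one fun v => by
    rw [one_mul]
    exact le_of_sq_le_sq (by nlinarith [norm_sq_polar hL v, sq_nonneg ‖polarG L v‖]) (norm_nonneg _)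

theorem norm_polarG_le (hL : IsGraphLike L) : ‖polarG L‖ ≤ 1 :=
  ContinuousLinearMap.opNorm_le_bound _ zero_le_one fun v => by
    rw [one_mul]
    exact le_of_sq_le_sq (by nlinarith [norm_sq_polar hL v, sq_nonneg ‖polarF L v‖]) (norm_nonneg _)

theorem polarF_injective (hL : IsGraphLike L) (h0 : IsTransverse L) {v : H}
    (h : polarF L v = 0) : v = 0 :=
  polarG_injective hL (isTransverse_iff.1 h0 _ (polar_mem hL v) h)

/-- If `L` is the graph of an injective operator `A` with closed range, then
`A (1 + A ^ 2) ^ (-1 / 2)` has the same range and is bounded below. -/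
theorem exists_bound_polarF (hL : IsGraphLike L) (h0 : IsTransverse L)
    (h : IsClosed (WithLp.snd '' (L.1 : Set (SympSpace H)))) :
    ∃ c > 0, ∀ v, c * ‖v‖ ≤ ‖polarF L v‖ := by
  have e : WithLp.snd '' (L.1 : Set (SympSpace H)) = range (polarF L) := by
    ext y
    constructor
    · rintro ⟨z, hz, rfl⟩
      obtain ⟨v, -, hv⟩ := (mem_iff_polar hL).1 hz
      exact ⟨v, hv⟩
    · rintro ⟨v, rfl⟩
      exact ⟨_, polar_mem hL v, rfl⟩
  have hinj : Function.Injective (polarF L) :=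
    (injective_iff_map_eq_zero _).2 fun v hv => polarF_injective hL h0 hv
  obtain ⟨k, hk⟩ := (polarF L).antilipschitz_of_injective_of_isClosed_range hinj (e ▸ h)
  refine ⟨1 / ((k : ℝ) + 1), by positivity, fun v => ?_⟩
  have h1 := hk.le_mul_norm (map_zero (polarF L)) v
  rw [div_mul_eq_mul_div, one_mul, div_le_iff₀ (by positivity)]
  nlinarith [norm_nonneg (polarF L v)]

/-- If `L` is the graph of an injective operator `A`, this says that `⟪|A| x, x⟫` is positive for
all nonzero `x = polarG L v` in the domain of `A`. The square root of `polarG L` symmetrizes the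
form. -/
theorem inner_signOp_polarF_pos (hL : IsGraphLike L) (h0 : IsTransverse L) {v : H} (hv : v ≠ 0) :
    0 < ⟪signOp (polarF L) (polarF L v), polarG L v⟫_ℝ := by
  have hF := isSelfAdjoint_polarF hL
  have hn := norm_polarF_le hL
  have hG : IsPosContraction (polarG L) :=
    ⟨isSelfAdjoint_polarG hL, inner_polarG_nonneg hL, norm_polarG_le hL⟩
  have hP : ‖1 - polarG L‖ ≤ 1 := by
    refine ContinuousLinearMap.opNorm_le_bound _ zero_le_one fun x => ?_
    rw [one_mul]
    refine le_of_sq_le_sq ?_ (norm_nonneg _)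
    rw [sub_apply, one_apply_eq_self, norm_sub_sq_real, real_inner_comm]
    linarith [hG.norm_sq_le x]
  set S := absOp (polarF L) with hS
  set g := opSqrt (polarG L) with hg
  have hSG : Commute S (polarG L) :=
    (commute_absOp hF hn ((commute_polar hL).mul_right (commute_polar hL))).symm
  have hSg : ∀ x, S (g x) = g (S x) := fun x =>
    congrArg (fun T : H →L[ℝ] H => T x) (commute_opSqrt hP hSG).eq
  have hgg : ∀ x, g (g x) = polarG L x := fun x =>
    congrArg (fun T : H →L[ℝ] H => T x) (opSqrt_mul_self hP)
  have e1 : signOp (polarF L) (polarF L v) = S v :=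
    congrArg (fun T : H →L[ℝ] H => T v) (signOp_mul hF hn)
  have e2 : ⟪g (S v), g v⟫_ℝ = ⟪S v, g (g v)⟫_ℝ :=
    (isSelfAdjoint_opSqrt hP (isSelfAdjoint_polarG hL)).isSymmetric _ _
  rw [e1, ← hgg, ← e2, ← hSg]
  have h1 := (isPosContraction_absOp hF hn).norm_sq_le (g v)
  have h2 : 0 < ‖S (g v)‖ := norm_pos_iff.2 fun h => hv <| by
    have h3 := polarF_injective hL h0 ((absOp_eq_zero_iff hF hn).1 h)
    exact polarG_injective hL (by rw [← hgg, h3, map_zero])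
  rw [← hS] at h1
  nlinarith [sq_pos_of_pos h2]

theorem commute_signOp_polarF (hL : IsGraphLike L) (h0 : IsTransverse L) {T : H →L[ℝ] H}
    (hT : Commute T (polarF L)) : Commute T (signOp (polarF L)) :=
  commute_signOp (isSelfAdjoint_polarF hL) (norm_polarF_le hL)
    (fun _ hx => polarF_injective hL h0 hx) hT

theorem posSpectralSubspace_eq_of_polar {A : H →ₗ.[ℝ] H} (hA : L.1 = graphS A)
    (hL : IsGraphLike L) (h0 : IsTransverse L) :
    posSpectralSubspace A = (signOp (polarF L) - 1).ker := by
  refine posSpectralSubspace_eq (G := polarG L) (F := polarF L)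
    (fun z => by rw [← hA]; exact mem_iff_polar hL)
    (fun v hv => polarG_injective hL hv) isSelfAdjoint_signOp signOp_mul_self
    (commute_signOp_polarF hL h0 (Commute.refl _)).symm
    (commute_signOp_polarF hL h0 (commute_polar hL)).symm
    (fun v hv => inner_signOp_polarF_pos hL h0 hv) fun T hT => ?_
  rw [← hA] at hT
  obtain ⟨h1, h2⟩ := commute_polar_of_preserves hL hT
  exact ⟨commute_signOp_polarF hL h0 h1, h2⟩

theorem negSpectralSubspace_eq_of_polar {A : H →ₗ.[ℝ] H} (hA : L.1 = graphS A)
    (hL : IsGraphLike L) (h0 : IsTransverse L) :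
    negSpectralSubspace A = (-signOp (polarF L) - 1).ker := by
  have hgr : ∀ z : SympSpace H, z ∈ graphS (-A) ↔
      (WithLp.toLp 2 (z.fst, -z.snd) : SympSpace H) ∈ L.1 := fun z => by
    rw [hA]; exact mem_graphS_neg
  refine posSpectralSubspace_eq (G := polarG L) (F := -polarF L) (fun z => ?_)
    (fun v hv => polarG_injective hL hv) isSelfAdjoint_signOp.neg
    (by rw [neg_mul_neg, signOp_mul_self])
    (commute_signOp_polarF hL h0 (Commute.refl _)).symm.neg_left.neg_right
    (commute_signOp_polarF hL h0 (commute_polar hL)).symm.neg_left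
    (fun v hv => ?_) fun T hT => ?_
  · rw [hgr, mem_iff_polar hL]
    refine exists_congr fun v => and_congr_right fun _ => ?_
    rw [neg_apply, neg_eq_iff_eq_neg]
    rfl
  · have h1 : (-signOp (polarF L)) ((-polarF L) v) = signOp (polarF L) (polarF L v) := by
      rw [neg_apply, neg_apply, map_neg, neg_neg]
    rw [h1]
    exact inner_signOp_polarF_pos hL h0 hv
  · obtain ⟨h1, h2⟩ := commute_polar_of_preserves hL (T := T) fun z hz => by
      have h3 := (hgr _).1 (hT (WithLp.toLp 2 (z.fst, -z.snd)) ((hgr _).2 (by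
        convert hz using 1; exact SympSpace.ext rfl (neg_neg _))))
      simpa using h3
    exact ⟨(commute_signOp_polarF hL h0 h1).neg_right, h2⟩

end Polar

/-- If the second components are compact perturbations of an invertible operator, they have
finite-dimensional kernel and closed range, so that all intersections can be made clean. -/
theorem isAdmissiblePath_pairLag {X Y : ℝ → H →L[ℝ] H} {a b : ℝ}
    (hX : ContinuousOn X (Icc a b)) (hY : ContinuousOn Y (Icc a b))
    (h : ∀ t ∈ Icc a b, IsLagPair (X t) (Y t)) {U : H →L[ℝ] H} (hU : IsUnit U)
    (hc : ∀ t ∈ Icc a b, IsCompactOperator (Y t - U : H →L[ℝ] H)) (hab : a ≤ b)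
    (ha : ∀ v, Y a v = 0 → v = 0) (hb : ∀ v, Y b v = 0 → v = 0) :
    IsAdmissiblePath (fun t => pairLag (X t) (Y t)) a b := by
  refine ⟨continuousOn_pairLag hX hY h, fun t ht => ?_, (h a (left_mem_Icc.2 hab)).isTransverse ha,
    (h b (right_mem_Icc.2 hab)).isTransverse hb⟩
  have := finiteDimensional_ker_of_isCompactOperator hU (hc t ht)
  exact ⟨(Y t).ker.map (X t).toLinearMap, inferInstance, isCleanFor_pairLag (h t ht)
    (fun v hv => ⟨v, hv, rfl⟩)
    (isClosed_range_of_isCompactOperator (h t ht).selfAdjoint_snd hU (hc t ht))⟩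

omit [CompleteSpace H] in
theorem eq_zero_of_isUnit {U : H →L[ℝ] H} (hU : IsUnit U) (v : H) (h : U v = 0) : v = 0 := by
  obtain ⟨V, hV⟩ := hU.exists_left_inv
  have h1 : V (U v) = v := congrArg (fun T : H →L[ℝ] H => T v) hV
  rw [← h1, h, map_zero]

section Deformation

variable {F G : ℝ → H →L[ℝ] H} {a b : ℝ}

/-- Deformation of the path of graphs of `F t (G t)⁻¹` to the segment between the signs of its end
points. -/
theorem genMaslovIndex_eq_segment (hab : a < b) (hF : ContinuousOn F (Icc a b))
    (hG : ContinuousOn G (Icc a b))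
    (hFs : ∀ t ∈ Icc a b, IsSelfAdjoint (F t)) (hFn : ∀ t ∈ Icc a b, ‖F t‖ ≤ 1)
    (hpair : ∀ r ∈ Icc (0 : ℝ) 1, ∀ t ∈ Icc a b, IsLagPair ((1 - r) • G t + r • 1) (F t))
    (hc : ∀ t ∈ Icc a b, IsCompactOperator (F t - F a : H →L[ℝ] H))
    (ha : ∃ c > 0, ∀ v, c * ‖v‖ ≤ ‖F a v‖) (hb : ∃ c > 0, ∀ v, c * ‖v‖ ≤ ‖F b v‖) :
    genMaslovIndex (fun t => pairLag (G t) (F t)) a b =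
      genMaslovIndex (fun t => pairLag 1 (segment (signOp (F a)) (signOp (F b)) a b t)) a b := by
  obtain ⟨c, hc0, hca⟩ := ha
  obtain ⟨c', hc0', hcb⟩ := hb
  have hma := left_mem_Icc.2 hab.le
  have hmb := right_mem_Icc.2 hab.le
  have hU : ∀ s ∈ Icc (0 : ℝ) 1, IsUnit ((1 - s) • F a + s • signOp (F a)) := fun s hs =>
    isUnit_segment_signOp (hFs a hma) (hFn a hma) hc0 hca hs
  have hU' : ∀ s ∈ Icc (0 : ℝ) 1, IsUnit ((1 - s) • F b + s • signOp (F b)) := fun s hs =>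
    isUnit_segment_signOp (hFs b hmb) (hFn b hmb) hc0' hcb hs
  have hJ : IsCompactOperator (signOp (F b) - signOp (F a) : H →L[ℝ] H) :=
    isCompactOperator_signOp_sub_of_invertible (hFs a hma) (hFn a hma) hc0 hca (hFs b hmb)
      (hFn b hmb) (hc b hmb)
  set T := segment (signOp (F a)) (signOp (F b)) a b with hT
  have hF2 : ContinuousOn (fun p : ℝ × ℝ => F p.2) (Icc 0 1 ×ˢ Icc a b) :=
    hF.comp (f := fun p : ℝ × ℝ => p.2) continuous_snd.continuousOn fun p hp => hp.2
  have hG2 : ContinuousOn (fun p : ℝ × ℝ => G p.2) (Icc 0 1 ×ˢ Icc a b) :=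
    hG.comp (f := fun p : ℝ × ℝ => p.2) continuous_snd.continuousOn fun p hp => hp.2
  -- first replace `G` by the identity
  have hX : ContinuousOn (fun p : ℝ × ℝ => (1 - p.1) • G p.2 + p.1 • (1 : H →L[ℝ] H))
      (Icc 0 1 ×ˢ Icc a b) :=
    (((continuous_const.sub continuous_fst).continuousOn).smul hG2).add
      (continuous_fst.smul continuous_const).continuousOn
  have e0 := hU 0 (by simp)
  have e0' := hU' 0 (by simp)
  rw [sub_zero, one_smul, zero_smul, add_zero] at e0 e0'
  have h1 := genMaslovIndex_homotopy (L := fun r t => pairLag ((1 - r) • G t + r • 1) (F t)) hab.le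
    (continuousOn_pairLag hX hF2 fun p hp => hpair p.1 hp.1 p.2 hp.2) fun r hr =>
      isAdmissiblePath_pairLag ((hG.const_smul (1 - r)).add continuousOn_const) hF (hpair r hr) e0 hc
        hab.le (eq_zero_of_isUnit e0) (eq_zero_of_isUnit e0')
  -- then deform `F` to the segment between the signs
  have hpair2 : ∀ s t : ℝ, t ∈ Icc a b → IsLagPair 1 ((1 - s) • F t + s • T t) := fun s t ht =>
    isLagPair_one_left ((IsSelfAdjoint.smul (.all _) (hFs t ht)).add
      (IsSelfAdjoint.smul (.all _) (isSelfAdjoint_segment isSelfAdjoint_signOp isSelfAdjoint_signOp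
        a b t)))
  have hTc : Continuous T := continuous_segment a b
  have hY : ContinuousOn (fun p : ℝ × ℝ => (1 - p.1) • F p.2 + p.1 • T p.2)
      (Icc 0 1 ×ˢ Icc a b) :=
    (((continuous_const.sub continuous_fst).continuousOn).smul hF2).add
      (continuous_fst.smul (hTc.comp continuous_snd)).continuousOn
  have h2 := genMaslovIndex_homotopy (L := fun s t => pairLag 1 ((1 - s) • F t + s • T t)) hab.le
    (continuousOn_pairLag continuousOn_const hY fun p hp => hpair2 p.1 p.2 hp.2) fun s hs =>
      isAdmissiblePath_pairLag continuousOn_const ((hF.const_smul (1 - s)).add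
        (hTc.const_smul s).continuousOn) (hpair2 s) (hU s hs) (fun t ht => by
          have e : (1 - s) • F t + s • T t - ((1 - s) • F a + s • signOp (F a)) =
              (1 - s) • (F t - F a) + s • (T t - signOp (F a)) := by module
          rw [e]
          exact ((hc t ht).smul _).add ((isCompactOperator_segment_sub hJ a b t).smul _))
        hab.le (by rw [hT, segment_left]; exact eq_zero_of_isUnit (hU s hs))
        (by rw [hT, segment_right hab]; exact eq_zero_of_isUnit (hU' s hs))
  simp only [sub_zero, one_smul, zero_smul, add_zero, sub_self, zero_add] at h1 h2
  exact h1.trans h2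

end Deformation

/-- The path `L` consists of the graphs of `A + K t`, for an operator `A` independent of `t`. This
is expressed without `A`: adding `K t' - K t` maps `L t` into `L t'`. -/
def IsPerturbation (L : ℝ → LagGr H) (K : ℝ → H →L[ℝ] H) (s : Set ℝ) : Prop :=
  ∀ t ∈ s, ∀ t' ∈ s, ∀ z ∈ (L t).1,
    (WithLp.toLp 2 (z.fst, z.snd + (K t' - K t) z.fst) : SympSpace H) ∈ (L t').1

section Perturbation

variable {L : ℝ → LagGr H} {K : ℝ → H →L[ℝ] H} {s : Set ℝ}

/-- The signs of the operators `dres (L t)` are at most as far apart as the perturbations. -/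
theorem IsPerturbation.norm_signOp_sub_le (h : IsPerturbation L K s)
    (hL : ∀ t ∈ s, IsGraphLike (L t)) {t t' : ℝ} (ht : t ∈ s) (ht' : t' ∈ s) :
    ‖signOp (dres (L t')) - signOp (dres (L t))‖ ≤ ‖K t' - K t‖ :=
  (SpecFlow.norm_signOp_sub_le (isSelfAdjoint_dres _) (norm_dres_le _) (hL t ht).dres_injective
    (isSelfAdjoint_dres _) (norm_dres_le _) (dres_sub_dres (h t ht t' ht'))).trans
    (norm_sympDiag_neg_le _)

theorem IsPerturbation.isCompactOperator (h : IsPerturbation L K s)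
    (hL : ∀ t ∈ s, IsGraphLike (L t)) (hK : ∀ t ∈ s, IsCompactOperator (K t)) {t t' : ℝ}
    (ht : t ∈ s) (ht' : t' ∈ s) :
    IsCompactOperator (polarF (L t') - polarF (L t) : H →L[ℝ] H) := by
  have h1 : IsCompactOperator (K t' - K t : H →L[ℝ] H) := (hK t' ht').sub (hK t ht)
  exact isCompactOperator_polar_sub (isCompactOperator_signOp_sub (isSelfAdjoint_dres _)
    (norm_dres_le _) (hL t ht).dres_injective (isSelfAdjoint_dres _) (norm_dres_le _)
    (dres_sub_dres (h t ht t' ht')) (isCompactOperator_sympDiag h1 h1.neg))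

theorem continuousOn_of_norm_sub_le {E E' : Type*} [SeminormedAddCommGroup E]
    [SeminormedAddCommGroup E'] {f : ℝ → E} {g : ℝ → E'} (hf : ContinuousOn f s)
    (h : ∀ t ∈ s, ∀ t' ∈ s, ‖g t' - g t‖ ≤ ‖f t' - f t‖) : ContinuousOn g s := by
  intro t ht
  have h1 := tendsto_iff_norm_sub_tendsto_zero.1 (hf t ht)
  refine tendsto_iff_norm_sub_tendsto_zero.2 (squeeze_zero' (.of_forall fun _ => norm_nonneg _) ?_ h1)
  filter_upwards [self_mem_nhdsWithin] with t' ht'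
  exact h t ht t' ht'

theorem IsPerturbation.continuousOn (h : IsPerturbation L K s)
    (hL : ∀ t ∈ s, IsGraphLike (L t)) (hK : ContinuousOn K s) :
    ContinuousOn (fun t => polarF (L t)) s ∧ ContinuousOn (fun t => polarG (L t)) s :=
  ⟨continuousOn_of_norm_sub_le hK fun _ ht _ ht' => (norm_polar_sub_le _ _).1.trans
      (h.norm_signOp_sub_le hL ht ht'),
    continuousOn_of_norm_sub_le hK fun _ ht _ ht' => (norm_polar_sub_le _ _).2.trans
      (h.norm_signOp_sub_le hL ht ht')⟩

/-- The Maslov index of a path of compact perturbations is the index of the segment between the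
signs of its end points. -/
theorem IsPerturbation.genMaslovIndex_eq {a b : ℝ} (hab : a < b)
    (h : IsPerturbation L K (Icc a b))
    (hL : ∀ t ∈ Icc a b, IsGraphLike (L t)) (hKc : ContinuousOn K (Icc a b))
    (hK : ∀ t ∈ Icc a b, IsCompactOperator (K t)) (hadm : IsAdmissiblePath L a b)
    (ha : IsClosed (WithLp.snd '' ((L a).1 : Set (SympSpace H))))
    (hb : IsClosed (WithLp.snd '' ((L b).1 : Set (SympSpace H)))) :
    genMaslovIndex L a b = genMaslovIndex (fun t => pairLag 1
      (segment (signOp (polarF (L a))) (signOp (polarF (L b))) a b t)) a b := by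
  have hma := left_mem_Icc.2 hab.le
  have hmb := right_mem_Icc.2 hab.le
  refine (genMaslovIndex_congr hab.le hadm fun t ht => eq_pairLag_polar (hL t ht)).trans ?_
  obtain ⟨h1, h2⟩ := h.continuousOn hL hKc
  exact genMaslovIndex_eq_segment hab h1 h2 (fun t ht => isSelfAdjoint_polarF (hL t ht))
    (fun t ht => norm_polarF_le (hL t ht)) (fun r hr t ht => isLagPair_polar (hL t ht) hr)
    (fun t ht => h.isCompactOperator hL hK hma ht) (exists_bound_polarF (hL a hma) hadm.left ha)
    (exists_bound_polarF (hL b hmb) hadm.right hb)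

/-- The dimension formula for a path of compact perturbations, in terms of the signs of its end
points. -/
theorem IsPerturbation.finrank_sub {a b : ℝ} (hab : a ≤ b)
    (h : IsPerturbation L K (Icc a b))
    (hL : ∀ t ∈ Icc a b, IsGraphLike (L t)) (hKc : ContinuousOn K (Icc a b))
    (hK : ∀ t ∈ Icc a b, IsCompactOperator (K t)) (hadm : IsAdmissiblePath L a b)
    (ha : IsClosed (WithLp.snd '' ((L a).1 : Set (SympSpace H))))
    (hb : IsClosed (WithLp.snd '' ((L b).1 : Set (SympSpace H)))) :
    FiniteDimensional ℝ
      ↥((-signOp (polarF (L a)) - 1).ker ⊓ (signOp (polarF (L b)) - 1).ker) ∧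
    FiniteDimensional ℝ
      ↥((-signOp (polarF (L b)) - 1).ker ⊓ (signOp (polarF (L a)) - 1).ker) ∧
    genMaslovIndex L a b =
      (Module.finrank ℝ
        ↥((-signOp (polarF (L a)) - 1).ker ⊓ (signOp (polarF (L b)) - 1).ker) : ℤ) -
      Module.finrank ℝ
        ↥((-signOp (polarF (L b)) - 1).ker ⊓ (signOp (polarF (L a)) - 1).ker) := by
  rcases hab.eq_or_lt with rfl | hab
  · have hbot : (-signOp (polarF (L a)) - 1).ker ⊓ (signOp (polarF (L a)) - 1).ker = ⊥ := by
      rw [Submodule.eq_bot_iff]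
      rintro v ⟨h1, h2⟩
      have h1' : -signOp (polarF (L a)) v = v := sub_eq_zero.1 h1
      have h2' : signOp (polarF (L a)) v = v := sub_eq_zero.1 h2
      rw [h2'] at h1'
      have h3 : (2 : ℝ) • v = 0 := by rw [two_smul, ← neg_add_cancel v, h1']
      exact (smul_eq_zero.1 h3).resolve_left two_ne_zero
    rw [hbot]
    refine ⟨inferInstance, inferInstance, ?_⟩
    rw [sub_self]
    refine genMaslovIndex_eq_zero le_rfl hadm fun t ht => ?_
    rw [Icc_self, mem_singleton_iff] at ht
    exact ht ▸ hadm.left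
  · have hma := left_mem_Icc.2 hab.le
    have hmb := right_mem_Icc.2 hab.le
    obtain ⟨c, hc, hcb⟩ := exists_bound_polarF (hL a hma) hadm.left ha
    rw [h.genMaslovIndex_eq hab hL hKc hK hadm ha hb]
    exact genMaslovIndex_segment isSelfAdjoint_signOp signOp_mul_self isSelfAdjoint_signOp
      signOp_mul_self (isCompactOperator_signOp_sub_of_invertible (isSelfAdjoint_polarF (hL a hma))
        (norm_polarF_le (hL a hma)) hc hcb (isSelfAdjoint_polarF (hL b hmb))
        (norm_polarF_le (hL b hmb)) (h.isCompactOperator hL hK hma hmb)) hab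

end Perturbation

section Operators

omit [CompleteSpace H] in
theorem mem_graphS_vadd {A : H →ₗ.[ℝ] H} {K : H →L[ℝ] H} {z : SympSpace H} :
    z ∈ graphS ((K : H →ₗ[ℝ] H) +ᵥ A) ↔
      (WithLp.toLp 2 (z.fst, z.snd - K z.fst) : SympSpace H) ∈ graphS A := by
  rw [mem_graphS, mem_graphS]
  refine exists_congr fun x => and_congr_right fun hx => ?_
  change K (x : H) + A x = z.snd ↔ A x = z.snd - K z.fst
  rw [← hx, eq_sub_iff_add_eq, add_comm]

theorem CGap.isGraphLike (A : CGap H) : IsGraphLike A.graph := fun y hy => by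
  obtain ⟨x, hx, hx'⟩ := CGap.mem_graph.1 hy
  have h0 : x = 0 := Subtype.ext hx
  rw [h0, LinearPMap.map_zero] at hx'
  exact hx'.symm

theorem CGap.isClosed_snd_image (A : CGap H) :
    IsClosed (WithLp.snd '' (A.graph.1 : Set (SympSpace H))) := by
  convert A.fredholm.2.1 using 1
  ext y
  constructor
  · rintro ⟨z, hz, rfl⟩
    obtain ⟨x, -, hx⟩ := CGap.mem_graph.1 hz
    exact ⟨x, hx⟩
  · rintro ⟨x, rfl⟩
    exact ⟨WithLp.toLp 2 ((x : H), A.op x), CGap.mem_graph.2 ⟨x, rfl, rfl⟩, rfl⟩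

theorem isPerturbation_graph {𝒜 : ℝ → CGap H} {A : H →ₗ.[ℝ] H} {K : ℝ → H →L[ℝ] H} {s : Set ℝ}
    (h : ∀ t ∈ s, (𝒜 t).op = (K t : H →ₗ[ℝ] H) +ᵥ A) :
    IsPerturbation (fun t => (𝒜 t).graph) K s := by
  intro t ht t' ht' z hz
  change z ∈ graphS (𝒜 t).op at hz
  change _ ∈ graphS (𝒜 t').op
  rw [h t ht, mem_graphS_vadd] at hz
  rw [h t' ht', mem_graphS_vadd]
  convert hz using 1
  refine SympSpace.ext rfl ?_
  change z.snd + (K t' z.fst - K t z.fst) - K t' z.fst = z.snd - K t z.fst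
  abel

theorem spectralFlow_eq_of_compact {𝒜 : ℝ → CGap H} {a b : ℝ} (hab : a ≤ b)
    (h : IsAdmissible 𝒜 a b) {A : H →ₗ.[ℝ] H} {K : ℝ → H →L[ℝ] H}
    (hKc : ContinuousOn K (Icc a b)) (hK : ∀ t ∈ Icc a b, IsCompactOperator (K t))
    (hA : ∀ t ∈ Icc a b, (𝒜 t).op = (K t : H →ₗ[ℝ] H) +ᵥ A) :
    FiniteDimensional ℝ ↥(negSpectralSubspace (𝒜 a).op ⊓ posSpectralSubspace (𝒜 b).op) ∧
    FiniteDimensional ℝ ↥(negSpectralSubspace (𝒜 b).op ⊓ posSpectralSubspace (𝒜 a).op) ∧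
    spectralFlow 𝒜 a b =
      (Module.finrank ℝ ↥(negSpectralSubspace (𝒜 a).op ⊓ posSpectralSubspace (𝒜 b).op) : ℤ) -
      Module.finrank ℝ ↥(negSpectralSubspace (𝒜 b).op ⊓ posSpectralSubspace (𝒜 a).op) := by
  have ha : IsTransverse (𝒜 a).graph := CGap.isTransverse_graph.2 h.2.1
  have hb : IsTransverse (𝒜 b).graph := CGap.isTransverse_graph.2 h.2.2
  have key := (isPerturbation_graph hA).finrank_sub hab (fun t _ => (𝒜 t).isGraphLike) hKc hK
    h.isAdmissiblePath (𝒜 a).isClosed_snd_image (𝒜 b).isClosed_snd_image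
  have e1 : posSpectralSubspace (𝒜 a).op = (signOp (polarF (𝒜 a).graph) - 1).ker :=
    posSpectralSubspace_eq_of_polar rfl (𝒜 a).isGraphLike ha
  have e2 : posSpectralSubspace (𝒜 b).op = (signOp (polarF (𝒜 b).graph) - 1).ker :=
    posSpectralSubspace_eq_of_polar rfl (𝒜 b).isGraphLike hb
  have e3 : negSpectralSubspace (𝒜 a).op = (-signOp (polarF (𝒜 a).graph) - 1).ker :=
    negSpectralSubspace_eq_of_polar rfl (𝒜 a).isGraphLike ha
  have e4 : negSpectralSubspace (𝒜 b).op = (-signOp (polarF (𝒜 b).graph) - 1).ker :=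
    negSpectralSubspace_eq_of_polar rfl (𝒜 b).isGraphLike hb
  rw [e1, e2, e3, e4]
  exact key

end Operators

end CompactPerturbation

end

end SpecFlow

theorem proposition3 {H : Type*} [NormedAddCommGroup H] [InnerProductSpace ℝ H] [CompleteSpace H]
    [TopologicalSpace.SeparableSpace H] :
    -- the spectral flow of an admissible path is a well-defined integer
    (∀ (𝒜 : ℝ → CGap H) (a b : ℝ), a ≤ b → IsAdmissible 𝒜 a b →
      ∀ m : ℤ, HasGenMaslovIndex (fun t => (𝒜 t).graph) a b m ↔ m = spectralFlow 𝒜 a b) ∧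
    -- (i) normalization
    (∀ (𝒜 : ℝ → CGap H) (a b : ℝ), a ≤ b → IsAdmissible 𝒜 a b →
      (∀ t ∈ Icc a b, (𝒜 t).Injective) → spectralFlow 𝒜 a b = 0) ∧
    -- (ii) homotopy invariance
    (∀ (ℋ : ℝ → ℝ → CGap H) (a b : ℝ), a ≤ b →
      ContinuousOn (fun p : ℝ × ℝ => ℋ p.1 p.2) (Icc 0 1 ×ˢ Icc a b) →
      (∀ s ∈ Icc (0 : ℝ) 1, IsAdmissible (ℋ s) a b) →
      spectralFlow (ℋ 0) a b = spectralFlow (ℋ 1) a b) ∧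
    -- (iii) concatenation
    (∀ (𝒜 : ℝ → CGap H) (a c b : ℝ), a ≤ c → c ≤ b →
      IsAdmissible 𝒜 a c → IsAdmissible 𝒜 c b →
      spectralFlow 𝒜 a b = spectralFlow 𝒜 a c + spectralFlow 𝒜 c b) ∧
    -- (iv) compact perturbations
    (∀ (𝒜 : ℝ → CGap H) (a b : ℝ), a ≤ b → IsAdmissible 𝒜 a b →
      ∀ (A : H →ₗ.[ℝ] H) (K : ℝ → H →L[ℝ] H), ContinuousOn K (Icc a b) →
      (∀ t ∈ Icc a b, IsCompactOperator (K t)) →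
      (∀ t ∈ Icc a b, (𝒜 t).op = (K t : H →ₗ[ℝ] H) +ᵥ A) →
      FiniteDimensional ℝ
        ↥(negSpectralSubspace (𝒜 a).op ⊓ posSpectralSubspace (𝒜 b).op) ∧
      FiniteDimensional ℝ
        ↥(negSpectralSubspace (𝒜 b).op ⊓ posSpectralSubspace (𝒜 a).op) ∧
      spectralFlow 𝒜 a b =
        (Module.finrank ℝ ↥(negSpectralSubspace (𝒜 a).op ⊓ posSpectralSubspace (𝒜 b).op) : ℤ) -
        (Module.finrank ℝ ↥(negSpectralSubspace (𝒜 b).op ⊓ posSpectralSubspace (𝒜 a).op) : ℤ)) := by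
  refine ⟨fun 𝒜 a b hab h m => hasGenMaslovIndex_iff_eq hab h.isAdmissiblePath m,
    fun 𝒜 a b hab h h0 => genMaslovIndex_eq_zero hab h.isAdmissiblePath fun t ht =>
      CGap.isTransverse_graph.2 (h0 t ht),
    fun ℋ a b hab hc h => genMaslovIndex_homotopy hab
      (CGap.continuous_graph.comp_continuousOn hc) fun s hs => (h s hs).isAdmissiblePath,
    fun 𝒜 a c b hac hcb h₁ h₂ =>
      genMaslovIndex_concat hac hcb h₁.isAdmissiblePath h₂.isAdmissiblePath,
    fun 𝒜 a b hab h A K hKc hK hA => spectralFlow_eq_of_compact hab h hKc hK hA⟩
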